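/- **Setting.** Let $G$ be a finite Feynman graph (a multigraph; parallel edges and self-loops are allowed) with $N$ edges, all of them massless propagators, and with external lines $p_1,\dots,p_K$, $q_1,\dots,q_L$ attached to vertices. The external momenta depend on a scaling variable $\lambda\to 0^+$, sum to zero, and are in wide-angle kinematics with hard scale $1$: $p_i^2\sim\lambda$, $q_j^2\sim 1$, $p_i\cdot p_j\sim 1$ for $i\neq j$, and $(\sum_{\ell\in X}k_\ell)^2\sim 1$ for every nonempty proper set $X$ of external lines such that neither $X$ nor its complement is a single $\{p_i\}$. A graph is *one-vertex irreducible* (1VI) if it is connected and remains connected after any one of its vertices is removed, where lines ending at the removed vertex are kept as open lines (so a self-loop is a 1VI component by itself). A subgraph is *mojetic* if it becomes 1VI once all its external lines are joined to one auxiliary vertex. Assume that $G$ itself is mojetic (equivalently, it contains no scaleless subgraph joined to the rest at a single vertex). Let $\mathcal P=\mathcal U+\mathcal F$ be the Lee–Pomeransky polynomial, where $$\mathcal U=\sum_{T^1}\prod_{e\notin T^1}x_e,\qquad \mathcal F=-\sum_{T^2}s_{T^2}\prod_{e\notin T^2}x_e,$$ $T^1$ runs over the spanning trees, $T^2$ over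 the spanning 2-trees of $G$, and $s_{T^2}$ is the square of the total external momentum entering one component of $T^2$. Its Newton polytope $\Delta\subset\mathbb R^{N+1}$ is the convex hull of the points $(m_1,\dots,m_N;w)$, where $x_1^{m_1}\cdots x_N^{m_N}$ is a monomial of $\mathcal P$ whose coefficient scales as $\lambda^w$. **Configurations.** Every edge is assigned to one of $H$ (hard), $J_1,\dots,J_K$ (jets), $S$ (soft); the external line $p_i$ counts as a line of $J_i$ and the $q_j$ count as lines of $H$. A vertex belongs to $S$ if all lines at it are soft; to $J_i$ if some line at it is in $J_i$ and all others are in $J_i$ or $S$; and to $H$ otherwise. A line may belong to a subgraph that does not contain its endpoints, and it is connected within the subgraph only through endpoints that belong to it. Two of these subgraphs are *attached* if a line of one of them ends at a vertex of the other. The configuration satisfies the *basic requirements*: * $H$ is connected and contains the vertices at which the $q_j$ enter; * each $J_i$ is connected, is attached to $H$, and $p_i$ is the only external line that may enter at a vertex of $J_i$ (a trivial jet, consisting of $p_i$ only, is allowed); * no external line enters at a vertex of $S$, and each connected component of $S$ is attached to $H\cup J_1\cup\dots\cup J_K$. Put $v_R=(u_{R,1},\dots,u_{R,N};1)$, where $u_{R,e}=0,-1,-2$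 for $e$ in $H$, in a jet, in $S$, respectively. The configuration is a *region* of the on-shell expansion if $v_R$ is an inward-pointing normal vector of a lower facet of $\Delta$, that is, if the face of $\Delta$ on which $r\mapsto r\cdot v_R$ is minimal has dimension $N$. **Theorem.** A configuration satisfying the basic requirements is a region if and only if both of the following hold: 1. for every $i\in\{1,\dots,K\}$, the subgraph $H\cup J\setminus J_i=H\cup\bigcup_{j\neq i}J_j$ (whose external lines are $q_1,\dots,q_L$ and the $p_j$ with $j\neq i$) is mojetic; 2. every connected component of $S$ is attached to at least two different jets. -/

import Mathlib

open Asymptotics Filter Topology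

/-- External lines: `Sum.inl i` carries the nearly on-shell momentum `p_i` (`K` of them),
`Sum.inr j` carries the off-shell momentum `q_j` (`L` of them). -/
abbrev Leg (K L : ℕ) : Type := Fin K ⊕ Fin L

/-- Lines of a graph: internal edges (propagators) and external lines. -/
abbrev Line (E : Type*) (K L : ℕ) := E ⊕ Leg K L

/-- Cells of a graph: vertices and lines. -/
abbrev Cell (V E : Type*) (K L : ℕ) := V ⊕ Line E K L

/-- A Feynman graph with massless propagators: a multigraph (parallel edges and self-loops are
allowed) with vertices `V`, edges `E`, and external lines attached to vertices. -/
structure FeynmanGraph (V E : Type*) (K L : ℕ) where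
  /-- the endpoints of an edge -/
  ends : E → Sym2 V
  /-- the vertex at which an external line enters -/
  att : Leg K L → V

/-- The three kinds of modes: hard, collinear to `p_i` (jet `i`), soft. -/
inductive Mode (K : ℕ) : Type
  | hard : Mode K
  | jet (i : Fin K) : Mode K
  | soft : Mode K

/-- Wide-angle kinematics of the on-shell expansion. `k ℓ lam` is the momentum entering through
the external line `ℓ` at the value `lam` of the scaling variable, and `Q k` is the square `k²`
(the Minkowski square, or any quadratic form). The hard scale is the unit, and `f =Θ[𝓝[>] 0] g`
says that `f` and `g` are of the same order as `lam → 0+`. -/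
structure WideAngle {M : Type*} [AddCommGroup M] [Module ℝ M] {K L : ℕ}
    (Q : QuadraticForm ℝ M) (k : Leg K L → ℝ → M) : Prop where
  /-- momentum conservation -/
  conserved : ∀ᶠ lam in 𝓝[>] (0 : ℝ), ∑ ℓ, k ℓ lam = 0
  /-- `p_i² ~ lam` -/
  onShell : ∀ i : Fin K, (fun lam => Q (k (Sum.inl i) lam)) =Θ[𝓝[>] 0] fun lam : ℝ => lam
  /-- `q_j² ~ 1` -/
  offShell : ∀ j : Fin L, (fun lam => Q (k (Sum.inr j) lam)) =Θ[𝓝[>] 0] fun _ : ℝ => (1 : ℝ)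
  /-- `p_i · p_j ~ 1` for `i ≠ j` (`QuadraticMap.polar Q x y = 2 x·y`) -/
  wideAngle : ∀ i j : Fin K, i ≠ j →
    (fun lam => QuadraticMap.polar Q (k (Sum.inl i) lam) (k (Sum.inl j) lam))
      =Θ[𝓝[>] 0] fun _ : ℝ => (1 : ℝ)
  /-- The external momenta are non-exceptional: all invariants `(∑_{ℓ ∈ X} k_ℓ)²` other than the
  `p_i²` are large. -/
  nonexceptional : ∀ X : Finset (Leg K L), X.Nonempty → X ≠ Finset.univ →
    (∀ i : Fin K, X ≠ {Sum.inl i} ∧ Xᶜ ≠ {Sum.inl i}) →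
    (fun lam => Q (∑ ℓ ∈ X, k ℓ lam)) =Θ[𝓝[>] 0] fun _ : ℝ => (1 : ℝ)

/-- The Newton polytope in `ℝ^{N+1}` of a polynomial in the variables `x_e`, `e : E`, whose
coefficients depend on `lam`: the convex hull of the exponent vectors of its monomials, where the
coordinate `some e` is the exponent of `x_e` and the coordinate `none` is the exponent `w` of `lam`
with which the coefficient scales, `c(lam) ~ lam ^ w`. (A vanishing coefficient has no such `w`.) -/
def newtonPolytope {E : Type*} (P : MvPolynomial E (ℝ → ℝ)) : Set (Option E → ℝ) :=
  convexHull ℝ {r | ∃ (m : E →₀ ℕ) (w : ℕ),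
    (MvPolynomial.coeff m P) =Θ[𝓝[>] 0] (fun lam : ℝ => lam ^ w) ∧
    r none = w ∧ ∀ e, r (some e) = m e}

/-- The face of a set `Δ` on which the linear functional `r ↦ r · v` is minimal. -/
def minFace {E : Type*} [Fintype E] (Δ : Set (Option E → ℝ)) (v : Option E → ℝ) :
    Set (Option E → ℝ) :=
  {r ∈ Δ | ∀ r' ∈ Δ, r ⬝ᵥ v ≤ r' ⬝ᵥ v}

/-- `v` is an inward normal of a lower facet of `Δ ⊆ ℝ^{N+1}`: its component in the `lam` direction
is positive, and the face with inward normal `v` has codimension one, i.e. dimension `N`. -/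
def IsLowerFacetNormal {E : Type*} [Fintype E] (Δ : Set (Option E → ℝ)) (v : Option E → ℝ) :
    Prop :=
  0 < v none ∧ (minFace Δ v).Nonempty ∧
    Module.finrank ℝ (vectorSpan ℝ (minFace Δ v)) = Fintype.card E

/-- The vector `v_R = (u_R; 1)` of a configuration, with `u_{R,e} = 0, -1, -2` for hard, jet and
soft edges `e`. -/
def regionVector {E : Type*} {K : ℕ} (R : E → Mode K) : Option E → ℝ
  | none => 1
  | some e =>
    match R e with
    | .hard => 0
    | .jet _ => -1
    | .soft => -2

namespace FeynmanGraph

variable {V E : Type*} {K L : ℕ} (G : FeynmanGraph V E K L)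

section Symanzik

/-- The simple graph on all vertices that joins `u ≠ v` when some edge in `T` has endpoints
`u, v`. It records which vertices are joined through the edges of `T`. -/
def joins (T : Set E) : SimpleGraph V :=
  SimpleGraph.fromRel fun u v => ∃ e ∈ T, G.ends e = s(u, v)

/-- `T` contains no loop: removing any edge of `T` disconnects its endpoints. -/
def IsForest (T : Set E) : Prop :=
  ∀ e ∈ T, ∀ u v, G.ends e = s(u, v) → ¬ (G.joins (T \ {e})).Reachable u v

/-- `T` is (the edge set of) a spanning tree. -/
def IsSpanningTree (T : Set E) : Prop :=
  G.IsForest T ∧ (G.joins T).Connected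

/-- `T` is (the edge set of) a spanning 2-tree: a spanning forest with two components. -/
def IsSpanningTwoTree (T : Set E) : Prop :=
  G.IsForest T ∧ Nat.card (G.joins T).ConnectedComponent = 2

variable {M : Type*} [AddCommGroup M] [Module ℝ M]

open Classical in
/-- The square of the total external momentum flowing into the `T`-component of the vertex `v`. -/
noncomputable def momentumSq (Q : QuadraticForm ℝ M) (k : Leg K L → ℝ → M) (T : Set E) (v : V) :
    ℝ → ℝ :=
  fun lam => Q (∑ ℓ with (G.joins T).Reachable v (G.att ℓ), k ℓ lam)

open Classical in
/-- The first Symanzik polynomial. -/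
noncomputable def symanzikU [Fintype E] : MvPolynomial E (ℝ → ℝ) :=
  ∑ T : Set E with G.IsSpanningTree T, ∏ e with e ∉ T, MvPolynomial.X e

open Classical in
/-- The second Symanzik polynomial (massless propagators), at kinematics depending on `lam`. Of the
two components of a 2-tree, the one that contains a fixed vertex is taken; by momentum conservation
the other one gives the same square. -/
noncomputable def symanzikF [Nonempty V] [Fintype E] (Q : QuadraticForm ℝ M)
    (k : Leg K L → ℝ → M) : MvPolynomial E (ℝ → ℝ) :=
  - ∑ T : Set E with G.IsSpanningTwoTree T,
      MvPolynomial.C (G.momentumSq Q k T (Classical.arbitrary V)) *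
        ∏ e with e ∉ T, MvPolynomial.X e

/-- The Lee-Pomeransky polynomial `U + F`. -/
noncomputable def leePomeransky [Nonempty V] [Fintype E] (Q : QuadraticForm ℝ M)
    (k : Leg K L → ℝ → M) : MvPolynomial E (ℝ → ℝ) :=
  G.symanzikU + G.symanzikF Q k

/-- The configuration `R` is a region of the on-shell expansion: its vector `v_R` is an inward
normal of a lower facet of the Newton polytope of the Lee-Pomeransky polynomial. -/
def IsRegion [Nonempty V] [Fintype E] (Q : QuadraticForm ℝ M) (k : Leg K L → ℝ → M)
    (R : E → Mode K) : Prop :=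
  IsLowerFacetNormal (newtonPolytope (G.leePomeransky Q k)) (regionVector R)

end Symanzik

section Subgraphs

/-- The line `l` ends at the vertex `v`. -/
def OnLine (v : V) : Line E K L → Prop
  | .inl e => v ∈ G.ends e
  | .inr ℓ => G.att ℓ = v

/-- The incidence graph on all cells: a vertex is adjacent to the lines that end there. A subgraph
is a set of cells. A line may belong to a subgraph without its endpoints (an open line), and it is
connected to the rest of the subgraph only through those of its endpoints that belong to it. -/
def incidence : SimpleGraph (Cell V E K L) :=
  SimpleGraph.fromRel fun a b => ∃ v l, a = .inl v ∧ b = .inr l ∧ G.OnLine v l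

/-- The incidence graph after all external lines are joined to an auxiliary vertex `none`. -/
def joined : SimpleGraph (Option (Cell V E K L)) :=
  SimpleGraph.fromRel fun a b =>
    (∃ x y, a = some x ∧ b = some y ∧ G.incidence.Adj x y) ∨
    (a = none ∧ ∃ ℓ : Leg K L, b = some (.inr (.inr ℓ)))

/-- The subgraph `γ` is mojetic: after joining all its external lines to an auxiliary vertex it is
one-vertex irreducible, i.e. it is connected and it remains connected after any one of its vertices
(the auxiliary one included) is removed. Removing a vertex leaves the lines that end there; a
self-loop at it is then left alone, so that a self-loop counts as a one-vertex-irreducible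
component of its own. -/
def IsMojetic (γ : Set (Cell V E K L)) : Prop :=
  (G.joined.induce (insert none (some '' γ))).Connected ∧
  (G.joined.induce (some '' γ)).Connected ∧
  ∀ v : V, Sum.inl v ∈ γ →
    (G.joined.induce (insert none (some '' γ) \ {some (Sum.inl v)})).Connected

/-- The mode of a line: edges as prescribed by `R`; the external line `p_i` belongs to the jet
`i`, the external lines `q_j` are hard. -/
def lineMode (R : E → Mode K) : Line E K L → Mode K
  | .inl e => R e
  | .inr (.inl i) => .jet i
  | .inr (.inr _) => .hard

/-- The soft subgraph `S`: a vertex is in `S` iff it meets soft lines only. -/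
def softPart (R : E → Mode K) : Set (Cell V E K L)
  | .inl v => ∀ l, G.OnLine v l → lineMode R l = .soft
  | .inr l => lineMode (L := L) R l = .soft

/-- The jet subgraph `J_i`: a vertex is in `J_i` iff it meets a line of `J_i`, and otherwise only
lines of `J_i` and soft lines. -/
def jetPart (R : E → Mode K) (i : Fin K) : Set (Cell V E K L)
  | .inl v => (∃ l, G.OnLine v l ∧ lineMode R l = .jet i) ∧
      ∀ l, G.OnLine v l → lineMode R l = .jet i ∨ lineMode R l = .soft
  | .inr l => lineMode (L := L) R l = .jet i

/-- The hard subgraph `H`: it has the hard lines and all vertices that are not in `S` or a jet. -/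
def hardPart (R : E → Mode K) : Set (Cell V E K L)
  | .inl v => Sum.inl v ∉ G.softPart R ∧ ∀ i, Sum.inl v ∉ G.jetPart R i
  | .inr l => lineMode (L := L) R l = .hard

/-- Some cell of `A` is incident with some cell of `B`. -/
def Attached (A B : Set (Cell V E K L)) : Prop :=
  ∃ x ∈ A, ∃ y ∈ B, G.incidence.Adj x y

/-- `C` is a connected component of the subgraph `γ`. -/
def IsComponent (γ C : Set (Cell V E K L)) : Prop :=
  ∃ c : (G.incidence.induce γ).ConnectedComponent, C = Subtype.val '' c.supp

/-- The basic requirements on the hard, jet and soft subgraphs. A trivial jet, which consists of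
the external line `p_i` only, is allowed; `p_i` then enters at a vertex of `H`. -/
structure BasicRequirements (R : E → Mode K) : Prop where
  hard_connected : (G.incidence.induce (G.hardPart R)).Connected
  hard_offShell : ∀ j : Fin L, Sum.inl (G.att (Sum.inr j)) ∈ G.hardPart R
  jet_connected : ∀ i, (G.incidence.induce (G.jetPart R i)).Connected
  jet_attached : ∀ i, G.Attached (G.jetPart R i) (G.hardPart R)
  jet_external : ∀ i ℓ, Sum.inl (G.att ℓ) ∈ G.jetPart R i → ℓ = Sum.inl i
  soft_external : ∀ ℓ, Sum.inl (G.att ℓ) ∉ G.softPart R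
  soft_attached : ∀ C, G.IsComponent (G.softPart R) C →
    G.Attached C (G.hardPart R ∪ ⋃ i, G.jetPart R i)

end Subgraphs

end FeynmanGraph

/-! The face selected by `v_R` is a facet exactly when no nonzero `α : E → ℝ` has the same sum over
the edge sets `T` of all terms of minimal weight (`isRegion_iff`). The theorem thus becomes a
statement about weighted spanning trees and 2-trees. The weight of an edge is 2 - [hard] -
[nonsoft]. Since |F| + c(F) = |V| for a forest with c(F) components, `T` has weight c(T ∩ hard) +
c(T ∩ nonsoft) - 2 c(T). A spanning tree is minimal iff it restricts to maximal forests of the hard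
and of the nonsoft edges. A minimal 2-tree has a budget of exactly two units, shared between
additional hard components, additional nonsoft components and the exponent w
(`IsSpanningTwoTree.numComp_of_minWeight`). One unit always goes into a nonsoft component, because
external lines enter on both sides.

Necessity: every violation of the two conditions produces an `α`. In a minimal term, a soft
component attached to at most one jet has as many edges as vertices (`IsTerm.ncard_soft`), and so
has a part of H ∪ J \ J_i that one vertex cuts off from the external lines (`IsTerm.ncard_cut`).
Hence the indicator of these edges has constant sum. Both counts hold because `T` joins each vertex
of the part to exactly one vertex outside. A failure would use up the budget and leave w = 0 for a
2-tree that in fact separates a single `p_i`, where w = 1.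

Sufficiency: let `α` have constant sum. Exchanging edges of equal weight in minimal trees shows that
`α` is constant on the edges across a bond, that is, a partition into two connected sides, of the
hard, the nonsoft or all edges (`const_of_trees`). Enlarging one side while a crossing edge stays
keeps the value. A side that cannot be enlarged has all its exits at one vertex, or all of them in a
prescribed set `Z` (`exists_bond_single_exit`). A single exit is a cut vertex, so mojeticity forces
an external line to enter behind it, and deleting a crossing edge then gives a minimal 2-tree,
whence `α = 0` there. For a jet, the 2-tree cuts off `p_k` and w = 1 pays for the jet edge. For a
soft edge, the two attached jets are linked by it and both are detached from H: two jet edges pay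
for one soft edge, and the pair `p_i`, `p_j` has w = 0. For a hard edge, the hard vertices at which
the jets enter may be chosen freely, and a split with w = 0 is needed. Mojeticity without J_j
supplies a line other than `p_j` behind the cut vertex. -/

namespace FeynmanGraph

/-! ### Paths, forests and component counts -/

variable {V E : Type*} {K L : ℕ} (G : FeynmanGraph V E K L)

/-- `x` and `y` are joined by a path whose edges lie in `F`. -/
def Reach (F : Set E) (x y : V) : Prop := (G.joins F).Reachable x y

/-- The number of connected components of the spanning subgraph with edge set `F`. -/
noncomputable def numComp (F : Set E) : ℕ := Nat.card (G.joins F).ConnectedComponent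

/-- The edges of `F` with both endpoints in `A`. -/
def inside (F : Set E) (A : Set V) : Set E := {e ∈ F | ∀ v ∈ G.ends e, v ∈ A}

variable {G} {F X : Set E} {x y z u v : V} {e : E}

theorem inside_subset {A : Set V} : G.inside F A ⊆ F := fun _ h => h.1

theorem mem_inside {A : Set V} (he : e ∈ F) (h : G.ends e = s(u, v)) (hu : u ∈ A) (hv : v ∈ A) :
    e ∈ G.inside F A := by
  refine ⟨he, fun w hw => ?_⟩
  rw [h, Sym2.mem_iff] at hw
  rcases hw with rfl | rfl <;> assumption

theorem joins_adj : (G.joins F).Adj u v ↔ u ≠ v ∧ ∃ e ∈ F, G.ends e = s(u, v) := by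
  simp only [joins, SimpleGraph.fromRel_adj]
  constructor
  · rintro ⟨h, ⟨e, he, h'⟩ | ⟨e, he, h'⟩⟩
    · exact ⟨h, e, he, h'⟩
    · exact ⟨h, e, he, h'.trans Sym2.eq_swap⟩
  · rintro ⟨h, e, he, h'⟩
    exact ⟨h, Or.inl ⟨e, he, h'⟩⟩

theorem joins_mono (h : F ⊆ X) : G.joins F ≤ G.joins X := by
  intro u v
  simp only [joins_adj]
  rintro ⟨h1, e, he, h2⟩
  exact ⟨h1, e, h he, h2⟩

@[refl] theorem Reach.refl (x : V) : G.Reach F x x := SimpleGraph.Reachable.refl x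

theorem Reach.symm (h : G.Reach F x y) : G.Reach F y x := SimpleGraph.Reachable.symm h

theorem Reach.trans (h : G.Reach F x y) (h' : G.Reach F y z) : G.Reach F x z :=
  SimpleGraph.Reachable.trans h h'

theorem Reach.mono (hF : F ⊆ X) (h : G.Reach F x y) : G.Reach X x y :=
  SimpleGraph.Reachable.mono (joins_mono hF) h

theorem reach_of_edge (he : e ∈ F) (h : G.ends e = s(u, v)) : G.Reach F u v := by
  by_cases huv : u = v
  · subst huv; rfl
  · exact SimpleGraph.Adj.reachable (joins_adj.2 ⟨huv, e, he, h⟩)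

theorem Reach.induction (h : G.Reach F x y) (P : V → Prop) (hx : P x)
    (step : ∀ e ∈ F, ∀ u v, G.ends e = s(u, v) → G.Reach F x u → P u → P v) : P y := by
  obtain ⟨p⟩ := h
  have : ∀ (a b : V) (p : (G.joins F).Walk a b), G.Reach F x a → P a → P b := by
    intro a b p
    induction p with
    | nil => exact fun _ h => h
    | cons hadj _ ih =>
      intro hr ha
      obtain ⟨-, e, he, h'⟩ := joins_adj.1 hadj
      exact ih (hr.trans (reach_of_edge he h')) (step e he _ _ h' hr ha)
  exact this x y p (Reach.refl x) hx

theorem Reach.of_edges (h : G.Reach F x y)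
    (H : ∀ e ∈ F, ∀ u v, G.ends e = s(u, v) → G.Reach X u v) : G.Reach X x y :=
  h.induction (fun z => G.Reach X x z) (Reach.refl x) fun e he u v huv _ hu =>
    hu.trans (H e he u v huv)

/-- A path that leaves the set `S` does so by an edge that is reached inside `S`. -/
theorem Reach.first_exit {S : Set V} (h : G.Reach F x y) (hx : x ∈ S) (hy : y ∉ S) :
    ∃ e ∈ F, ∃ u ∈ S, ∃ w ∉ S, G.ends e = s(u, w) ∧ G.Reach (G.inside F S) x u := by
  by_contra hcon
  push Not at hcon
  have := h.induction (fun z => z ∈ S ∧ G.Reach (G.inside F S) x z) ⟨hx, Reach.refl x⟩ ?_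
  · exact hy this.1
  · rintro e he u v huv - ⟨hu, hr⟩
    have hv : v ∈ S := by
      by_contra hv
      exact hcon e he u hu v hv huv hr
    exact ⟨hv, hr.trans (reach_of_edge (mem_inside he huv hu hv) huv)⟩

theorem reach_empty (h : G.Reach (∅ : Set E) x y) : x = y :=
  h.induction (fun z => x = z) rfl fun _ he => absurd he (Set.notMem_empty _)

theorem reach_insert (h : G.ends e = s(u, v)) :
    G.Reach (insert e F) x y ↔ G.Reach F x y ∨ (G.Reach F x u ∧ G.Reach F v y) ∨
      (G.Reach F x v ∧ G.Reach F u y) := by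
  constructor
  · intro hr
    refine hr.induction (fun y => G.Reach F x y ∨ (G.Reach F x u ∧ G.Reach F v y) ∨
      (G.Reach F x v ∧ G.Reach F u y)) (Or.inl (Reach.refl x)) ?_
    rintro e' he' a b hab - H
    rcases he' with rfl | he'
    · have hab' : (u = a ∧ v = b) ∨ (u = b ∧ v = a) := by
        rw [h, Sym2.eq_iff] at hab; exact hab
      rcases hab' with ⟨rfl, rfl⟩ | ⟨rfl, rfl⟩
      · rcases H with H | ⟨H1, H2⟩ | ⟨H1, H2⟩
        · exact Or.inr (Or.inl ⟨H, Reach.refl _⟩)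
        · exact Or.inr (Or.inl ⟨H1, Reach.refl _⟩)
        · exact Or.inl H1
      · rcases H with H | ⟨H1, H2⟩ | ⟨H1, H2⟩
        · exact Or.inr (Or.inr ⟨H, Reach.refl _⟩)
        · exact Or.inl H1
        · exact Or.inr (Or.inr ⟨H1, Reach.refl _⟩)
    · have hr' := reach_of_edge he' hab
      rcases H with H | ⟨H1, H2⟩ | ⟨H1, H2⟩
      · exact Or.inl (H.trans hr')
      · exact Or.inr (Or.inl ⟨H1, H2.trans hr'⟩)
      · exact Or.inr (Or.inr ⟨H1, H2.trans hr'⟩)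
  · have hm : F ⊆ insert e F := Set.subset_insert e F
    have he : G.Reach (insert e F) u v := reach_of_edge (Set.mem_insert e F) h
    rintro (H | ⟨H1, H2⟩ | ⟨H1, H2⟩)
    · exact H.mono hm
    · exact ((H1.mono hm).trans he).trans (H2.mono hm)
    · exact ((H1.mono hm).trans he.symm).trans (H2.mono hm)

theorem IsForest.subset (hF : G.IsForest F) (h : X ⊆ F) : G.IsForest X :=
  fun e he u v huv hr => hF e (h he) u v huv (Reach.mono (Set.sdiff_subset_sdiff_left h) hr)

theorem isForest_empty : G.IsForest (∅ : Set E) := fun _ he => absurd he (Set.notMem_empty _)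

theorem IsForest.insert_edge (hF : G.IsForest F) (h : G.ends e = s(u, v)) (hr : ¬ G.Reach F u v) :
    G.IsForest (insert e F) := by
  intro e' he' a b hab hr'
  by_cases hee : e' = e
  · subst hee
    apply hr
    have hsub : insert e' F \ {e'} ⊆ F := by
      rintro f ⟨rfl | hf, hne⟩
      · exact absurd rfl hne
      · exact hf
    have hr2 : G.Reach F a b := Reach.mono hsub hr'
    rw [h, Sym2.eq_iff] at hab
    rcases hab with ⟨rfl, rfl⟩ | ⟨rfl, rfl⟩
    · exact hr2
    · exact hr2.symm
  · have heF : e' ∈ F := he'.resolve_left hee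
    have hsub : insert e F \ {e'} ⊆ insert e (F \ {e'}) := by
      rintro f ⟨rfl | hf, hne⟩
      · exact Set.mem_insert _ _
      · exact Or.inr ⟨hf, hne⟩
    have hm : F \ {e'} ⊆ F := Set.sdiff_subset
    have hr2 : G.Reach (insert e (F \ {e'})) a b := Reach.mono hsub hr'
    have hab' : G.Reach F a b := reach_of_edge heF hab
    rw [reach_insert h] at hr2
    rcases hr2 with H | ⟨H1, H2⟩ | ⟨H1, H2⟩
    · exact hF e' heF a b hab H
    · exact hr (((H1.mono hm).symm.trans hab').trans (H2.mono hm).symm)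
    · exact hr (((H2.mono hm).trans hab'.symm).trans (H1.mono hm))

/-- Two disjoint parts of a forest do not join the same two vertices. -/
theorem IsForest.eq_of_reach_of_disjoint [Finite E] {Y : Set E} (hF : G.IsForest F) (hX : X ⊆ F)
    (hY : Y ⊆ F) (hXY : Disjoint X Y) (h1 : G.Reach X x y) (h2 : G.Reach Y x y) : x = y := by
  by_contra hne
  have main : ∀ X : Set E, X.Finite → X ⊆ F → Disjoint X Y → G.Reach X x y → False := by
    intro X hXfin
    induction X, hXfin using Set.Finite.induction_on with
    | empty => exact fun _ _ h => hne (reach_empty h)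
    | @insert a s ha _ ih =>
      intro hs hd hr
      obtain ⟨u, v, huv⟩ : ∃ u v, G.ends a = s(u, v) := by
        induction h : G.ends a with | _ u v => exact ⟨u, v, rfl⟩
      rw [reach_insert huv] at hr
      have hsF : s ⊆ F := (Set.subset_insert a s).trans hs
      have hsa : s ⊆ F \ {a} := fun f hf => ⟨hsF hf, fun h => ha (h ▸ hf)⟩
      have hYa : Y ⊆ F \ {a} := fun f hf => ⟨hY hf, fun h =>
        Set.disjoint_left.1 hd (Set.mem_insert a s) (by rw [← Set.mem_singleton_iff.1 h]; exact hf)⟩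
      have haF := hF a (hs (Set.mem_insert a s)) u v huv
      -- If the path passes through `a`, its two remaining pieces closed up through `Y` join the
      -- ends of `a` without using `a`, which a forest forbids.
      rcases hr with H | ⟨H1, H2⟩ | ⟨H1, H2⟩
      · exact ih hsF (hd.mono_left (Set.subset_insert a s)) H
      · exact haF (((Reach.mono hsa H1).symm.trans (Reach.mono hYa h2)).trans
          (Reach.mono hsa H2).symm)
      · exact haF (((Reach.mono hsa H2).trans (Reach.mono hYa h2).symm).trans
          (Reach.mono hsa H1))
  exact main X (Set.toFinite X) hX hXY h1

variable (G) in
theorem exists_ends (e : E) : ∃ u v, G.ends e = s(u, v) := by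
  induction h : G.ends e with | _ u v => exact ⟨u, v, rfl⟩

/-- A forest inside `X` extends to a forest inside `X` with the same components as `X`. -/
theorem IsForest.exists_extension [Finite E] (hF : G.IsForest F) (hFX : F ⊆ X) :
    ∃ T, G.IsForest T ∧ F ⊆ T ∧ T ⊆ X ∧ ∀ x y, G.Reach X x y → G.Reach T x y := by
  obtain ⟨T, hFT, hT⟩ := (Set.toFinite {T : Set E | G.IsForest T ∧ T ⊆ X}).exists_le_maximal
    (a := F) ⟨hF, hFX⟩
  refine ⟨T, hT.prop.1, hFT, hT.prop.2, fun x y h => h.of_edges fun e he u v huv => ?_⟩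
  by_contra hr
  have h1 : insert e T ⊆ T := hT.le_of_ge (y := insert e T)
    ⟨hT.prop.1.insert_edge huv hr, Set.insert_subset he hT.prop.2⟩ (Set.subset_insert e T)
  exact hr (reach_of_edge (h1 (Set.mem_insert e T)) huv)

section Count

/-- If `X` joins the vertices of a list that `F ⊆ X` leaves pairwise separate, then `F` has
correspondingly more components. -/
theorem numComp_add_length_le [Finite V] (hFX : F ⊆ X) (x₀ : V) (l : List V)
    (hl : l.Pairwise fun x y => ¬ G.Reach F x y) (hX : ∀ x ∈ l, G.Reach X x x₀) :
    G.numComp X + l.length ≤ G.numComp F + 1 := by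
  classical
  have : Fintype V := Fintype.ofFinite V
  let cX := (G.joins X).ConnectedComponent
  let cF := (G.joins F).ConnectedComponent
  have : Fintype cX := Fintype.ofFinite _
  have : Fintype cF := Fintype.ofFinite _
  let p : cF → cX := SimpleGraph.ConnectedComponent.map (SimpleGraph.Hom.ofLE (joins_mono hFX))
  have hp : Function.Surjective p := by
    intro c
    induction c using SimpleGraph.ConnectedComponent.ind with
    | _ v => exact ⟨(G.joins F).connectedComponentMk v, rfl⟩
  obtain ⟨s, hs⟩ := hp.hasRightInverse
  let c₀ : cX := (G.joins X).connectedComponentMk x₀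
  have hli : Function.Injective fun i : Fin l.length => (G.joins F).connectedComponentMk (l.get i) := by
    intro i j hij
    have hr : G.Reach F (l.get i) (l.get j) := SimpleGraph.ConnectedComponent.exact hij
    rcases lt_trichotomy i j with h | h | h
    · exact absurd hr (List.pairwise_iff_get.1 hl i j h)
    · exact h
    · exact absurd hr.symm (List.pairwise_iff_get.1 hl j i h)
  -- Every component of `X` other than that of `x₀` contributes one chosen component of `F` inside
  -- it, and the listed vertices contribute `l.length` further ones, all inside `c₀`.
  let f : {c : cX // c ≠ c₀} ⊕ Fin l.length → cF :=
    Sum.elim (fun c => s c.1) (fun i => (G.joins F).connectedComponentMk (l.get i))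
  have hpl : ∀ i : Fin l.length, p ((G.joins F).connectedComponentMk (l.get i)) = c₀ := fun i =>
    SimpleGraph.ConnectedComponent.sound (hX _ (l.get_mem i))
  have hf : Function.Injective f := by
    rintro (a | i) (b | j) h
    · have : p (s a.1) = p (s b.1) := congrArg p h
      rw [hs, hs] at this
      exact congrArg Sum.inl (Subtype.ext this)
    · have : p (s a.1) = p _ := congrArg p h
      rw [hs] at this
      exact absurd (this.trans (hpl j)) a.2
    · have : p (s b.1) = p _ := congrArg p h.symm
      rw [hs] at this
      exact absurd (this.trans (hpl i)) b.2
    · exact congrArg Sum.inr (hli h)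
  have hc := Fintype.card_le_of_injective f hf
  rw [Fintype.card_sum, Fintype.card_fin] at hc
  have h1 : Fintype.card {c : cX // c ≠ c₀} = Fintype.card cX - 1 := by
    rw [Fintype.card_subtype_compl, Fintype.card_subtype_eq]
  have h2 : 0 < Fintype.card cX := Fintype.card_pos_iff.2 ⟨c₀⟩
  simp only [numComp, Nat.card_eq_fintype_card]
  change Fintype.card cX + _ ≤ Fintype.card cF + 1
  omega

theorem numComp_anti [Finite V] [Nonempty V] (hFX : F ⊆ X) : G.numComp X ≤ G.numComp F := by
  have := numComp_add_length_le (G := G) hFX (Classical.arbitrary V) [Classical.arbitrary V]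
    (by simp) (by simp [Reach.refl])
  simpa using this

/-- Otherwise the list `[x, y]` would give `F` more components than `X`. This turns equalities
between component counts back into paths. -/
theorem reach_of_numComp_le [Finite V] (hFX : F ⊆ X) (hc : G.numComp F ≤ G.numComp X) (h : G.Reach X x y) :
    G.Reach F x y := by
  by_contra hr
  have := numComp_add_length_le (G := G) hFX y [x, y] (by simpa using hr) (by simp [h, Reach.refl])
  simp at this
  omega

theorem numComp_congr [Nonempty V] (hFX : F ⊆ X) (h : ∀ x y, G.Reach X x y → G.Reach F x y) :
    G.numComp F = G.numComp X := by
  simp only [numComp]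
  refine Nat.card_congr (Quot.congr (Equiv.refl V) fun a b => ?_)
  exact ⟨fun hr => Reach.mono hFX hr, fun hr => h a b hr⟩

theorem numComp_insert [Finite V] (h : G.ends e = s(u, v)) (hr : ¬ G.Reach F u v) :
    G.numComp (insert e F) + 1 = G.numComp F := by
  have : Nonempty V := ⟨u⟩
  have hsub := Set.subset_insert e F
  apply le_antisymm
  · have := numComp_add_length_le (G := G) hsub v [u, v] (by simpa using hr)
      (by simp [Reach.refl, reach_of_edge (Set.mem_insert e F) h])
    simpa using this
  · -- identifying two components
    classical
    have : Fintype V := Fintype.ofFinite V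
    let cX := (G.joins (insert e F)).ConnectedComponent
    let cF := (G.joins F).ConnectedComponent
    have : Fintype cX := Fintype.ofFinite _
    have : Fintype cF := Fintype.ofFinite _
    let c₀ : cF := (G.joins F).connectedComponentMk u
    let f : {c : cF // c ≠ c₀} → cX := fun c =>
      SimpleGraph.ConnectedComponent.map (SimpleGraph.Hom.ofLE (joins_mono hsub)) c.1
    have hf : Function.Injective f := by
      rintro ⟨a, ha⟩ ⟨b, hb⟩ hab
      induction a using SimpleGraph.ConnectedComponent.ind with
      | _ a =>
      induction b using SimpleGraph.ConnectedComponent.ind with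
      | _ b =>
      have ha' : ¬ G.Reach F a u := fun h => ha (SimpleGraph.ConnectedComponent.sound h)
      have hb' : ¬ G.Reach F b u := fun h => hb (SimpleGraph.ConnectedComponent.sound h)
      have hr : G.Reach (insert e F) a b := SimpleGraph.ConnectedComponent.exact hab
      rw [reach_insert h] at hr
      rcases hr with H | H | H
      · exact Subtype.ext (SimpleGraph.ConnectedComponent.sound H)
      · exact absurd H.1 ha'
      · exact absurd H.2.symm hb'
    have hc := Fintype.card_le_of_injective f hf
    rw [Fintype.card_subtype_compl, Fintype.card_subtype_eq] at hc
    simp only [numComp, Nat.card_eq_fintype_card]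
    change Fintype.card cF ≤ Fintype.card cX + 1
    omega

theorem numComp_empty : G.numComp (∅ : Set E) = Nat.card V := by
  simp only [numComp]
  symm
  refine Nat.card_congr (Equiv.ofBijective (G.joins ∅).connectedComponentMk ⟨?_, ?_⟩)
  · intro a b h
    exact reach_empty (G := G) (SimpleGraph.ConnectedComponent.exact h)
  · intro c
    induction c using SimpleGraph.ConnectedComponent.ind with
    | _ v => exact ⟨v, rfl⟩

/-- Each edge added to a forest merges two components. This converts the weights of terms, which are
edge counts, into component counts. -/
theorem IsForest.ncard_add_numComp [Finite V] [Finite E] (hF : G.IsForest F) :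
    F.ncard + G.numComp F = Nat.card V := by
  induction F, Set.toFinite F using Set.Finite.induction_on with
  | empty => simp [numComp_empty]
  | @insert a s ha hs ih =>
    obtain ⟨u, v, huv⟩ := G.exists_ends a
    have hr : ¬ G.Reach s u v := fun h => hF a (Set.mem_insert a s) u v huv
      (by rwa [Set.insert_sdiff_of_mem _ (Set.mem_singleton a), Set.sdiff_singleton_eq_self ha])
    have h1 := ih (hF.subset (Set.subset_insert a s))
    have h2 := numComp_insert huv hr
    rw [Set.ncard_insert_of_notMem ha hs]
    omega

/-- A forest each of whose components contains exactly one vertex outside `W` has `|W|` edges. -/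
theorem IsForest.ncard_eq [Finite V] [Finite E] {W : Set V} (hF : G.IsForest F)
    (h1 : ∀ x, ∃ y ∉ W, G.Reach F x y)
    (h2 : ∀ x ∉ W, ∀ y ∉ W, G.Reach F x y → x = y) : F.ncard = W.ncard := by
  -- The vertices outside `W` represent the components of `F`, each exactly once.
  have hc : G.numComp F = Wᶜ.ncard := by
    rw [← Nat.card_coe_set_eq]
    symm
    refine Nat.card_congr (Equiv.ofBijective
      (fun w : (Wᶜ : Set V) => (G.joins F).connectedComponentMk w.1) ⟨?_, ?_⟩)
    · intro a b h
      exact Subtype.ext (h2 a.1 a.2 b.1 b.2 (SimpleGraph.ConnectedComponent.exact h))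
    · intro c
      induction c using SimpleGraph.ConnectedComponent.ind with
      | _ v =>
        obtain ⟨y, hy, hr⟩ := h1 v
        exact ⟨⟨y, hy⟩, SimpleGraph.ConnectedComponent.sound hr.symm⟩
  have := hF.ncard_add_numComp
  have h3 := Set.ncard_add_ncard_compl W
  omega

end Count

/-! ### Spanning trees and spanning 2-trees -/

section Trees

variable {T : Set E} {e' : E} {u' v' : V}

theorem IsSpanningTree.reach (hT : G.IsSpanningTree T) (x y : V) : G.Reach T x y :=
  hT.2.preconnected x y

theorem isSpanningTree_iff [Nonempty V] :
    G.IsSpanningTree T ↔ G.IsForest T ∧ ∀ x y, G.Reach T x y :=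
  ⟨fun h => ⟨h.1, h.reach⟩, fun h => ⟨h.1, ⟨h.2⟩⟩⟩

theorem IsSpanningTree.numComp_eq [Nonempty V] (hT : G.IsSpanningTree T) : G.numComp T = 1 := by
  rw [numComp, Nat.card_eq_one_iff_unique]
  have := hT.2.preconnected.subsingleton_connectedComponent
  exact ⟨this, inferInstance⟩

theorem IsForest.not_reach_diff (hT : G.IsForest T) (he : e ∈ T) (h : G.ends e = s(u, v)) :
    ¬ G.Reach (T \ {e}) u v := hT e he u v h

theorem IsSpanningTree.reach_diff_or (hT : G.IsSpanningTree T) (he : e ∈ T)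
    (h : G.ends e = s(u, v)) (x : V) : G.Reach (T \ {e}) x u ∨ G.Reach (T \ {e}) x v := by
  have hr := hT.reach x u
  have hTe : T = insert e (T \ {e}) := by rw [Set.insert_sdiff_self_of_mem he]
  rw [hTe, reach_insert h] at hr
  rcases hr with H | H | H
  · exact Or.inl H
  · exact Or.inl H.1
  · exact Or.inr H.1

theorem IsSpanningTree.isSpanningTwoTree_diff [Finite V] (hT : G.IsSpanningTree T) (he : e ∈ T)
    (h : G.ends e = s(u, v)) : G.IsSpanningTwoTree (T \ {e}) := by
  have : Nonempty V := ⟨u⟩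
  refine ⟨hT.1.subset Set.sdiff_subset, ?_⟩
  have h1 := numComp_insert h (hT.1.not_reach_diff he h)
  rw [Set.insert_sdiff_self_of_mem he, hT.numComp_eq] at h1
  exact h1.symm

/-- Exchange of two edges that cross between the two sides of a tree. -/
theorem IsSpanningTree.exchange (hT : G.IsSpanningTree T) (he : e ∈ T) (h : G.ends e = s(u, v))
    (h' : G.ends e' = s(u', v')) (hu : G.Reach (T \ {e}) u' u) (hv : G.Reach (T \ {e}) v' v) :
    e' ∉ T \ {e} ∧ G.IsSpanningTree (insert e' (T \ {e})) := by
  have : Nonempty V := ⟨u⟩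
  have hr : ¬ G.Reach (T \ {e}) u' v' := fun hr =>
    hT.1.not_reach_diff he h ((hu.symm.trans hr).trans hv)
  refine ⟨fun hmem => hr (reach_of_edge hmem h'), ?_⟩
  rw [isSpanningTree_iff]
  refine ⟨(hT.1.subset Set.sdiff_subset).insert_edge h' hr, ?_⟩
  have hsub := Set.subset_insert e' (T \ {e})
  have he' : G.Reach (insert e' (T \ {e})) u' v' := reach_of_edge (Set.mem_insert _ _) h'
  have key : ∀ x, G.Reach (insert e' (T \ {e})) x u' := by
    intro x
    rcases hT.reach_diff_or he h x with H | H
    · exact (H.mono hsub).trans (hu.symm.mono hsub)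
    · exact ((H.mono hsub).trans (hv.symm.mono hsub)).trans he'.symm
  exact fun x y => (key x).trans (key y).symm

theorem IsSpanningTwoTree.numComp_eq (hT : G.IsSpanningTwoTree T) : G.numComp T = 2 := hT.2

/-- The two sides of a spanning 2-tree. -/
theorem IsSpanningTwoTree.reach_or (hT : G.IsSpanningTwoTree T) (h : ¬ G.Reach T x y) (z : V) :
    G.Reach T z x ∨ G.Reach T z y := by
  by_contra hz
  push Not at hz
  obtain ⟨a, b, hab, hu⟩ := Nat.card_eq_two_iff.1 hT.2
  have hmem : ∀ c : (G.joins T).ConnectedComponent, c = a ∨ c = b := fun c => by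
    have : c ∈ ({a, b} : Set _) := hu ▸ Set.mem_univ c
    simpa using this
  have ne : ∀ p q : V, ¬ G.Reach T p q →
      (G.joins T).connectedComponentMk p ≠ (G.joins T).connectedComponentMk q :=
    fun p q hpq h => hpq (SimpleGraph.ConnectedComponent.exact h)
  have h1 := ne _ _ h
  have h2 := ne _ _ hz.1
  have h3 := ne _ _ hz.2
  rcases hmem ((G.joins T).connectedComponentMk x) with hx | hx <;>
  rcases hmem ((G.joins T).connectedComponentMk y) with hy | hy <;>
  rcases hmem ((G.joins T).connectedComponentMk z) with hz | hz <;>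
  simp_all

end Trees

end FeynmanGraph

/-! ### Lower facets as faces without linear relations -/

section Facets

variable {E : Type*} [Fintype E]

/-- The points strictly above the level `c`, together with the hull of the generators on that level,
form a convex set. It contains all generators and hence the whole hull, so a minimal point lies in
the second part. -/
theorem minFace_convexHull {P : Set (Option E → ℝ)} {v : Option E → ℝ} {c : ℝ}
    (hc : ∀ p ∈ P, c ≤ p ⬝ᵥ v) (hex : ∃ p ∈ P, p ⬝ᵥ v = c) :
    minFace (convexHull ℝ P) v = convexHull ℝ {p ∈ P | p ⬝ᵥ v = c} := by
  have hconv : Convex ℝ ({r : Option E → ℝ | c < r ⬝ᵥ v} ∪ convexHull ℝ {p ∈ P | p ⬝ᵥ v = c}) := by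
    have hle : ∀ r ∈ convexHull ℝ {p ∈ P | p ⬝ᵥ v = c}, r ⬝ᵥ v = c := by
      have : convexHull ℝ {p ∈ P | p ⬝ᵥ v = c} ⊆ {r | r ⬝ᵥ v = c} := by
        refine convexHull_min (fun p hp => hp.2) ?_
        intro x hx y hy a b _ _ hab
        simp only [Set.mem_ofPred_eq] at hx hy ⊢
        rw [add_dotProduct, smul_dotProduct, smul_dotProduct, hx, hy, ← add_smul, hab, one_smul]
      exact this
    intro x hx y hy a b ha hb hab
    by_cases hxy : x ∈ convexHull ℝ {p ∈ P | p ⬝ᵥ v = c} ∧ y ∈ convexHull ℝ {p ∈ P | p ⬝ᵥ v = c}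
    · exact Or.inr (convex_convexHull ℝ _ hxy.1 hxy.2 ha hb hab)
    · have hx' : c ≤ x ⬝ᵥ v := hx.elim (fun h => le_of_lt h) fun h => (hle x h).ge
      have hy' : c ≤ y ⬝ᵥ v := hy.elim (fun h => le_of_lt h) fun h => (hle y h).ge
      rcases ha.eq_or_lt with rfl | ha'
      · rw [zero_add] at hab
        subst hab
        simpa using hy
      rcases hb.eq_or_lt with rfl | hb'
      · rw [add_zero] at hab
        subst hab
        simpa using hx
      left
      simp only [Set.mem_ofPred_eq]
      rw [add_dotProduct, smul_dotProduct, smul_dotProduct, smul_eq_mul, smul_eq_mul]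
      have hcc : c = a * c + b * c := by rw [← add_mul, hab, one_mul]
      rcases not_and_or.1 hxy with h | h
      · have h1 : c < x ⬝ᵥ v := hx.resolve_right h
        nlinarith
      · have h1 : c < y ⬝ᵥ v := hy.resolve_right h
        nlinarith
  have hcP : ∀ r ∈ convexHull ℝ P, c ≤ r ⬝ᵥ v := by
    have : convexHull ℝ P ⊆ {r | c ≤ r ⬝ᵥ v} := by
      refine convexHull_min hc ?_
      intro x hx y hy a b ha hb hab
      simp only [Set.mem_ofPred_eq] at hx hy ⊢
      rw [add_dotProduct, smul_dotProduct, smul_dotProduct, smul_eq_mul, smul_eq_mul]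
      have hcc : c = a * c + b * c := by rw [← add_mul, hab, one_mul]
      nlinarith
    exact this
  apply Set.Subset.antisymm
  · rintro r ⟨hr, hmin⟩
    have hsub : convexHull ℝ P ⊆ _ := convexHull_min (s := P) (fun p hp => by
      rcases (hc p hp).lt_or_eq with h | h
      · exact Or.inl h
      · exact Or.inr (subset_convexHull ℝ _ ⟨hp, h.symm⟩)) hconv
    refine (hsub hr).resolve_left fun h => ?_
    obtain ⟨p, hp, hpc⟩ := hex
    have := hmin p (subset_convexHull ℝ _ hp)
    simp only [Set.mem_ofPred_eq] at h
    linarith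
  · refine convexHull_min ?_ ?_
    · rintro p ⟨hp, hpc⟩
      exact ⟨subset_convexHull ℝ _ hp, fun r hr => hpc ▸ hcP r hr⟩
    · intro x hx y hy a b ha hb hab
      refine ⟨convex_convexHull ℝ _ hx.1 hy.1 ha hb hab, fun r hr => ?_⟩
      have h1 := hx.2 r hr
      have h2 := hy.2 r hr
      rw [add_dotProduct, smul_dotProduct, smul_dotProduct, smul_eq_mul, smul_eq_mul]
      have hcc : r ⬝ᵥ v = a * (r ⬝ᵥ v) + b * (r ⬝ᵥ v) := by rw [← add_mul, hab, one_mul]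
      nlinarith

/-- A lower facet is a face on which no nontrivial combination of the exponents of the `x_e` is
constant. -/
theorem isLowerFacetNormal_convexHull_iff {P : Set (Option E → ℝ)} {v : Option E → ℝ} {c : ℝ}
    (hv : v none = 1) (hc : ∀ p ∈ P, c ≤ p ⬝ᵥ v) (hex : ∃ p ∈ P, p ⬝ᵥ v = c) :
    IsLowerFacetNormal (convexHull ℝ P) v ↔
      ∀ α : E → ℝ, (∃ κ, ∀ p ∈ P, p ⬝ᵥ v = c → ∑ e, α e * p (some e) = κ) → α = 0 := by
  obtain ⟨p₀, hp₀, hpc₀⟩ := hex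
  rw [IsLowerFacetNormal, minFace_convexHull hc ⟨p₀, hp₀, hpc₀⟩]
  set P₀ : Set (Option E → ℝ) := {p ∈ P | p ⬝ᵥ v = c} with hP₀
  have hmem₀ : p₀ ∈ P₀ := ⟨hp₀, hpc₀⟩
  have hspan : vectorSpan ℝ (convexHull ℝ P₀) = vectorSpan ℝ P₀ := by
    rw [← direction_affineSpan, affineSpan_convexHull, direction_affineSpan]
  rw [hspan]
  -- Forgetting the `lam` coordinate loses nothing on the direction of the face: there `d ⬝ᵥ v = 0`,
  -- and `v none = 1` makes the last coordinate a function of the others.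
  let φ : (Option E → ℝ) →ₗ[ℝ] (E → ℝ) := LinearMap.funLeft ℝ ℝ some
  have hker : ∀ d ∈ vectorSpan ℝ P₀, d ⬝ᵥ v = 0 := by
    intro d hd
    rw [vectorSpan_def] at hd
    induction hd using Submodule.span_induction with
    | mem x hx =>
      obtain ⟨p, hp, q, hq, rfl⟩ := hx
      simp only [vsub_eq_sub, sub_dotProduct]
      rw [hp.2, hq.2, sub_self]
    | zero => simp
    | add x y _ _ hx hy => rw [add_dotProduct, hx, hy, add_zero]
    | smul a x _ hx => rw [smul_dotProduct, hx, smul_zero]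
  have hinj : Function.Injective (φ.domRestrict (vectorSpan ℝ P₀)) := by
    rw [← LinearMap.ker_eq_bot, LinearMap.ker_eq_bot']
    rintro ⟨d, hd⟩ h
    have hs : ∀ e, d (some e) = 0 := fun e => congrFun h e
    have h0 := hker d hd
    rw [dotProduct, Fintype.sum_option] at h0
    simp only [hs, zero_mul, Finset.sum_const_zero, add_zero, hv, mul_one] at h0
    ext x
    cases x with
    | none => exact h0
    | some e => exact hs e
  have hfin : Module.finrank ℝ (vectorSpan ℝ P₀) =
      Module.finrank ℝ ((vectorSpan ℝ P₀).map φ) := by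
    rw [← LinearMap.range_domRestrict, LinearMap.finrank_range_of_inj hinj]
  rw [hfin]
  have hne : (convexHull ℝ P₀).Nonempty := ⟨p₀, subset_convexHull ℝ _ hmem₀⟩
  constructor
  · rintro ⟨-, -, hrank⟩ α ⟨κ, hκ⟩
    have htop : (vectorSpan ℝ P₀).map φ = ⊤ := Submodule.eq_top_of_finrank_eq (by
      rw [hrank, Module.finrank_fintype_fun_eq_card])
    have hzero : ∀ d ∈ vectorSpan ℝ P₀, ∑ e, α e * d (some e) = 0 := by
      intro d hd
      rw [vectorSpan_def] at hd
      induction hd using Submodule.span_induction with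
      | mem x hx =>
        obtain ⟨p, hp, q, hq, rfl⟩ := hx
        simp only [vsub_eq_sub, Pi.sub_apply, mul_sub, Finset.sum_sub_distrib]
        rw [hκ p hp.1 hp.2, hκ q hq.1 hq.2, sub_self]
      | zero => simp
      | add x y _ _ hx hy => simp only [Pi.add_apply, mul_add, Finset.sum_add_distrib, hx, hy, add_zero]
      | smul a x _ hx =>
        have : ∑ e, α e * (a • x) (some e) = a * ∑ e, α e * x (some e) := by
          rw [Finset.mul_sum]
          exact Finset.sum_congr rfl fun e _ => by simp only [Pi.smul_apply, smul_eq_mul]; ring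
        rw [this, hx, mul_zero]
    -- In full dimension `α` is itself a direction of the face, so it is orthogonal to itself.
    obtain ⟨d, hd, hdα⟩ : α ∈ (vectorSpan ℝ P₀).map φ := htop ▸ Submodule.mem_top
    have h := hzero d hd
    have h2 : ∀ e, d (some e) = α e := fun e => congrFun hdα e
    simp only [h2] at h
    rw [Finset.sum_eq_zero_iff_of_nonneg fun e _ => mul_self_nonneg _] at h
    ext e
    exact mul_self_eq_zero.1 (h e (Finset.mem_univ e))
  · intro H
    refine ⟨by rw [hv]; exact one_pos, hne, ?_⟩
    by_contra hrank
    have hlt : (vectorSpan ℝ P₀).map φ < ⊤ := by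
      rw [lt_top_iff_ne_top]
      intro h
      rw [h, finrank_top, Module.finrank_fintype_fun_eq_card] at hrank
      exact hrank rfl
    -- A proper subspace is killed by a nonzero functional, whose coefficients are the `α` to be
    -- excluded.
    obtain ⟨f, hf0, hf⟩ := Submodule.exists_le_ker_of_lt_top _ hlt
    classical
    have hfe : ∀ x : E → ℝ, f x = ∑ e, f (Pi.single e 1) * x e := by
      intro x
      rw [LinearMap.pi_apply_eq_sum_univ f x]
      refine Finset.sum_congr rfl fun e _ => ?_
      rw [smul_eq_mul, mul_comm]
      congr 2
      ext i
      simp [Pi.single_apply, eq_comm]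
    have hα := H (fun e => f (Pi.single e 1)) ⟨f (φ p₀), fun p hp hpc => ?_⟩
    · apply hf0
      ext e
      simpa using congrFun hα e
    · have h1 := hfe (φ p)
      simp only [φ, LinearMap.funLeft_apply] at h1 ⊢
      rw [← h1, ← sub_eq_zero, ← map_sub]
      have : φ (p -ᵥ p₀) ∈ (vectorSpan ℝ P₀).map φ :=
        Submodule.mem_map_of_mem (vsub_mem_vectorSpan ℝ ⟨hp, hpc⟩ hmem₀)
      exact hf this

end Facets

/-! ### Kinematics and the order of the invariants -/

/-- The momentum entering through the external lines in `X` has a square of order `lam ^ w`: `X` is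
a proper nonempty set of external lines, and `w = 1` or `0` according to whether or not a single
on-shell line `p_i` is cut off. -/
def IsSplit {K L : ℕ} (X : Set (Leg K L)) (w : ℕ) : Prop :=
  X.Nonempty ∧ Xᶜ.Nonempty ∧
    ((∃ i, X = {Sum.inl i} ∨ Xᶜ = {Sum.inl i}) ∧ w = 1 ∨
      (∀ i, X ≠ {Sum.inl i} ∧ Xᶜ ≠ {Sum.inl i}) ∧ w = 0)

theorem IsSplit.compl {K L : ℕ} {X : Set (Leg K L)} {w : ℕ} (h : IsSplit X w) : IsSplit Xᶜ w := by
  obtain ⟨h1, h2, h3⟩ := h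
  refine ⟨h2, by rwa [compl_compl], ?_⟩
  rw [compl_compl]
  rcases h3 with ⟨⟨i, h⟩, hw⟩ | ⟨h, hw⟩
  · exact Or.inl ⟨⟨i, h.symm⟩, hw⟩
  · exact Or.inr ⟨fun i => (h i).symm, hw⟩

theorem isSplit_zero_iff {K L : ℕ} {X : Set (Leg K L)} :
    IsSplit X 0 ↔ X.Nonempty ∧ Xᶜ.Nonempty ∧ ∀ i, X ≠ {Sum.inl i} ∧ Xᶜ ≠ {Sum.inl i} := by
  simp [IsSplit]

theorem IsSplit.eq_one_of_subset {K L : ℕ} {X : Set (Leg K L)} {w : ℕ} (h : IsSplit X w) {i : Fin K}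
    (hX : X ⊆ {Sum.inl i}) : w = 1 := by
  have : X = {Sum.inl i} := (Set.subset_singleton_iff_eq.1 hX).resolve_left h.1.ne_empty
  rcases h.2.2 with h3 | h3
  · exact h3.2
  · exact absurd this (h3.1 i).1

section Kinematics

theorem not_zero_isTheta_pow (w : ℕ) {f : ℝ → ℝ} (hf : f =ᶠ[𝓝[>] 0] fun _ => 0) :
    ¬ f =Θ[𝓝[>] 0] fun lam : ℝ => lam ^ w := by
  intro h
  have h1 := (h.symm.trans_eventuallyEq hf).1
  rw [isBigO_zero_right_iff] at h1
  obtain ⟨x, hx, hx0⟩ := (h1.and self_mem_nhdsWithin).exists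
  exact pow_ne_zero w (ne_of_gt (Set.mem_Ioi.1 hx0)) hx

theorem pow_isTheta_pow_iff {a b : ℕ} :
    (fun lam : ℝ => lam ^ a) =Θ[𝓝[>] 0] (fun lam : ℝ => lam ^ b) ↔ a = b := by
  have key : ∀ {a b : ℕ}, a < b → ¬ (fun lam : ℝ => lam ^ a) =O[𝓝[>] 0] (fun lam : ℝ => lam ^ b) := by
    intro a b hab h
    have h1 : (fun lam : ℝ => lam ^ b) =o[𝓝[>] 0] (fun lam : ℝ => lam ^ a) :=
      (isLittleO_pow_pow hab).mono nhdsWithin_le_nhds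
    refine isLittleO_irrefl ?_ (h.trans_isLittleO h1)
    refine Eventually.frequently ?_
    filter_upwards [self_mem_nhdsWithin] with x hx
    exact pow_ne_zero a (ne_of_gt hx)
  constructor
  · intro h
    rcases lt_trichotomy a b with hab | hab | hab
    · exact absurd h.1 (key hab)
    · exact hab
    · exact absurd h.2 (key hab)
  · rintro rfl
    exact isTheta_refl _ _

theorem isTheta_pow_iff {f : ℝ → ℝ} {a b : ℕ} (hf : f =Θ[𝓝[>] 0] (fun lam : ℝ => lam ^ a)) :
    f =Θ[𝓝[>] 0] (fun lam : ℝ => lam ^ b) ↔ b = a := by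
  rw [← pow_isTheta_pow_iff]
  exact ⟨fun h => h.symm.trans hf, fun h => hf.trans h.symm⟩

variable {M : Type*} [AddCommGroup M] [Module ℝ M] {K L : ℕ}
  {Q : QuadraticForm ℝ M} {k : Leg K L → ℝ → M}

theorem WideAngle.sum_compl (hk : WideAngle Q k) (X : Finset (Leg K L)) :
    (fun lam => Q (∑ ℓ ∈ Xᶜ, k ℓ lam)) =ᶠ[𝓝[>] 0] fun lam => Q (∑ ℓ ∈ X, k ℓ lam) := by
  filter_upwards [hk.conserved] with lam h
  rw [← Finset.sum_add_sum_compl X] at h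
  rw [← neg_eq_of_add_eq_zero_right h, QuadraticMap.map_neg]

/-- The empty and the full set carry zero momentum, which is of no order `lam ^ w`. By conservation
a set and its complement have the same square, and distinct powers of `lam` are of distinct orders.
-/
theorem WideAngle.isTheta_iff (hk : WideAngle Q k) (X : Finset (Leg K L)) (w : ℕ) :
    ((fun lam => Q (∑ ℓ ∈ X, k ℓ lam)) =Θ[𝓝[>] 0] fun lam : ℝ => lam ^ w) ↔
      IsSplit (X : Set (Leg K L)) w := by
  by_cases h1 : X = ∅
  · subst h1
    simp only [IsSplit, Finset.coe_empty, Set.not_nonempty_empty, false_and, iff_false]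
    exact not_zero_isTheta_pow w (by simp)
  by_cases h2 : X = Finset.univ
  · subst h2
    simp only [IsSplit, Finset.coe_univ, Set.compl_univ, Set.not_nonempty_empty, false_and,
      and_false, iff_false]
    refine not_zero_isTheta_pow w ?_
    filter_upwards [hk.conserved] with lam h
    simp [h]
  have hne : (X : Set (Leg K L)).Nonempty := Finset.coe_nonempty.2 (Finset.nonempty_iff_ne_empty.2 h1)
  have hne' : (X : Set (Leg K L))ᶜ.Nonempty := by
    rw [Set.nonempty_compl]
    exact fun h => h2 (Finset.coe_eq_univ.1 h)
  have e1 : ∀ i : Fin K, (X : Set (Leg K L)) = {Sum.inl i} ↔ X = {Sum.inl i} := fun i => by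
    rw [← Finset.coe_singleton, Finset.coe_inj]
  have e2 : ∀ i : Fin K, (X : Set (Leg K L))ᶜ = {Sum.inl i} ↔ Xᶜ = {Sum.inl i} := fun i => by
    rw [← Finset.coe_singleton, ← Finset.coe_compl, Finset.coe_inj]
  simp only [IsSplit, hne, hne', true_and, e1, e2, ne_eq]
  by_cases hs : ∃ i : Fin K, X = {Sum.inl i} ∨ Xᶜ = {Sum.inl i}
  · have hθ : (fun lam => Q (∑ ℓ ∈ X, k ℓ lam)) =Θ[𝓝[>] 0] fun lam : ℝ => lam ^ 1 := by
      simp only [pow_one]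
      obtain ⟨i, h | h⟩ := hs
      · subst h
        simpa using hk.onShell i
      · refine (hk.sum_compl X).symm.trans_isTheta ?_
        rw [h]
        simpa using hk.onShell i
    rw [isTheta_pow_iff hθ]
    constructor
    · exact fun h => Or.inl ⟨hs, h⟩
    · rintro (h | h)
      · exact h.2
      · obtain ⟨i, hi⟩ := hs
        exact absurd hi (not_or.2 (h.1 i))
  · have hs' : ∀ i : Fin K, X ≠ {Sum.inl i} ∧ Xᶜ ≠ {Sum.inl i} := fun i => by
      have := not_exists.1 hs i
      exact not_or.1 this
    have hθ : (fun lam => Q (∑ ℓ ∈ X, k ℓ lam)) =Θ[𝓝[>] 0] fun lam : ℝ => lam ^ 0 := by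
      simp only [pow_zero]
      exact hk.nonexceptional X (Finset.nonempty_iff_ne_empty.2 h1) h2 hs'
    rw [isTheta_pow_iff hθ]
    constructor
    · exact fun h => Or.inr ⟨hs', h⟩
    · rintro (h | h)
      · exact absurd h.1 hs
      · exact h.2

/-- With fewer lines conservation contradicts the scaling: a single momentum vanishes; `q² = p²` for
one line of each kind; `2 p₁·p₂ = -2 p₁²` for two on-shell lines; and `2 p₁·p₂ = p₃² - p₁² - p₂²`
for three of them. -/
theorem WideAngle.three_le (hk : WideAngle Q k) (i : Fin K) : 3 ≤ K + L ∧ (L = 0 → 4 ≤ K) := by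
  have h1 := hk.onShell i
  have hnot : ∀ f : ℝ → ℝ, f =Θ[𝓝[>] 0] (fun lam : ℝ => lam) → ¬ f =Θ[𝓝[>] 0] fun _ : ℝ => (1 : ℝ) := by
    intro f h h'
    have := (pow_isTheta_pow_iff (a := 1) (b := 0)).1 (by simpa using h.symm.trans h')
    omega
  have hK : 0 < K := i.pos
  have hsing : ∀ ℓ : Leg K L, (fun lam => Q (∑ x ∈ {ℓ}ᶜ, k x lam)) =ᶠ[𝓝[>] 0] fun lam => Q (k ℓ lam) := by
    intro ℓ
    simpa using hk.sum_compl {ℓ}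
  have hcard : ¬ (K + L = 1) := by
    intro h
    have h2 : K = 1 ∧ L = 0 := by omega
    obtain ⟨rfl, rfl⟩ := h2
    have hi : i = 0 := Subsingleton.elim _ _
    refine not_zero_isTheta_pow 1 (f := fun lam => Q (k (Sum.inl i) lam)) ?_ (by simpa using h1)
    filter_upwards [hk.conserved] with lam h
    have : k (Sum.inl i) lam = 0 := by
      rw [← h, hi]; simp
    simp [this]
  have hcard2 : ¬ (K + L = 2) := by
    intro h
    have h2 : (K = 1 ∧ L = 1) ∨ (K = 2 ∧ L = 0) := by omega
    rcases h2 with ⟨rfl, rfl⟩ | ⟨rfl, rfl⟩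
    · refine hnot _ ?_ (hk.offShell 0)
      refine (hsing (Sum.inr 0)).symm.trans_isTheta ?_
      have : ({Sum.inr 0}ᶜ : Finset (Leg 1 1)) = {Sum.inl 0} := by decide
      rw [this]
      simpa using hk.onShell 0
    · refine hnot _ ?_ (hk.wideAngle 0 1 (by decide))
      have hpol : (fun lam => QuadraticMap.polar Q (k (Sum.inl 0) lam) (k (Sum.inl 1) lam))
          =ᶠ[𝓝[>] 0] fun lam => -2 * Q (k (Sum.inl 0) lam) := by
        filter_upwards [hk.conserved] with lam h
        have h' : k (Sum.inl 0) lam + k (Sum.inl 1) lam = 0 := by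
          rw [← h]; simp
        rw [QuadraticMap.polar, h', ← neg_eq_of_add_eq_zero_right h', QuadraticMap.map_neg]
        simp; ring
      refine hpol.trans_isTheta ?_
      exact (isTheta_const_mul_left (by norm_num)).2 (hk.onShell 0)
  have hcard3 : ¬ (K = 3 ∧ L = 0) := by
    rintro ⟨rfl, rfl⟩
    refine hnot _ ?_ (hk.wideAngle 0 1 (by decide))
    have hO : ∀ a, (fun lam => Q (k (Sum.inl a) lam)) =O[𝓝[>] 0] fun lam : ℝ => lam :=
      fun a => (hk.onShell a).1
    have hpol : (fun lam => QuadraticMap.polar Q (k (Sum.inl 0) lam) (k (Sum.inl 1) lam))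
        =ᶠ[𝓝[>] 0] fun lam => Q (k (Sum.inl 2) lam) - Q (k (Sum.inl 0) lam) - Q (k (Sum.inl 1) lam) := by
      filter_upwards [hk.conserved] with lam h
      have h' : k (Sum.inl 0) lam + k (Sum.inl 1) lam + k (Sum.inl 2) lam = 0 := by
        rw [← h]; simp [Fin.sum_univ_three]
      rw [QuadraticMap.polar, ← neg_eq_of_add_eq_zero_right h', QuadraticMap.map_neg]
    have hb : (fun lam => QuadraticMap.polar Q (k (Sum.inl 0) lam) (k (Sum.inl 1) lam))
        =O[𝓝[>] 0] fun lam : ℝ => lam :=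
      hpol.trans_isBigO (((hO 2).sub (hO 0)).sub (hO 1))
    have h0 : (fun _ : ℝ => (1 : ℝ)) =O[𝓝[>] 0] fun lam : ℝ => lam :=
      (hk.wideAngle 0 1 (by decide)).2.trans hb
    have h00 : (fun lam : ℝ => lam) =O[𝓝[>] 0] fun _ : ℝ => (1 : ℝ) := by
      have := ((isLittleO_pow_pow (𝕜 := ℝ) one_pos).mono (nhdsWithin_le_nhds (s := Set.Ioi 0))).isBigO
      simpa using this
    exact ⟨hb, h00.trans (hk.wideAngle 0 1 (by decide)).2⟩
  constructor <;> omega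

theorem WideAngle.two_le (hk : WideAngle Q k) (hpos : 0 < K + L) : 2 ≤ K + L := by
  by_cases hK : 0 < K
  · have := (hk.three_le ⟨0, hK⟩).1
    omega
  · obtain rfl : K = 0 := by omega
    by_contra h
    obtain rfl : L = 1 := by omega
    refine not_zero_isTheta_pow 0 (f := fun lam => Q (k (Sum.inr 0) lam)) ?_
      (by simpa using hk.offShell 0)
    filter_upwards [hk.conserved] with lam h
    have : k (Sum.inr 0) lam = 0 := by
      rw [← h]; simp
    simp [this]

end Kinematics

/-! ### The monomials of the Lee-Pomeransky polynomial and the linear criterion for regions -/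

namespace FeynmanGraph

variable {V E : Type*} {K L : ℕ} (G : FeynmanGraph V E K L)

/-- The external lines that enter in the `T`-component of `v`. -/
def legSide (T : Set E) (v : V) : Set (Leg K L) := {ℓ | G.Reach T v (G.att ℓ)}

/-- `T` labels a monomial of the Lee-Pomeransky polynomial whose coefficient scales as `lam ^ w`. -/
def IsTerm (T : Set E) (w : ℕ) : Prop :=
  (G.IsSpanningTree T ∧ w = 0) ∨ (G.IsSpanningTwoTree T ∧ ∃ v, IsSplit (G.legSide T v) w)

variable {G}

theorem legSide_eq {T : Set E} {u v : V} (h : G.Reach T u v) : G.legSide T u = G.legSide T v :=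
  Set.ext fun _ => ⟨fun h' => h.symm.trans h', fun h' => h.trans h'⟩

theorem IsSpanningTwoTree.legSide_compl {T : Set E} (hT : G.IsSpanningTwoTree T) {u v : V}
    (h : ¬ G.Reach T u v) : (G.legSide T u)ᶜ = G.legSide T v := by
  ext ℓ
  constructor
  · intro hu
    exact ((hT.reach_or h (G.att ℓ)).resolve_left fun h' => hu h'.symm).symm
  · intro hv hu
    exact h (Reach.trans hu (Reach.symm hv))

theorem IsSpanningTwoTree.isSplit {T : Set E} (hT : G.IsSpanningTwoTree T) {u v : V} {w : ℕ}
    (h : IsSplit (G.legSide T u) w) : IsSplit (G.legSide T v) w := by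
  by_cases huv : G.Reach T u v
  · rwa [← legSide_eq huv]
  · rw [← hT.legSide_compl huv]
    exact h.compl

section Polynomial

variable [Fintype E]

open Classical in
/-- The exponent vector of the monomial of `T`. -/
noncomputable def treeExponent (T : Set E) : E →₀ ℕ := ∑ e with e ∉ T, Finsupp.single e 1

open Classical in
theorem treeExponent_apply (T : Set E) (e : E) : treeExponent T e = if e ∈ T then 0 else 1 := by
  rw [treeExponent, Finsupp.finsetSum_apply]
  simp only [Finsupp.single_apply, Finset.sum_ite_eq', Finset.mem_filter, Finset.mem_univ, true_and]
  split_ifs <;> simp_all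

theorem treeExponent_injective : Function.Injective (treeExponent (E := E)) := by
  classical
  intro S T h
  ext e
  have := DFunLike.congr_fun h e
  rw [treeExponent_apply, treeExponent_apply] at this
  by_cases h1 : e ∈ S <;> by_cases h2 : e ∈ T <;> simp_all

open Classical in
theorem prod_X_eq_monomial (T : Set E) :
    (∏ e with e ∉ T, MvPolynomial.X e : MvPolynomial E (ℝ → ℝ)) =
      MvPolynomial.monomial (treeExponent T) 1 := by
  rw [treeExponent, MvPolynomial.monomial_sum_one]
  rfl

variable {M : Type*} [AddCommGroup M] [Module ℝ M] [Nonempty V]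
  (Q : QuadraticForm ℝ M) (k : Leg K L → ℝ → M)

open Classical in
theorem coeff_leePomeransky (m : E →₀ ℕ) :
    MvPolynomial.coeff m (G.leePomeransky Q k) =
      (∑ T : Set E with G.IsSpanningTree T, if treeExponent T = m then 1 else 0) -
      ∑ T : Set E with G.IsSpanningTwoTree T,
        if treeExponent T = m then G.momentumSq Q k T (Classical.arbitrary V) else 0 := by
  rw [leePomeransky, symanzikU, symanzikF, MvPolynomial.coeff_add, MvPolynomial.coeff_neg,
    MvPolynomial.coeff_sum, MvPolynomial.coeff_sum, ← sub_eq_add_neg]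
  congr 1
  · refine Finset.sum_congr rfl fun T _ => ?_
    rw [prod_X_eq_monomial, MvPolynomial.coeff_monomial]
  · refine Finset.sum_congr rfl fun T _ => ?_
    rw [prod_X_eq_monomial, MvPolynomial.C_mul_monomial, MvPolynomial.coeff_monomial, mul_one]

open Classical in
theorem coeff_leePomeransky_treeExponent (T : Set E) :
    MvPolynomial.coeff (treeExponent T) (G.leePomeransky Q k) =
      (if G.IsSpanningTree T then 1 else 0) -
      if G.IsSpanningTwoTree T then G.momentumSq Q k T (Classical.arbitrary V) else 0 := by
  rw [coeff_leePomeransky]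
  simp only [treeExponent_injective.eq_iff, Finset.sum_ite_eq', Finset.mem_filter, Finset.mem_univ,
    true_and]

/-- Nothing cancels: different edge sets have different exponents, and no spanning tree is also a
spanning 2-tree. -/
theorem coeff_leePomeransky_isTheta {Q : QuadraticForm ℝ M} {k : Leg K L → ℝ → M}
    (hk : WideAngle Q k) (m : E →₀ ℕ) (w : ℕ) :
    (MvPolynomial.coeff m (G.leePomeransky Q k)) =Θ[𝓝[>] 0] (fun lam : ℝ => lam ^ w) ↔
      ∃ T, G.IsTerm T w ∧ m = treeExponent T := by
  classical
  by_cases hm : ∃ T, m = treeExponent T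
  · obtain ⟨T, rfl⟩ := hm
    have hex : (∃ T', G.IsTerm T' w ∧ treeExponent T = treeExponent T') ↔ G.IsTerm T w :=
      ⟨fun ⟨T', h, h'⟩ => treeExponent_injective h' ▸ h, fun h => ⟨T, h, rfl⟩⟩
    rw [hex, coeff_leePomeransky_treeExponent]
    by_cases h1 : G.IsSpanningTree T
    · have h2 : ¬ G.IsSpanningTwoTree T := fun h => by
        have := h.numComp_eq
        rw [h1.numComp_eq] at this
        omega
      rw [if_pos h1, if_neg h2, sub_zero]
      have : (1 : ℝ → ℝ) = fun lam : ℝ => lam ^ 0 := by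
        ext; simp
      rw [this, pow_isTheta_pow_iff]
      constructor
      · exact fun h => Or.inl ⟨h1, h.symm⟩
      · rintro (h | h)
        · exact h.2.symm
        · exact absurd h.1 h2
    · by_cases h2 : G.IsSpanningTwoTree T
      · rw [if_neg h1, if_pos h2, zero_sub]
        have : (-G.momentumSq Q k T (Classical.arbitrary V)) =
            fun lam => -(G.momentumSq Q k T (Classical.arbitrary V) lam) := rfl
        rw [this, IsTheta, isBigO_neg_left, isBigO_neg_right, ← IsTheta]
        unfold momentumSq
        rw [hk.isTheta_iff]
        have hset : ((Finset.univ.filter fun ℓ =>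
            (G.joins T).Reachable (Classical.arbitrary V) (G.att ℓ) : Finset (Leg K L)) :
              Set (Leg K L)) = G.legSide T (Classical.arbitrary V) := by
          ext ℓ
          simp [legSide, Reach]
        rw [hset]
        constructor
        · exact fun h => Or.inr ⟨h2, _, h⟩
        · rintro (h | ⟨-, v, h⟩)
          · exact absurd h.1 h1
          · exact h2.isSplit h
      · rw [if_neg h1, if_neg h2, sub_zero]
        constructor
        · exact fun h => absurd h (not_zero_isTheta_pow w (EventuallyEq.refl _ _))
        · rintro (h | h)
          · exact absurd h.1 h1
          · exact absurd h.1 h2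
  · rw [coeff_leePomeransky]
    push Not at hm
    simp only [fun T => (hm T).symm, if_false, Finset.sum_const_zero, sub_zero]
    constructor
    · exact fun h => absurd h (not_zero_isTheta_pow w (EventuallyEq.refl _ _))
    · rintro ⟨T, -, h⟩
      exact absurd h (hm T)

/-- The weight `-u_{R,e}` of an edge. -/
def edgeWeight (R : E → Mode K) (e : E) : ℕ :=
  match R e with
  | .hard => 0
  | .jet _ => 1
  | .soft => 2

omit [Fintype E] in
theorem regionVector_some (R : E → Mode K) (e : E) :
    regionVector R (some e) = -(edgeWeight R e : ℝ) := by
  simp only [regionVector, edgeWeight]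
  cases R e <;> simp

/-- The sum of the weights of the edges of `T`. -/
noncomputable def treeWeight (R : E → Mode K) (T : Set E) : ℕ :=
  ∑ e, T.indicator (edgeWeight R) e

/-- A configuration is a region if and only if no nontrivial combination of the edges is constant on
the terms of minimal weight. -/
theorem isRegion_iff {Q : QuadraticForm ℝ M} {k : Leg K L → ℝ → M} (hk : WideAngle Q k)
    (R : E → Mode K) {m : ℕ} (hm : ∀ T w, G.IsTerm T w → m ≤ treeWeight R T + w)
    (hex : ∃ T w, G.IsTerm T w ∧ treeWeight R T + w = m) :
    G.IsRegion Q k R ↔ ∀ α : E → ℝ,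
      (∃ κ, ∀ T w, G.IsTerm T w → treeWeight R T + w = m → ∑ e, T.indicator α e = κ) → α = 0 := by
  classical
  -- The exponents of a monomial are the indicator of the complement of `T`, so constancy in the
  -- exponents is the same as constancy of the sums over `T`.
  have hsplit : ∀ (T : Set E) (f : E → ℝ),
      ∑ e, f e * (treeExponent T e : ℝ) = ∑ e, f e - ∑ e, T.indicator f e := by
    intro T f
    rw [← Finset.sum_sub_distrib]
    refine Finset.sum_congr rfl fun e _ => ?_
    rw [treeExponent_apply, Set.indicator_apply]
    split_ifs <;> simp
  have hw : ∀ T : Set E, ∑ e, T.indicator (fun e => (edgeWeight R e : ℝ)) e = treeWeight R T := by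
    intro T
    rw [treeWeight, Nat.cast_sum]
    refine Finset.sum_congr rfl fun e _ => ?_
    simp only [Set.indicator_apply]
    split_ifs <;> simp
  set W : ℝ := ∑ e, (edgeWeight R e : ℝ) with hW
  set P : Set (Option E → ℝ) := {r | ∃ (m : E →₀ ℕ) (w : ℕ),
    (MvPolynomial.coeff m (G.leePomeransky Q k)) =Θ[𝓝[>] 0] (fun lam : ℝ => lam ^ w) ∧
    r none = w ∧ ∀ e, r (some e) = m e} with hP
  have hPmem : ∀ r, r ∈ P ↔ ∃ T w, G.IsTerm T w ∧ r none = w ∧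
      ∀ e, r (some e) = treeExponent T e := by
    intro r
    constructor
    · rintro ⟨m, w, h, h1, h2⟩
      obtain ⟨T, hT, rfl⟩ := (coeff_leePomeransky_isTheta hk m w).1 h
      exact ⟨T, w, hT, h1, h2⟩
    · rintro ⟨T, w, hT, h1, h2⟩
      exact ⟨_, w, (coeff_leePomeransky_isTheta hk _ w).2 ⟨T, hT, rfl⟩, h1, h2⟩
  have hdot : ∀ (r : Option E → ℝ) (T : Set E) (w : ℕ), r none = w →
      (∀ e, r (some e) = treeExponent T e) →
      r ⬝ᵥ regionVector R = (treeWeight R T : ℝ) + w - W := by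
    intro r T w h1 h2
    rw [dotProduct, Fintype.sum_option, h1]
    have : ∑ e, r (some e) * regionVector R (some e) =
        -∑ e, (edgeWeight R e : ℝ) * (treeExponent T e : ℝ) := by
      rw [← Finset.sum_neg_distrib]
      refine Finset.sum_congr rfl fun e _ => ?_
      rw [h2, regionVector_some]
      ring
    rw [this, hsplit, hw]
    simp only [regionVector]
    ring
  have hpoint : ∀ (T : Set E) (w : ℕ), G.IsTerm T w → ∃ r ∈ P, r none = w ∧
      ∀ e, r (some e) = treeExponent T e := fun T w hT =>
    ⟨fun o => o.elim (w : ℝ) fun e => treeExponent T e,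
      (hPmem _).2 ⟨T, w, hT, rfl, fun _ => rfl⟩, rfl, fun _ => rfl⟩
  -- By `hdot` the pairing with `v_R` is the weight of the term shifted by the total weight `W`,
  -- hence the level `m - W`.
  have key := isLowerFacetNormal_convexHull_iff (P := P) (v := regionVector R) (c := (m : ℝ) - W)
    rfl ?_ ?_
  · refine key.trans (forall_congr' fun α => imp_congr_left ?_)
    constructor
    · rintro ⟨κ, hκ⟩
      refine ⟨∑ e, α e - κ, fun T w hT hTw => ?_⟩
      obtain ⟨r, hr, h1, h2⟩ := hpoint T w hT
      have h3 := hκ r hr (by rw [hdot r T w h1 h2, ← hTw]; push_cast; ring)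
      simp only [h2] at h3
      rw [hsplit] at h3
      linarith
    · rintro ⟨κ, hκ⟩
      refine ⟨∑ e, α e - κ, fun r hr hrc => ?_⟩
      obtain ⟨T, w, hT, h1, h2⟩ := (hPmem r).1 hr
      rw [hdot r T w h1 h2] at hrc
      have h3 := hκ T w hT (by
        have : (treeWeight R T : ℝ) + w = m := by linarith
        exact_mod_cast this)
      simp only [h2]
      rw [hsplit, h3]
  · intro r hr
    obtain ⟨T, w, hT, h1, h2⟩ := (hPmem r).1 hr
    rw [hdot r T w h1 h2]
    have : (m : ℝ) ≤ treeWeight R T + w := by exact_mod_cast hm T w hT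
    linarith
  · obtain ⟨T, w, hT, hTw⟩ := hex
    obtain ⟨r, hr, h1, h2⟩ := hpoint T w hT
    refine ⟨r, hr, ?_⟩
    rw [hdot r T w h1 h2, ← hTw]
    push_cast
    ring

end Polynomial

end FeynmanGraph

/-! ### Subgraphs as sets of cells; mojetic subgraphs -/

theorem SimpleGraph.Reachable.induce_induction {α : Type*} {Γ : SimpleGraph α} {s : Set α} {a b : s}
    (h : (Γ.induce s).Reachable a b) (P : α → Prop) (ha : P a)
    (step : ∀ x ∈ s, ∀ y ∈ s, Γ.Adj x y → P x → P y) : P b := by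
  obtain ⟨p⟩ := h
  induction p with
  | nil => exact ha
  | cons hadj _ ih => exact ih (step _ (Subtype.prop _) _ (Subtype.prop _) hadj ha)

namespace FeynmanGraph

variable {V E : Type*} {K L : ℕ} {G : FeynmanGraph V E K L}

section Cells

theorem incidence_adj {a b : Cell V E K L} : G.incidence.Adj a b ↔
    (∃ v l, a = .inl v ∧ b = .inr l ∧ G.OnLine v l) ∨
      (∃ v l, b = .inl v ∧ a = .inr l ∧ G.OnLine v l) := by
  simp only [incidence, SimpleGraph.fromRel_adj]
  constructor
  · rintro ⟨-, h⟩
    exact h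
  · intro h
    refine ⟨?_, h⟩
    rintro rfl
    rcases h with ⟨v, l, rfl, h, -⟩ | ⟨v, l, rfl, h, -⟩ <;> simp at h

theorem incidence_adj_inl {v : V} {b : Cell V E K L} :
    G.incidence.Adj (.inl v) b ↔ ∃ l, b = .inr l ∧ G.OnLine v l := by
  rw [incidence_adj]
  constructor
  · rintro (⟨v', l, h, rfl, h'⟩ | ⟨v', l, -, h, -⟩)
    · obtain rfl : v = v' := Sum.inl.inj h
      exact ⟨l, rfl, h'⟩
    · simp at h
  · rintro ⟨l, rfl, h⟩
    exact Or.inl ⟨v, l, rfl, rfl, h⟩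

theorem incidence_adj_inr {l : Line E K L} {b : Cell V E K L} :
    G.incidence.Adj (.inr l) b ↔ ∃ v, b = .inl v ∧ G.OnLine v l := by
  rw [incidence_adj]
  constructor
  · rintro (⟨v', l, h, -, -⟩ | ⟨v', l', rfl, h, h'⟩)
    · simp at h
    · obtain rfl : l = l' := Sum.inr.inj h
      exact ⟨v', rfl, h'⟩
  · rintro ⟨v, rfl, h⟩
    exact Or.inr ⟨v, l, rfl, rfl, h⟩

theorem joined_adj_some {a b : Cell V E K L} :
    G.joined.Adj (some a) (some b) ↔ G.incidence.Adj a b := by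
  simp only [joined, SimpleGraph.fromRel_adj]
  constructor
  · rintro ⟨-, h⟩
    rcases h with (⟨x, y, h1, h2, h3⟩ | ⟨h, -⟩) | (⟨x, y, h1, h2, h3⟩ | ⟨h, -⟩)
    · rw [Option.some_inj.1 h1, Option.some_inj.1 h2]; exact h3
    · simp at h
    · rw [Option.some_inj.1 h1, Option.some_inj.1 h2]; exact h3.symm
    · simp at h
  · intro h
    exact ⟨fun h' => h.ne (Option.some_inj.1 h'), Or.inl (Or.inl ⟨a, b, rfl, rfl, h⟩)⟩

theorem joined_adj_none {a : Option (Cell V E K L)} :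
    G.joined.Adj a none ↔ ∃ ℓ : Leg K L, a = some (.inr (.inr ℓ)) := by
  simp only [joined, SimpleGraph.fromRel_adj]
  constructor
  · rintro ⟨-, h⟩
    rcases h with (⟨x, y, h1, h2, h3⟩ | ⟨_, _, h⟩) | (⟨x, y, h1, h2, h3⟩ | ⟨-, h⟩)
    · simp at h2
    · simp at h
    · simp at h1
    · exact h
  · rintro ⟨ℓ, rfl⟩
    exact ⟨by simp, Or.inr (Or.inr ⟨trivial, ℓ, rfl⟩)⟩

theorem OnLine.ends_eq {u v : V} {e : E} (hu : G.OnLine u (.inl e)) (hv : G.OnLine v (.inl e))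
    (huv : u ≠ v) : G.ends e = s(u, v) := (Sym2.mem_and_mem_iff huv).1 ⟨hu, hv⟩

/-- Connection within a subgraph in terms of its edges. -/
theorem reach_of_induce_reachable {γ : Set (Cell V E K L)}
    (h : (G.incidence.induce γ).Preconnected) {x y : V} (hx : .inl x ∈ γ) (hy : .inl y ∈ γ) :
    G.Reach (G.inside {e | .inr (.inl e) ∈ γ} {v | .inl v ∈ γ}) x y := by
  set F := G.inside {e | .inr (.inl e) ∈ γ} {v | .inl v ∈ γ}
  -- Paths of cells alternate between vertices and lines, so at a line the invariant remembers an
  -- endpoint in `γ` that has already been reached. An external line has only one endpoint and leads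
  -- nowhere else.
  have := (h ⟨_, hx⟩ ⟨_, hy⟩).induce_induction (fun c => (∀ v, c = .inl v → G.Reach F x v) ∧
    ∀ l, c = .inr l → ∃ u, .inl u ∈ γ ∧ G.OnLine u l ∧ G.Reach F x u) ?_ ?_
  · exact this.1 y rfl
  · refine ⟨?_, fun l hl => by simp at hl⟩
    rintro v hv
    rw [Sum.inl.inj hv]
  · rintro a ha b hb hab ⟨h1, h2⟩
    rcases a with a | a
    · obtain ⟨l, rfl, hl⟩ := incidence_adj_inl.1 hab
      refine ⟨fun v hv => by simp at hv, fun l' hl' => ⟨a, ha, ?_, h1 a rfl⟩⟩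
      rwa [← Sum.inr.inj hl']
    · obtain ⟨v, rfl, hv⟩ := incidence_adj_inr.1 hab
      refine ⟨fun w hw => ?_, fun l' hl' => by simp at hl'⟩
      obtain rfl : v = w := Sum.inl.inj hw
      obtain ⟨u, hu, hul, hr⟩ := h2 a rfl
      by_cases huv : u = v
      · rwa [← huv]
      rcases a with e | ℓ
      · have hends := hul.ends_eq hv huv
        exact hr.trans (reach_of_edge (mem_inside ha hends hu hb) hends)
      · exact absurd (hul.symm.trans hv) huv

/-- A line of a connected subgraph with further cells ends in that subgraph. -/
theorem exists_onLine_of_preconnected {γ : Set (Cell V E K L)}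
    (h : (G.incidence.induce γ).Preconnected) {l : Line E K L} {c : Cell V E K L}
    (hl : .inr l ∈ γ) (hc : c ∈ γ) (hne : c ≠ .inr l) : ∃ v, G.OnLine v l ∧ .inl v ∈ γ := by
  have := (h ⟨_, hl⟩ ⟨c, hc⟩).induce_induction
    (fun c => c = .inr l ∨ ∃ v, G.OnLine v l ∧ .inl v ∈ γ) (Or.inl rfl) ?_
  · exact this.resolve_left hne
  · rintro a ha b hb hab (rfl | h')
    · obtain ⟨v, rfl, hv⟩ := incidence_adj_inr.1 hab
      exact Or.inr ⟨v, hv, hb⟩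
    · exact Or.inr h'

/-- In a mojetic subgraph no vertex cuts off cells from the external lines. -/
theorem IsMojetic.false_of_closed {γ D : Set (Cell V E K L)} (h : G.IsMojetic γ) {v : V}
    (hv : .inl v ∈ γ) (hD : D ⊆ γ) (hne : D.Nonempty) (hvD : .inl v ∉ D)
    (hleg : ∀ ℓ, .inr (.inr ℓ) ∉ D)
    (hcl : ∀ x ∈ D, ∀ y ∈ γ, y ≠ .inl v → G.incidence.Adj x y → y ∈ D) : False := by
  obtain ⟨c, hc⟩ := hne
  have hc' : some c ∈ insert none (some '' γ) \ {some (Sum.inl v)} :=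
    ⟨Or.inr ⟨c, hD hc, rfl⟩, fun h => hvD (by
      rw [← Option.some_inj.1 (Set.mem_singleton_iff.1 h)]; exact hc)⟩
  have hn : (none : Option (Cell V E K L)) ∈ insert none (some '' γ) \ {some (Sum.inl v)} :=
    ⟨Or.inl rfl, by simp⟩
  obtain ⟨x, -, hx⟩ := ((h.2.2 v hv).preconnected ⟨_, hc'⟩ ⟨_, hn⟩).induce_induction
    (fun o => ∃ x ∈ D, o = some x) ⟨c, hc, rfl⟩ (by
      rintro _ - y hy hadj ⟨x, hx, rfl⟩
      rcases y with _ | y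
      · obtain ⟨ℓ, hℓ⟩ := joined_adj_none.1 hadj
        exact absurd (Option.some_inj.1 hℓ ▸ hx) (hleg ℓ)
      · have hyγ : y ∈ γ := by
          rcases hy.1 with h | ⟨z, hz, h⟩
          · simp at h
          · rwa [← Option.some_inj.1 h]
        have hyv : y ≠ .inl v := fun h => hy.2 (by rw [h]; rfl)
        exact ⟨y, hcl x hx y hyγ hyv (joined_adj_some.1 hadj), rfl⟩)
  simp at hx

/-- In a mojetic subgraph no vertex cuts off other vertices from the external lines. -/
theorem IsMojetic.false_of_cut {γ : Set (Cell V E K L)} (h : G.IsMojetic γ) {A : Set V} {x : V}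
    (hx : .inl x ∈ γ) (hA : ∀ v ∈ A, .inl v ∈ γ) (hne : A.Nonempty) (hxA : x ∉ A)
    (hleg : ∀ ℓ, .inr (.inr ℓ) ∈ γ → G.att ℓ ∉ A)
    (hcut : ∀ e, .inr (.inl e) ∈ γ → ∀ u ∈ A, ∀ w ∉ A, G.ends e = s(u, w) → w = x) : False := by
  -- The part cut off by `x` consists of `A` and of the edges of `γ` that touch it.
  refine h.false_of_closed (D := {c | (∃ v ∈ A, c = .inl v) ∨
    ∃ e, c = .inr (.inl e) ∧ .inr (.inl e) ∈ γ ∧ ∃ u ∈ A, u ∈ G.ends e}) hx ?_ ?_ ?_ ?_ ?_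
  · rintro c (⟨v, hv, rfl⟩ | ⟨e, rfl, he, -⟩)
    · exact hA v hv
    · exact he
  · exact ⟨_, Or.inl ⟨_, hne.some_mem, rfl⟩⟩
  · rintro (⟨v, hv, h'⟩ | ⟨e, h', -⟩)
    · exact hxA (Sum.inl.inj h' ▸ hv)
    · simp at h'
  · rintro ℓ (⟨v, hv, h'⟩ | ⟨e, h', -⟩) <;> simp at h'
  · rintro c hc y hy hyx hadj
    rcases hc with ⟨v, hv, rfl⟩ | ⟨e, rfl, he, u, hu, hue⟩
    · obtain ⟨l, rfl, hl⟩ := incidence_adj_inl.1 hadj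
      rcases l with e | ℓ
      · exact Or.inr ⟨e, rfl, hy, v, hv, hl⟩
      · exact absurd (by rw [show G.att ℓ = v from hl]; exact hv) (hleg ℓ hy)
    · obtain ⟨w, rfl, hw⟩ := incidence_adj_inr.1 hadj
      refine Or.inl ⟨w, ?_, rfl⟩
      by_contra hwA
      have huw : u ≠ w := fun h => hwA (h ▸ hu)
      exact hyx (by rw [hcut e he u hu w hwA (OnLine.ends_eq (G := G) hue hw huw)])

/-- A self-loop is cut off from the external lines by its only endpoint. -/
theorem IsMojetic.ne_of_ends (hG : G.IsMojetic Set.univ) {e : E} {u v : V}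
    (h : G.ends e = s(u, v)) : u ≠ v := by
  rintro rfl
  refine hG.false_of_closed (D := {.inr (.inl e)}) (v := u) (Set.mem_univ _) (Set.subset_univ _)
    ⟨_, rfl⟩ (by simp) (by simp) ?_
  rintro _ rfl y - hyu hadj
  obtain ⟨w, rfl, hw⟩ := incidence_adj_inr.1 hadj
  have hw' : w ∈ G.ends e := hw
  rw [h] at hw'
  simp at hw'
  exact absurd (congrArg Sum.inl hw') hyu

/-- Without external lines the auxiliary vertex would be isolated. -/
theorem IsMojetic.nonempty_leg [Nonempty V] (hG : G.IsMojetic Set.univ) : Nonempty (Leg K L) := by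
  by_contra hno
  have := (hG.1.preconnected ⟨none, Or.inl rfl⟩
    ⟨some (.inl (Classical.arbitrary V)), Or.inr ⟨_, Set.mem_univ _, rfl⟩⟩).induce_induction
    (fun o => o = none) rfl (by
      rintro x - y - hadj rfl
      obtain ⟨ℓ, -⟩ := joined_adj_none.1 hadj.symm
      exact absurd ⟨ℓ⟩ hno)
  simp at this

theorem IsMojetic.reach_univ (hG : G.IsMojetic Set.univ) (x y : V) : G.Reach Set.univ x y := by
  have h : (G.incidence.induce Set.univ).Preconnected := by
    rintro ⟨a, -⟩ ⟨b, -⟩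
    have := (hG.2.1.preconnected ⟨some a, ⟨a, Set.mem_univ _, rfl⟩⟩
      ⟨some b, ⟨b, Set.mem_univ _, rfl⟩⟩).induce_induction
      (fun o => ∀ c, o = some c →
        (G.incidence.induce Set.univ).Reachable ⟨a, Set.mem_univ _⟩ ⟨c, Set.mem_univ _⟩) (by
          intro c hc
          rw [Option.some_inj.1 hc]) (by
          rintro _ ⟨p, -, rfl⟩ q - hadj hp c rfl
          exact (hp p rfl).trans (SimpleGraph.Adj.reachable (joined_adj_some.1 hadj)))
    exact this b rfl
  exact (reach_of_induce_reachable h (Set.mem_univ x) (Set.mem_univ y)).mono (Set.subset_univ _)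

end Cells

/-! ### Hard, jet and soft vertices under the basic requirements -/

section Configuration

variable (G) (R : E → Mode K)

/-- The vertices of the hard subgraph. -/
def hardVerts : Set V := {v | .inl v ∈ G.hardPart R}

/-- The vertices of the jet `i`. -/
def jetVerts (i : Fin K) : Set V := {v | .inl v ∈ G.jetPart R i}

/-- The vertices of the soft subgraph. -/
def softVerts : Set V := {v | .inl v ∈ G.softPart R}

/-- The hard edges. -/
def hardEdges : Set E := {e | R e = .hard}

/-- The edges that are not soft. -/
def nonsoftEdges : Set E := {e | R e ≠ .soft}

variable {G R} {e : E} {u v x y : V} {i j : Fin K} {ℓ : Leg K L}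

theorem hardEdges_subset : hardEdges R ⊆ nonsoftEdges R := fun e he h => by
  rw [hardEdges, Set.mem_ofPred_eq, h] at he
  cases he

theorem mem_nonsoftEdges_iff : e ∈ nonsoftEdges R ↔ R e = .hard ∨ ∃ i, R e = .jet i := by
  simp only [nonsoftEdges, Set.mem_ofPred_eq]
  cases R e <;> simp

theorem vertex_cases (v : V) :
    v ∈ G.hardVerts R ∨ (∃ i, v ∈ G.jetVerts R i) ∨ v ∈ G.softVerts R := by
  by_cases h1 : v ∈ G.softVerts R
  · exact Or.inr (Or.inr h1)
  by_cases h2 : ∃ i, v ∈ G.jetVerts R i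
  · exact Or.inr (Or.inl h2)
  · exact Or.inl ⟨h1, not_exists.1 h2⟩

theorem notMem_softVerts_of_hard (hv : v ∈ G.hardVerts R) : v ∉ G.softVerts R := hv.1

theorem notMem_jetVerts_of_hard (hv : v ∈ G.hardVerts R) : v ∉ G.jetVerts R i := hv.2 i

theorem notMem_softVerts_of_jet (hv : v ∈ G.jetVerts R i) : v ∉ G.softVerts R := by
  intro h
  obtain ⟨⟨l, hl, hm⟩, -⟩ := hv
  have := h l hl
  rw [hm] at this
  cases this

theorem eq_of_mem_jetVerts (hi : v ∈ G.jetVerts R i) (hj : v ∈ G.jetVerts R j) : i = j := by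
  obtain ⟨⟨l, hl, hm⟩, -⟩ := hi
  rcases hj.2 l hl with h | h
  · rw [hm] at h
    exact Mode.jet.inj h
  · rw [hm] at h
    cases h

theorem hard_or_jet_of_notMem_softVerts (hv : v ∉ G.softVerts R) :
    v ∈ G.hardVerts R ∨ ∃ i, v ∈ G.jetVerts R i := by
  rcases G.vertex_cases (R := R) v with h | h | h
  · exact Or.inl h
  · exact Or.inr h
  · exact absurd h hv

theorem mode_of_mem_softVerts (hv : v ∈ G.softVerts R) (he : v ∈ G.ends e) : R e = .soft :=
  hv (.inl e) he

theorem mode_of_mem_jetVerts (hv : v ∈ G.jetVerts R i) (he : v ∈ G.ends e) :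
    R e = .jet i ∨ R e = .soft := hv.2 (.inl e) he

theorem mem_hardVerts_of_hard (he : R e = .hard) (hv : v ∈ G.ends e) : v ∈ G.hardVerts R := by
  refine ⟨fun h => ?_, fun i h => ?_⟩
  · have := mode_of_mem_softVerts h hv
    rw [he] at this; cases this
  · rcases mode_of_mem_jetVerts h hv with h | h <;> · rw [he] at h; cases h

theorem hard_or_jet_of_jet (he : R e = .jet i) (hv : v ∈ G.ends e) :
    v ∈ G.hardVerts R ∨ v ∈ G.jetVerts R i := by
  rcases G.vertex_cases (R := R) v with h | ⟨j, h⟩ | h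
  · exact Or.inl h
  · rcases mode_of_mem_jetVerts h hv with h' | h'
    · rw [he] at h'
      exact Or.inr (Mode.jet.inj h' ▸ h)
    · rw [he] at h'; cases h'
  · have := mode_of_mem_softVerts h hv
    rw [he] at this; cases this

theorem notMem_softVerts_of_nonsoft (he : e ∈ nonsoftEdges R) (hv : v ∈ G.ends e) :
    v ∉ G.softVerts R := fun h => he (mode_of_mem_softVerts h hv)

theorem jet_of_nonsoft (he : e ∈ nonsoftEdges R) (hu : u ∈ G.jetVerts R i) (h : u ∈ G.ends e) :
    R e = .jet i := (mode_of_mem_jetVerts hu h).resolve_right he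

variable (hR : G.BasicRequirements R)

include hR

theorem BasicRequirements.reach_hard (hx : x ∈ G.hardVerts R) (hy : y ∈ G.hardVerts R) :
    G.Reach (hardEdges R) x y :=
  (reach_of_induce_reachable hR.hard_connected.preconnected hx hy).mono fun _ h => h.1

theorem BasicRequirements.reach_jet (hx : x ∈ G.jetVerts R i) (hy : y ∈ G.jetVerts R i) :
    G.Reach (G.inside {e | R e = .jet i} (G.jetVerts R i)) x y :=
  reach_of_induce_reachable (hR.jet_connected i).preconnected hx hy

theorem BasicRequirements.att_mem_jetVerts (hx : x ∈ G.jetVerts R i) :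
    G.att (.inl i) ∈ G.jetVerts R i := by
  obtain ⟨v, hv, hvJ⟩ := exists_onLine_of_preconnected (hR.jet_connected i).preconnected
    (l := .inr (.inl i)) (c := .inl x) rfl hx (by simp)
  rw [show G.att (.inl i) = v from hv]
  exact hvJ

/-- The line `p_i` is always a cell of its jet, so by connectedness an edge of the jet cannot lie in
it without an endpoint. -/
theorem BasicRequirements.exists_jetVert_of_jet (he : R e = .jet i) :
    ∃ v ∈ G.ends e, v ∈ G.jetVerts R i := by
  obtain ⟨v, hv, hvJ⟩ := exists_onLine_of_preconnected (hR.jet_connected i).preconnected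
    (l := .inl e) (c := .inr (.inr (.inl i))) he rfl (by simp)
  exact ⟨v, hv, hvJ⟩

theorem BasicRequirements.att_notMem_softVerts (ℓ : Leg K L) : G.att ℓ ∉ G.softVerts R :=
  hR.soft_external ℓ

/-- A vertex of the jet meets no hard line, so the attachment is a line of the jet ending at a hard
vertex. This line is an edge, because `p_i` enters at a vertex of the jet as soon as the jet has
one. -/
theorem BasicRequirements.exists_jet_edge_to_hard (hx : x ∈ G.jetVerts R i) :
    ∃ e, R e = .jet i ∧ ∃ u ∈ G.jetVerts R i, ∃ h ∈ G.hardVerts R, G.ends e = s(u, h) := by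
  obtain ⟨a, ha, b, hb, hab⟩ := hR.jet_attached i
  rcases a with a | a
  · obtain ⟨l, rfl, hl⟩ := incidence_adj_inl.1 hab
    have hb' : lineMode R l = .hard := hb
    rcases ha.2 l hl with h | h <;> · rw [hb'] at h; cases h
  · obtain ⟨h, rfl, hh⟩ := incidence_adj_inr.1 hab
    rcases a with e | ℓ
    · obtain ⟨u, hue, hu⟩ := hR.exists_jetVert_of_jet (e := e) ha
      have hne : u ≠ h := by
        rintro rfl
        exact notMem_jetVerts_of_hard hb hu
      exact ⟨e, ha, u, hu, h, hb, OnLine.ends_eq (G := G) hue hh hne⟩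
    · rcases ℓ with k | k
      · have : k = i := Mode.jet.inj ha
        subst this
        have h1 := hR.att_mem_jetVerts hx
        rw [show G.att (.inl k) = h from hh] at h1
        exact absurd h1 (notMem_jetVerts_of_hard hb)
      · cases (show Mode.hard = .jet i from ha)

theorem BasicRequirements.hardVerts_nonempty : (G.hardVerts R).Nonempty := by
  obtain ⟨⟨c, hc⟩⟩ := hR.hard_connected.nonempty
  rcases c with v | e | i | j
  · exact ⟨v, hc⟩
  · obtain ⟨u, v, h⟩ := G.exists_ends e
    exact ⟨u, mem_hardVerts_of_hard hc (by rw [h]; exact Sym2.mem_mk_left u v)⟩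
  · cases (show Mode.jet i = .hard from hc)
  · exact ⟨_, hR.hard_offShell j⟩

theorem BasicRequirements.exists_reach_hard (hx : x ∈ G.jetVerts R i) :
    ∃ h ∈ G.hardVerts R, G.Reach {e | R e = .jet i} x h := by
  obtain ⟨e, he, u, hu, h, hh, hends⟩ := hR.exists_jet_edge_to_hard hx
  exact ⟨h, hh, ((hR.reach_jet hx hu).mono inside_subset).trans (reach_of_edge he hends)⟩

theorem BasicRequirements.reach_nonsoft (hx : x ∉ G.softVerts R) (hy : y ∉ G.softVerts R) :
    G.Reach (nonsoftEdges R) x y := by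
  have key : ∀ x ∉ G.softVerts R, ∃ h ∈ G.hardVerts R, G.Reach (nonsoftEdges R) x h := by
    intro x hx
    rcases hard_or_jet_of_notMem_softVerts hx with h | ⟨i, h⟩
    · exact ⟨x, h, Reach.refl x⟩
    · obtain ⟨w, hw, hr⟩ := hR.exists_reach_hard h
      exact ⟨w, hw, hr.mono fun e he => mem_nonsoftEdges_iff.2 (Or.inr ⟨i, he⟩)⟩
  obtain ⟨a, ha, hxa⟩ := key x hx
  obtain ⟨b, hb, hyb⟩ := key y hy
  exact (hxa.trans ((hR.reach_hard ha hb).mono hardEdges_subset)).trans hyb.symm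

/-- A leg entering at a jet is the momentum of the jet. -/
theorem BasicRequirements.eq_of_att_mem (h : G.att ℓ ∈ G.jetVerts R i) : ℓ = .inl i :=
  hR.jet_external i ℓ h

-- The weights 0, 1, 2 are 2 minus one for each of the nested classes, hard and nonsoft, that
-- contains the edge.
omit hR in
theorem treeWeight_add_ncard [Fintype E] (R : E → Mode K) (T : Set E) :
    treeWeight R T + (T ∩ hardEdges R).ncard + (T ∩ nonsoftEdges R).ncard = 2 * T.ncard := by
  classical
  have hn : ∀ S : Set E, S.ncard = ∑ e, S.indicator (fun _ => 1) e := by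
    intro S
    rw [Set.ncard_eq_toFinset_card', Finset.card_eq_sum_ones, ← Finset.sum_subset (Finset.subset_univ S.toFinset)]
    · exact Finset.sum_congr rfl fun e he => by
        rw [Set.indicator_of_mem (Set.mem_toFinset.1 he)]
    · intro e _ he
      rw [Set.indicator_of_notMem fun h => he (Set.mem_toFinset.2 h)]
  rw [hn, hn, hn, treeWeight, Finset.mul_sum, ← Finset.sum_add_distrib, ← Finset.sum_add_distrib]
  refine Finset.sum_congr rfl fun e _ => ?_
  by_cases he : e ∈ T
  · simp only [Set.indicator_apply, he, Set.mem_inter_iff, true_and, if_true, edgeWeight, hardEdges,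
      nonsoftEdges, Set.mem_ofPred_eq]
    cases R e <;> simp
  · simp [he]

-- Weights are compared through component counts because these only grow when edges are dropped, so
-- both terms on the right are bounded below independently of `T`.
omit hR in
theorem IsForest.treeWeight_add [Finite V] [Fintype E] {T : Set E} (hT : G.IsForest T) :
    treeWeight R T + 2 * G.numComp T =
      G.numComp (T ∩ hardEdges R) + G.numComp (T ∩ nonsoftEdges R) := by
  have h1 := hT.ncard_add_numComp
  have h2 := (hT.subset (X := T ∩ hardEdges R) Set.inter_subset_left).ncard_add_numComp
  have h3 := (hT.subset (X := T ∩ nonsoftEdges R) Set.inter_subset_left).ncard_add_numComp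
  have h4 := treeWeight_add_ncard R T
  omega

end Configuration

end FeynmanGraph

/-! ### Terms of minimal weight -/

namespace FeynmanGraph

variable {V E : Type*} {K L : ℕ} {G : FeynmanGraph V E K L} {R : E → Mode K}
  {T F : Set E} {w : ℕ} {u v x y z : V} {i : Fin K}

/-- A path of nonsoft edges that does not meet the hard vertices stays in its jet. -/
theorem Reach.mem_jetVerts (hF : F ⊆ nonsoftEdges R) (hx : x ∈ G.jetVerts R i)
    (hno : ∀ h ∈ G.hardVerts R, ¬ G.Reach F x h) (h : G.Reach F x y) : y ∈ G.jetVerts R i := by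
  refine h.induction (· ∈ G.jetVerts R i) hx fun e he u v huv hr hu => ?_
  have hjet := jet_of_nonsoft (hF he) hu (by rw [huv]; exact Sym2.mem_mk_left u v)
  exact (hard_or_jet_of_jet hjet (by rw [huv]; exact Sym2.mem_mk_right u v)).resolve_left
    fun hv => hno v hv (hr.trans (reach_of_edge he huv))

theorem IsSpanningTwoTree.eq_one_of_subset (hT : G.IsSpanningTwoTree T)
    (hs : IsSplit (G.legSide T v) w) (h : ∀ ℓ, G.Reach T x (G.att ℓ) → ℓ = .inl i) : w = 1 :=
  (hT.isSplit (v := x) hs).eq_one_of_subset (i := i) h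

theorem exists_att_not_reach (hs : IsSplit (G.legSide T v) w) (x : V) :
    ∃ ℓ, ¬ G.Reach T x (G.att ℓ) := by
  obtain ⟨ℓ, hℓ⟩ := hs.1
  obtain ⟨ℓ', hℓ'⟩ := hs.2.1
  by_contra hcon
  push Not at hcon
  exact hℓ' ((Reach.trans hℓ (hcon ℓ).symm).trans (hcon ℓ'))

theorem IsSpanningTwoTree.exists_att_reach (hT : G.IsSpanningTwoTree T)
    (hs : IsSplit (G.legSide T v) w) (x : V) : ∃ ℓ, G.Reach T x (G.att ℓ) :=
  (hT.isSplit (v := x) hs).1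

section Bounds

variable [Finite V]

/-- External lines enter on both sides of the 2-tree, always at nonsoft vertices, which the nonsoft
edges join to each other. -/
theorem IsSpanningTwoTree.numComp_nonsoft_lt (hT : G.IsSpanningTwoTree T)
    (hR : G.BasicRequirements R) (hs : IsSplit (G.legSide T v) w) :
    G.numComp (nonsoftEdges R) + 1 ≤ G.numComp (T ∩ nonsoftEdges R) := by
  obtain ⟨ℓ, hℓ⟩ := hT.exists_att_reach hs v
  obtain ⟨ℓ', hℓ'⟩ := exists_att_not_reach hs (G.att ℓ)
  by_contra hlt
  push Not at hlt
  exact hℓ' ((reach_of_numComp_le Set.inter_subset_right (by omega)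
    (hR.reach_nonsoft (hR.att_notMem_softVerts ℓ) (hR.att_notMem_softVerts ℓ'))).mono
      Set.inter_subset_left)

/-- All nonsoft vertices are joined by nonsoft edges, so vertices kept apart by `T` are counted as
additional components. Lists of three or four vertices are used below to exceed the budget of a
minimal 2-tree. -/
theorem BasicRequirements.length_le (hR : G.BasicRequirements R) (l : List V)
    (hl : l.Pairwise fun x y => ¬ G.Reach (T ∩ nonsoftEdges R) x y)
    (hns : ∀ x ∈ l, x ∉ G.softVerts R) :
    G.numComp (nonsoftEdges R) + l.length ≤ G.numComp (T ∩ nonsoftEdges R) + 1 := by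
  obtain ⟨h, hh⟩ := hR.hardVerts_nonempty
  exact numComp_add_length_le Set.inter_subset_right h l hl fun x hx =>
    hR.reach_nonsoft (hns x hx) (notMem_softVerts_of_hard hh)

/-- All hard vertices are on one side. On the other side the external lines enter in a single
nonsoft component, since a second one would be one too many. That component avoids the hard
vertices, so it stays in one jet and only `p_i` can enter it. -/
theorem IsSpanningTwoTree.eq_one (hT : G.IsSpanningTwoTree T) (hR : G.BasicRequirements R)
    (hs : IsSplit (G.legSide T v) w)
    (ha : G.numComp (T ∩ hardEdges R) ≤ G.numComp (hardEdges R))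
    (hb : G.numComp (T ∩ nonsoftEdges R) ≤ G.numComp (nonsoftEdges R) + 1) : w = 1 := by
  obtain ⟨h, hh⟩ := hR.hardVerts_nonempty
  have hsub : T ∩ nonsoftEdges R ⊆ T := Set.inter_subset_left
  have hHreach : ∀ h' ∈ G.hardVerts R, G.Reach T h h' := fun h' hh' =>
    (reach_of_numComp_le Set.inter_subset_right ha (hR.reach_hard hh hh')).mono
      Set.inter_subset_left
  obtain ⟨ℓ, hℓ⟩ := exists_att_not_reach hs h
  have hno : ∀ h' ∈ G.hardVerts R, ¬ G.Reach (T ∩ nonsoftEdges R) (G.att ℓ) h' := fun h' hh' hr =>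
    hℓ ((hHreach h' hh').trans (hr.mono hsub).symm)
  have hnh : G.att ℓ ∉ G.hardVerts R := fun hmem => hℓ (hHreach _ hmem)
  obtain ⟨i, hi⟩ := (hard_or_jet_of_notMem_softVerts (hR.att_notMem_softVerts ℓ)).resolve_left hnh
  refine hT.eq_one_of_subset hs (x := G.att ℓ) (i := i) fun ℓ' hℓ' => ?_
  apply hR.eq_of_att_mem
  refine Reach.mem_jetVerts Set.inter_subset_right hi hno ?_
  by_contra hr
  have := hR.length_le [h, G.att ℓ, G.att ℓ'] (T := T) (by
    simp only [List.pairwise_cons, List.mem_cons, List.not_mem_nil, or_false, forall_eq_or_imp,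
      forall_eq, List.Pairwise.nil, and_true, hr, not_false_iff]
    simp only [IsEmpty.forall_iff, implies_true, and_true]
    exact ⟨fun hr => hℓ (hr.mono hsub), fun hr => hℓ ((hr.mono hsub).trans hℓ'.symm)⟩) (by
    simp [notMem_softVerts_of_hard hh, hR.att_notMem_softVerts])
  simp at this
  omega

end Bounds

section MinWeight

variable (G R) in
/-- The least weight of the terms of the Lee-Pomeransky polynomial. -/
noncomputable def minWeight : ℕ := G.numComp (hardEdges R) + G.numComp (nonsoftEdges R) - 2

theorem numComp_pos [Finite V] [Nonempty V] : 0 < G.numComp F := Nat.card_pos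

variable [Finite V] [Nonempty V] [Fintype E]

/-- A 2-tree has one component more than a tree, which lowers its weight by two. The first unit is
regained from the additional nonsoft component, the second from a further component or, if there is
none, from `w = 1`. -/
theorem IsTerm.minWeight_le (h : G.IsTerm T w) (hR : G.BasicRequirements R) :
    G.minWeight R ≤ treeWeight R T + w := by
  have h1 : G.numComp (hardEdges R) ≤ G.numComp (T ∩ hardEdges R) :=
    numComp_anti Set.inter_subset_right
  have h2 : G.numComp (nonsoftEdges R) ≤ G.numComp (T ∩ nonsoftEdges R) :=
    numComp_anti Set.inter_subset_right
  rcases h with ⟨hT, rfl⟩ | ⟨hT, v, hs⟩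
  · have h3 := hT.1.treeWeight_add (R := R)
    rw [hT.numComp_eq] at h3
    unfold minWeight
    omega
  · have h3 := hT.1.treeWeight_add (R := R)
    rw [hT.numComp_eq] at h3
    have h4 := hT.numComp_nonsoft_lt hR hs
    have h5 := hT.eq_one hR hs
    unfold minWeight
    by_cases ha : G.numComp (T ∩ hardEdges R) ≤ G.numComp (hardEdges R)
    · by_cases hb : G.numComp (T ∩ nonsoftEdges R) ≤ G.numComp (nonsoftEdges R) + 1
      · have := h5 ha hb
        omega
      · omega
    · omega

/-- Spanning trees of minimal weight. -/
theorem IsSpanningTree.numComp_of_minWeight (hT : G.IsSpanningTree T)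
    (hm : treeWeight R T = G.minWeight R) :
    G.numComp (T ∩ hardEdges R) = G.numComp (hardEdges R) ∧
      G.numComp (T ∩ nonsoftEdges R) = G.numComp (nonsoftEdges R) := by
  have h1 : G.numComp (hardEdges R) ≤ G.numComp (T ∩ hardEdges R) :=
    numComp_anti Set.inter_subset_right
  have h2 : G.numComp (nonsoftEdges R) ≤ G.numComp (T ∩ nonsoftEdges R) :=
    numComp_anti Set.inter_subset_right
  have h3 := hT.1.treeWeight_add (R := R)
  rw [hT.numComp_eq] at h3
  -- Positivity of both counts ensures that the subtraction in `minWeight` is not truncated.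
  have h4 : 0 < G.numComp (hardEdges R) := numComp_pos
  have h5 : 0 < G.numComp (nonsoftEdges R) := numComp_pos
  unfold minWeight at hm
  omega

/-- Spanning 2-trees of minimal weight. -/
theorem IsSpanningTwoTree.numComp_of_minWeight (hT : G.IsSpanningTwoTree T)
    (hm : treeWeight R T + w = G.minWeight R) :
    G.numComp (T ∩ hardEdges R) + G.numComp (T ∩ nonsoftEdges R) + w =
      G.numComp (hardEdges R) + G.numComp (nonsoftEdges R) + 2 := by
  have h3 := hT.1.treeWeight_add (R := R)
  rw [hT.numComp_eq] at h3
  have h4 : 0 < G.numComp (hardEdges R) := numComp_pos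
  have h5 : 0 < G.numComp (nonsoftEdges R) := numComp_pos
  unfold minWeight at hm
  omega

theorem treeWeight_insert {e : E} (he : e ∉ T) :
    treeWeight R (insert e T) = treeWeight R T + edgeWeight R e := by
  classical
  have h : ∀ e', (insert e T).indicator (edgeWeight R) e' =
      T.indicator (edgeWeight R) e' + if e' = e then edgeWeight R e else 0 := by
    intro e'
    by_cases h1 : e' = e
    · subst h1; simp [he]
    · by_cases h2 : e' ∈ T <;> simp [h1, h2]
  simp only [treeWeight, h, Finset.sum_add_distrib, Finset.sum_ite_eq', Finset.mem_univ, if_true]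

theorem sum_indicator_insert {e : E} (he : e ∉ T) (α : E → ℝ) :
    ∑ e', (insert e T).indicator α e' = ∑ e', T.indicator α e' + α e := by
  classical
  have h : ∀ e', (insert e T).indicator α e' = T.indicator α e' + if e' = e then α e else 0 := by
    intro e'
    by_cases h1 : e' = e
    · subst h1; simp [he]
    · by_cases h2 : e' ∈ T <;> simp [h1, h2]
  simp only [h, Finset.sum_add_distrib, Finset.sum_ite_eq', Finset.mem_univ, if_true]

variable (G R) in
/-- Spanning trees that restrict to spanning forests of the hard and of the nonsoft edges. -/
def IsMinTree (T : Set E) : Prop :=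
  G.IsSpanningTree T ∧ (∀ x y, G.Reach (hardEdges R) x y → G.Reach (T ∩ hardEdges R) x y) ∧
    ∀ x y, G.Reach (nonsoftEdges R) x y → G.Reach (T ∩ nonsoftEdges R) x y

theorem IsMinTree.treeWeight_eq (hT : G.IsMinTree R T) : treeWeight R T = G.minWeight R := by
  have h1 := numComp_congr (G := G) (F := T ∩ hardEdges R) Set.inter_subset_right hT.2.1
  have h2 := numComp_congr (G := G) (F := T ∩ nonsoftEdges R) Set.inter_subset_right hT.2.2
  have h3 := hT.1.1.treeWeight_add (R := R)
  rw [hT.1.numComp_eq] at h3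
  unfold minWeight
  omega

omit [Finite V] [Nonempty V] [Fintype E] in
/-- Compatible spanning forests of the hard and of the nonsoft edges extend to a spanning tree. -/
theorem exists_isMinTree [Nonempty V] [Finite E] {F₁ F₂ : Set E}
    (h1 : F₁ ⊆ hardEdges R) (h1' : ∀ x y, G.Reach (hardEdges R) x y → G.Reach F₁ x y)
    (h12 : F₁ ⊆ F₂) (hF : G.IsForest F₂) (h2 : F₂ ⊆ nonsoftEdges R)
    (h2' : ∀ x y, G.Reach (nonsoftEdges R) x y → G.Reach F₂ x y) {X : Set E} (hFX : F₂ ⊆ X)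
    (hX : ∀ x y, G.Reach X x y) :
    ∃ T, G.IsMinTree R T ∧ F₂ ⊆ T ∧ T ⊆ X ∧ T ∩ nonsoftEdges R = F₂ := by
  obtain ⟨T, hT, hFT, hTX, hr⟩ := hF.exists_extension hFX
  refine ⟨T, ⟨isSpanningTree_iff.2 ⟨hT, fun x y => hr x y (hX x y)⟩, fun x y h => ?_,
    fun x y h => ?_⟩, hFT, hTX, ?_⟩
  · exact (h1' x y h).mono fun e he => ⟨hFT (h12 he), h1 he⟩
  · exact (h2' x y h).mono fun e he => ⟨hFT he, h2 he⟩
  · refine Set.Subset.antisymm ?_ fun e he => ⟨hFT he, h2 he⟩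
    -- The ends of a nonsoft edge are already joined in `F₂`, so a further such edge would close a
    -- loop.
    rintro e ⟨heT, hens⟩
    by_contra heF
    obtain ⟨u, v, huv⟩ := G.exists_ends e
    exact hT.not_reach_diff heT huv ((h2' u v (reach_of_edge hens huv)).mono fun f hf =>
      ⟨hFT hf, fun h => heF (Set.mem_singleton_iff.1 h ▸ hf)⟩)

end MinWeight

end FeynmanGraph

/-! ### Necessity: soft components attached to at most one jet -/

theorem SimpleGraph.induce_preconnected_of_closed {α : Type*} {Γ : SimpleGraph α} {s : Set α}
    (H : ∀ D ⊆ s, D.Nonempty → (∀ x ∈ D, ∀ y ∈ s, Γ.Adj x y → y ∈ D) → s ⊆ D) :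
    (Γ.induce s).Preconnected := by
  rintro ⟨a, ha⟩ ⟨b, hb⟩
  obtain ⟨hb', hr⟩ := H {c | ∃ h : c ∈ s, (Γ.induce s).Reachable ⟨a, ha⟩ ⟨c, h⟩}
    (fun c hc => hc.1) ⟨a, ha, SimpleGraph.Reachable.refl _⟩ (by
      rintro x ⟨hx, hr⟩ y hy hadj
      exact ⟨hy, hr.trans (SimpleGraph.Adj.reachable hadj)⟩) hb
  exact hr

/-- A connected part of `s` that meets a closed part is contained in it. -/
theorem SimpleGraph.subset_of_induce_preconnected {α : Type*} {Γ : SimpleGraph α} {s t D : Set α}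
    (h : (Γ.induce t).Preconnected) (hts : t ⊆ s) (hcl : ∀ x ∈ D, ∀ y ∈ s, Γ.Adj x y → y ∈ D)
    (hne : (t ∩ D).Nonempty) : t ⊆ D := by
  obtain ⟨c, hc, hcD⟩ := hne
  intro y hy
  exact (h ⟨c, hc⟩ ⟨y, hy⟩).induce_induction (· ∈ D) hcD fun x _ y hy hadj hx =>
    hcl x hx y (hts hy) hadj

namespace FeynmanGraph

variable {V E : Type*} {K L : ℕ} {G : FeynmanGraph V E K L} {R : E → Mode K}

section Components

theorem IsComponent.subset {γ C : Set (Cell V E K L)} (h : G.IsComponent γ C) : C ⊆ γ := by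
  obtain ⟨c, rfl⟩ := h
  rintro _ ⟨x, -, rfl⟩
  exact x.2

theorem IsComponent.nonempty {γ C : Set (Cell V E K L)} (h : G.IsComponent γ C) : C.Nonempty := by
  obtain ⟨c, rfl⟩ := h
  exact c.nonempty_supp.image _

theorem IsComponent.closed {γ C : Set (Cell V E K L)} (h : G.IsComponent γ C)
    {x y : Cell V E K L} (hx : x ∈ C) (hy : y ∈ γ) (hadj : G.incidence.Adj x y) : y ∈ C := by
  obtain ⟨c, rfl⟩ := h
  obtain ⟨x, hx, rfl⟩ := hx
  refine ⟨⟨y, hy⟩, ?_, rfl⟩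
  rw [SimpleGraph.ConnectedComponent.mem_supp_iff] at hx ⊢
  rw [← hx]
  exact SimpleGraph.ConnectedComponent.sound
    (SimpleGraph.Adj.reachable (G := G.incidence.induce γ) (u := ⟨y, hy⟩) (v := x) hadj.symm)

variable (G) in
theorem exists_isComponent {γ : Set (Cell V E K L)} {x : Cell V E K L} (hx : x ∈ γ) :
    ∃ C, G.IsComponent γ C ∧ x ∈ C ∧
      ∀ D : Set (Cell V E K L), x ∈ D → (∀ a ∈ D, ∀ b ∈ γ, G.incidence.Adj a b → b ∈ D) → C ⊆ D := by
  refine ⟨_, ⟨(G.incidence.induce γ).connectedComponentMk ⟨x, hx⟩, rfl⟩, ⟨⟨x, hx⟩, rfl, rfl⟩, ?_⟩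
  rintro D hxD hcl _ ⟨y, hy, rfl⟩
  have hr : (G.incidence.induce γ).Reachable ⟨x, hx⟩ y :=
    (SimpleGraph.ConnectedComponent.exact hy).symm
  exact hr.induce_induction (· ∈ D) hxD fun a _ b hb hadj ha => hcl a ha b hb hadj

/-- A connected subgraph that is not mojetic has cells which one vertex cuts off from the external
lines. -/
theorem exists_closed_of_not_isMojetic {γ : Set (Cell V E K L)}
    (hc : (G.incidence.induce γ).Preconnected) {ℓ : Leg K L} (hℓ : .inr (.inr ℓ) ∈ γ)
    (h : ¬ G.IsMojetic γ) : ∃ v, .inl v ∈ γ ∧ ∃ D ⊆ γ, D.Nonempty ∧ .inl v ∉ D ∧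
      (∀ ℓ, .inr (.inr ℓ) ∉ D) ∧
      ∀ x ∈ D, ∀ y ∈ γ, y ≠ .inl v → G.incidence.Adj x y → y ∈ D := by
  by_contra hcon
  apply h
  have : Nonempty (some '' γ : Set (Option (Cell V E K L))) := ⟨⟨_, _, hℓ, rfl⟩⟩
  have hnone : ∀ v : V, Nonempty
      (insert none (some '' γ) \ {some (Sum.inl v)} : Set (Option (Cell V E K L))) :=
    fun v => ⟨⟨none, Or.inl rfl, by simp⟩⟩
  have h2 : ∀ D ⊆ insert none (some '' γ), (∃ c ∈ γ, some c ∈ D) →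
      (∀ x ∈ D, ∀ y ∈ some '' γ, G.joined.Adj x y → y ∈ D) → some '' γ ⊆ D := by
    rintro D hD ⟨c, hc', hcD⟩ hcl
    rintro _ ⟨y, hy, rfl⟩
    exact (hc ⟨c, hc'⟩ ⟨y, hy⟩).induce_induction (fun z => some z ∈ D) hcD
      fun x hx y hy hadj hxD => hcl _ hxD _ ⟨y, hy, rfl⟩ (joined_adj_some.2 hadj)
  refine ⟨⟨SimpleGraph.induce_preconnected_of_closed ?_⟩,
    ⟨SimpleGraph.induce_preconnected_of_closed ?_⟩, fun v hv =>
    ⟨SimpleGraph.induce_preconnected_of_closed ?_⟩⟩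
  · rintro D hD ⟨d, hd⟩ hcl
    have hcl' : ∀ x ∈ D, ∀ y ∈ some '' γ, G.joined.Adj x y → y ∈ D :=
      fun x hx y hy => hcl x hx y (Or.inr hy)
    have hadj : G.joined.Adj (some (.inr (.inr ℓ))) none := joined_adj_none.2 ⟨ℓ, rfl⟩
    have hsub : some '' γ ⊆ D := by
      apply h2 D hD _ hcl'
      rcases hD hd with rfl | ⟨c, hc', rfl⟩
      · exact ⟨_, hℓ, hcl' _ hd _ ⟨_, hℓ, rfl⟩ hadj.symm⟩
      · exact ⟨c, hc', hd⟩
    exact Set.insert_subset (hcl _ (hsub ⟨_, hℓ, rfl⟩) _ (Or.inl rfl) hadj) hsub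
  · rintro D hD ⟨d, hd⟩ hcl
    obtain ⟨c, hc', rfl⟩ := hD hd
    exact h2 D (hD.trans (Set.subset_insert _ _)) ⟨c, hc', hd⟩ hcl
  · have key : ∀ D ⊆ insert none (some '' γ) \ {some (Sum.inl v)}, none ∉ D → D.Nonempty →
        (∀ x ∈ D, ∀ y ∈ insert none (some '' γ) \ {some (Sum.inl v)}, G.joined.Adj x y → y ∈ D) →
        False := by
      rintro D hD hn ⟨d, hd⟩ hcl
      refine hcon ⟨v, hv, {c | some c ∈ D}, ?_, ?_, ?_, ?_, ?_⟩
      · intro c hc'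
        rcases (hD hc').1 with h | ⟨c', h, h'⟩
        · simp at h
        · rwa [← Option.some_inj.1 h']
      · rcases d with _ | c
        · exact absurd hd hn
        · exact ⟨c, hd⟩
      · exact fun h => (hD h).2 rfl
      · exact fun ℓ' h => hn (hcl _ h none ⟨Or.inl rfl, by simp⟩ (joined_adj_none.2 ⟨ℓ', rfl⟩))
      · intro x hx y hy hyv hadj
        exact hcl _ hx _ ⟨Or.inr ⟨y, hy, rfl⟩, fun h => hyv (Option.some_inj.1 h)⟩
          (joined_adj_some.2 hadj)
    intro D hD hDne hcl
    by_contra hsub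
    -- A set closed under adjacency has a closed complement, and one of the two avoids the auxiliary
    -- vertex and hence all external lines.
    by_cases hn : none ∈ D
    · refine key ((insert none (some '' γ) \ {some (Sum.inl v)}) \ D) Set.sdiff_subset
        (fun h => h.2 hn) (Set.sdiff_nonempty.2 hsub) ?_
      rintro x ⟨hx, hxD⟩ y hy hadj
      exact ⟨hy, fun hyD => hxD (hcl y hyD x hx hadj.symm)⟩
    · exact key D hD hn hDne hcl

end Components

section Constancy

variable [Finite V] [Nonempty V] [Fintype E]

theorem sum_indicator_indicator_one (S T : Set E) :
    ∑ e, T.indicator (S.indicator fun _ => (1 : ℝ)) e = ((T ∩ S).ncard : ℝ) := by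
  classical
  rw [Set.indicator_indicator, Set.ncard_eq_toFinset_card', Finset.card_eq_sum_ones, Nat.cast_sum,
    ← Finset.sum_subset (Finset.subset_univ (T ∩ S).toFinset)]
  · exact Finset.sum_congr rfl fun e he => by
      rw [Set.indicator_of_mem (Set.mem_toFinset.1 he), Nat.cast_one]
  · intro e _ he
    rw [Set.indicator_of_notMem fun h => he (Set.mem_toFinset.2 h)]

omit [Finite V] [Fintype E] in
theorem IsTerm.exists_att_reach {T : Set E} {w : ℕ} (h : G.IsTerm T w) (hG : G.IsMojetic Set.univ)
    (x : V) : ∃ ℓ, G.Reach T x (G.att ℓ) := by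
  rcases h with ⟨hT, -⟩ | ⟨hT, v, hs⟩
  · obtain ⟨ℓ⟩ := hG.nonempty_leg
    exact ⟨ℓ, hT.reach _ _⟩
  · exact hT.exists_att_reach hs x

omit [Fintype E] [Nonempty V] [Finite V] in
theorem exists_edge_of_reach {F : Set E} {x y : V} (h : G.Reach F x y) (hne : x ≠ y) :
    ∃ e ∈ F, x ∈ G.ends e := by
  obtain ⟨e, he, u, rfl, w, -, hends, -⟩ := h.first_exit (S := {x}) rfl fun h => hne h.symm
  exact ⟨e, he, by rw [hends]; exact Sym2.mem_mk_left _ _⟩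

variable {T : Set E} {w : ℕ} {x y z : V}

omit [Finite V] [Nonempty V] [Fintype E] in
/-- If one side of a 2-tree avoids the hard vertices, then it cuts off a single on-shell line. -/
theorem IsSpanningTwoTree.eq_one_of_jet {v z : V} (hT : G.IsSpanningTwoTree T)
    (hR : G.BasicRequirements R) (hs : IsSplit (G.legSide T v) w) (hz : z ∉ G.softVerts R)
    (hhard : ∀ h ∈ G.hardVerts R, ¬ G.Reach T z h)
    (hleg : ∀ ℓ, G.Reach T z (G.att ℓ) → G.Reach (T ∩ nonsoftEdges R) z (G.att ℓ)) : w = 1 := by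
  obtain ⟨i, hi⟩ := (hard_or_jet_of_notMem_softVerts hz).resolve_left
    fun h => hhard z h (Reach.refl z)
  exact hT.eq_one_of_subset hs (x := z) (i := i) fun ℓ hℓ => hR.eq_of_att_mem
    (Reach.mem_jetVerts Set.inter_subset_right hi
      (fun h hh hr => hhard h hh (hr.mono Set.inter_subset_left)) (hleg ℓ hℓ))

/-- Soft edges of a component that meets only one jet do not join further nonsoft vertices in a
term of minimal weight. -/
theorem IsTerm.reach_nonsoft_of_reach (h : G.IsTerm T w) (hR : G.BasicRequirements R)
    (hm : treeWeight R T + w = G.minWeight R) (hx : x ∉ G.softVerts R) (hy : y ∉ G.softVerts R)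
    (hxy : G.Reach T x y) (hij : ∀ i j, x ∈ G.jetVerts R i → y ∈ G.jetVerts R j → i = j) :
    G.Reach (T ∩ nonsoftEdges R) x y := by
  have hsub : T ∩ nonsoftEdges R ⊆ T := Set.inter_subset_left
  rcases h with ⟨hT, rfl⟩ | ⟨hT, v, hs⟩
  · exact reach_of_numComp_le Set.inter_subset_right (hT.numComp_of_minWeight hm).2.le
      (hR.reach_nonsoft hx hy)
  by_contra hno
  obtain ⟨ℓ₀, hℓ₀⟩ := exists_att_not_reach hs x
  have hz := hR.att_notMem_softVerts ℓ₀
  set z := G.att ℓ₀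
  have hsum := hT.numComp_of_minWeight hm
  have hH : G.numComp (hardEdges R) ≤ G.numComp (T ∩ hardEdges R) :=
    numComp_anti Set.inter_subset_right
  have hxz : ¬ G.Reach (T ∩ nonsoftEdges R) x z := fun h => hℓ₀ (h.mono hsub)
  have hyz : ¬ G.Reach (T ∩ nonsoftEdges R) y z := fun h => hℓ₀ (hxy.trans (h.mono hsub))
  -- Three separate nonsoft components exhaust the budget: `w = 0`, the hard vertices remain joined,
  -- and by `h4` there is no fourth component among the nonsoft vertices.
  have h3 := hR.length_le [x, y, z] (T := T) (by simp [hno, hxz, hyz]) (by simp [hx, hy, hz])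
  simp only [List.length_cons, List.length_nil] at h3
  obtain rfl : w = 0 := by omega
  have hHr : ∀ h ∈ G.hardVerts R, ∀ h' ∈ G.hardVerts R, G.Reach T h h' := fun h hh h' hh' =>
    (reach_of_numComp_le Set.inter_subset_right (by omega) (hR.reach_hard hh hh')).mono
      Set.inter_subset_left
  have h4 : ∀ a, a ∉ G.softVerts R → G.Reach (T ∩ nonsoftEdges R) x a ∨
      G.Reach (T ∩ nonsoftEdges R) y a ∨ G.Reach (T ∩ nonsoftEdges R) z a := by
    intro a ha
    by_contra hcon
    push Not at hcon
    have := hR.length_le [x, y, z, a] (T := T) (by simp [hno, hxz, hyz, hcon]) (by simp [hx, hy, hz, ha])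
    simp only [List.length_cons, List.length_nil] at this
    omega
  obtain ⟨h, hh⟩ := hR.hardVerts_nonempty
  -- On the side without hard vertices all external lines enter in one jet: either it is the side of
  -- `z`, with one nonsoft component, or that of `x` and `y`, whose two components lie in the same
  -- jet by `hij`. Both give `w = 1`.
  by_cases hhx : G.Reach T x h
  · have := hT.eq_one_of_jet hR hs hz (fun h' hh' hr => hℓ₀ ((hhx.trans (hHr h hh h' hh')).trans hr.symm))
      (fun ℓ hℓ => by
        rcases h4 _ (hR.att_notMem_softVerts ℓ) with h | h | h
        · exact absurd ((h.mono hsub).trans hℓ.symm) hℓ₀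
        · exact absurd (hxy.trans ((h.mono hsub).trans hℓ.symm)) hℓ₀
        · exact h)
    omega
  · have hnx : ∀ h' ∈ G.hardVerts R, ¬ G.Reach T x h' := fun h' hh' hr =>
      hhx (hr.trans (hHr h' hh' h hh))
    obtain ⟨i, hi⟩ := (hard_or_jet_of_notMem_softVerts hx).resolve_left
      fun h => hnx x h (Reach.refl x)
    obtain ⟨j, hj⟩ := (hard_or_jet_of_notMem_softVerts hy).resolve_left
      fun h => hnx y h hxy
    obtain rfl := hij i j hi hj
    have := hT.eq_one_of_subset hs (x := x) (i := i) fun ℓ hℓ => by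
      apply hR.eq_of_att_mem
      rcases h4 _ (hR.att_notMem_softVerts ℓ) with h | h | h
      · exact Reach.mem_jetVerts Set.inter_subset_right hi
          (fun h hh hr => hnx h hh (hr.mono hsub)) h
      · exact Reach.mem_jetVerts Set.inter_subset_right hj
          (fun h hh hr => hnx h hh (hxy.trans (hr.mono hsub))) h
      · exact absurd (hℓ.trans (h.mono hsub).symm) hℓ₀
    omega

/-- In a term of minimal weight a soft component that is attached to only one jet has as many edges
as vertices. -/
theorem IsTerm.ncard_soft (h : G.IsTerm T w) (hG : G.IsMojetic Set.univ)
    (hR : G.BasicRequirements R) (hm : treeWeight R T + w = G.minWeight R)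
    {C : Set (Cell V E K L)} (hC : G.IsComponent (G.softPart R) C)
    (hij : ∀ i j, G.Attached C (G.jetPart R i) → G.Attached C (G.jetPart R j) → i = j) :
    (T ∩ {e | .inr (.inl e) ∈ C}).ncard = {v | .inl v ∈ C}.ncard := by
  have hTf : G.IsForest T := by
    rcases h with ⟨hT, -⟩ | ⟨hT, -⟩
    · exact hT.1
    · exact hT.1
  have hEC : ∀ e, .inr (.inl e) ∈ C → R e = .soft := fun e he => hC.subset he
  have hVC : ∀ v, .inl v ∈ C → v ∈ G.softVerts R := fun v hv => hC.subset hv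
  have hVE : ∀ v, .inl v ∈ C → ∀ e, v ∈ G.ends e → .inr (.inl e) ∈ C := fun v hv e hve =>
    hC.closed hv (y := .inr (.inl e)) (mode_of_mem_softVerts (e := e) (hVC v hv) hve)
      (incidence_adj_inl.2 ⟨_, rfl, hve⟩)
  have hEV : ∀ e, .inr (.inl e) ∈ C → ∀ v ∈ G.ends e, v ∈ G.softVerts R → .inl v ∈ C :=
    fun e he v hv hvs => hC.closed he (y := .inl v) hvs (incidence_adj_inr.2 ⟨_, rfl, hv⟩)
  -- Every vertex of `C` is joined to exactly one vertex outside: to at least one because `T` leads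
  -- on to an external line, which enters at a nonsoft vertex.
  refine (hTf.subset Set.inter_subset_left).ncard_eq ?_ ?_
  · intro x
    by_cases hx : .inl x ∈ C
    · obtain ⟨ℓ, hℓ⟩ := h.exists_att_reach hG x
      obtain ⟨e, he, u, hu, w, hw, hends, hr⟩ := hℓ.first_exit (S := {v : V | (Sum.inl v : Cell V E K L) ∈ C}) hx
        fun hmem => hR.att_notMem_softVerts ℓ (hVC _ hmem)
      refine ⟨w, hw, (hr.mono ?_).trans (reach_of_edge (e := e) ⟨he, ?_⟩ hends)⟩
      · rintro f ⟨hfT, hf⟩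
        obtain ⟨a, b, hab⟩ := G.exists_ends f
        have ha : a ∈ G.ends f := by rw [hab]; exact Sym2.mem_mk_left _ _
        exact ⟨hfT, hVE a (hf a ha) f ha⟩
      · exact hVE u hu e (by rw [hends]; exact Sym2.mem_mk_left _ _)
    · exact ⟨x, hx, Reach.refl x⟩
  · intro x hx y hy hr
    by_contra hne
    obtain ⟨e, he, hxe⟩ := exists_edge_of_reach hr hne
    obtain ⟨f, hf, hyf⟩ := exists_edge_of_reach hr.symm (Ne.symm hne)
    have hxs : x ∉ G.softVerts R := fun h => hx (hEV e he.2 x hxe h)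
    have hys : y ∉ G.softVerts R := fun h => hy (hEV f hf.2 y hyf h)
    -- Two outside vertices would be joined twice in the forest, through `C` and through nonsoft
    -- edges.
    refine hne (hTf.eq_of_reach_of_disjoint (Set.inter_subset_left)
      (Set.inter_subset_left (t := nonsoftEdges R)) ?_ hr ?_)
    · rw [Set.disjoint_left]
      rintro e ⟨-, he⟩ ⟨-, he'⟩
      exact he' (hEC e he)
    · refine h.reach_nonsoft_of_reach hR hm hxs hys (hr.mono Set.inter_subset_left)
        fun i j hi hj => hij i j ?_ ?_
      · exact ⟨_, he.2, .inl x, hi, incidence_adj_inr.2 ⟨_, rfl, hxe⟩⟩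
      · exact ⟨_, hf.2, .inl y, hj, incidence_adj_inr.2 ⟨_, rfl, hyf⟩⟩

/-- In a region every soft component is attached to two jets. -/
theorem exists_attached_of_forall (hG : G.IsMojetic Set.univ) (hR : G.BasicRequirements R)
    (H : ∀ α : E → ℝ, (∃ κ, ∀ T w, G.IsTerm T w → treeWeight R T + w = G.minWeight R →
      ∑ e, T.indicator α e = κ) → α = 0)
    {C : Set (Cell V E K L)} (hC : G.IsComponent (G.softPart R) C) :
    ∃ i j : Fin K, i ≠ j ∧ G.Attached C (G.jetPart R i) ∧ G.Attached C (G.jetPart R j) := by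
  by_contra hcon
  have h0 := H ({e | .inr (.inl e) ∈ C}.indicator fun _ => 1) ⟨_, fun T w hT hm => by
    rw [sum_indicator_indicator_one, hT.ncard_soft hG hR hm hC fun i j hi hj => by
      by_contra hne
      exact hcon ⟨i, j, hne, hi, hj⟩]⟩
  have hno : ∀ e, .inr (.inl e) ∉ C := fun e he => by
    have := congrFun h0 e
    rw [Set.indicator_of_mem (Set.mem_ofPred_eq ▸ he)] at this
    exact one_ne_zero this
  -- The indicator is nonzero because `C` contains an edge: even a soft vertex meets one, as the
  -- graph is connected and has hard vertices.
  obtain ⟨c, hc⟩ := hC.nonempty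
  rcases c with v | e | i | j
  · obtain ⟨h, hh⟩ := hR.hardVerts_nonempty
    have hv : v ∈ G.softVerts R := hC.subset hc
    obtain ⟨e, -, hve⟩ := exists_edge_of_reach (hG.reach_univ v h)
      fun hvh => notMem_softVerts_of_hard hh (hvh ▸ hv)
    exact hno e (hC.closed hc (y := .inr (.inl e)) (mode_of_mem_softVerts (e := e) hv hve)
      (incidence_adj_inl.2 ⟨_, rfl, hve⟩))
  · exact hno e hc
  · cases (show Mode.jet i = .soft from hC.subset hc)
  · cases (show Mode.hard = .soft from hC.subset hc)

end Constancy

end FeynmanGraph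

/-! ### Necessity: cut vertices of H ∪ J \ J_i -/

namespace FeynmanGraph

variable {V E : Type*} {K L : ℕ} {G : FeynmanGraph V E K L} {R : E → Mode K} {i : Fin K}

variable (G R) in
/-- The subgraph `H ∪ J \ J_i`. -/
def withoutJet (i : Fin K) : Set (Cell V E K L) :=
  G.hardPart R ∪ ⋃ (j : Fin K) (_ : j ≠ i), G.jetPart R j

theorem mem_withoutJet {c : Cell V E K L} :
    c ∈ G.withoutJet R i ↔ c ∈ G.hardPart R ∨ ∃ j, j ≠ i ∧ c ∈ G.jetPart R j := by
  simp [withoutJet]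

theorem hardPart_subset_withoutJet : G.hardPart R ⊆ G.withoutJet R i := Set.subset_union_left

theorem jetPart_subset_withoutJet {j : Fin K} (h : j ≠ i) : G.jetPart R j ⊆ G.withoutJet R i :=
  fun _ hc => mem_withoutJet.2 (Or.inr ⟨j, h, hc⟩)

theorem leg_mem_withoutJet {ℓ : Leg K L} (h : ℓ ≠ .inl i) : .inr (.inr ℓ) ∈ G.withoutJet R i := by
  rcases ℓ with j | j
  · exact jetPart_subset_withoutJet (j := j) (fun hj => h (hj ▸ rfl)) rfl
  · exact hardPart_subset_withoutJet rfl

theorem edge_mem_withoutJet {e : E} :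
    .inr (.inl e) ∈ G.withoutJet R i ↔ R e = .hard ∨ ∃ j, j ≠ i ∧ R e = .jet j := mem_withoutJet

theorem edge_nonsoft_of_mem_withoutJet {e : E} (h : .inr (.inl e) ∈ G.withoutJet R i) :
    e ∈ nonsoftEdges R := by
  rcases edge_mem_withoutJet.1 h with h | ⟨j, -, h⟩
  · exact mem_nonsoftEdges_iff.2 (Or.inl h)
  · exact mem_nonsoftEdges_iff.2 (Or.inr ⟨j, h⟩)

theorem vertex_mem_of_edge_mem_withoutJet {e : E} {v : V} (h : .inr (.inl e) ∈ G.withoutJet R i)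
    (hv : v ∈ G.ends e) : .inl v ∈ G.withoutJet R i := by
  rcases edge_mem_withoutJet.1 h with h | ⟨j, hj, h⟩
  · exact hardPart_subset_withoutJet (mem_hardVerts_of_hard h hv)
  · rcases hard_or_jet_of_jet h hv with h | h
    · exact hardPart_subset_withoutJet h
    · exact jetPart_subset_withoutJet hj h

theorem BasicRequirements.preconnected_withoutJet (hR : G.BasicRequirements R) (i : Fin K) :
    (G.incidence.induce (G.withoutJet R i)).Preconnected := by
  refine SimpleGraph.induce_preconnected_of_closed fun D hD hne hcl => ?_
  have hH : (G.hardPart R ∩ D).Nonempty → G.hardPart R ⊆ D :=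
    SimpleGraph.subset_of_induce_preconnected hR.hard_connected.preconnected
      hardPart_subset_withoutJet hcl
  have hJ : ∀ j, j ≠ i → (G.jetPart R j ∩ D).Nonempty → G.jetPart R j ⊆ D := fun j hj =>
    SimpleGraph.subset_of_induce_preconnected (hR.jet_connected j).preconnected
      (jetPart_subset_withoutJet hj) hcl
  have hHD : G.hardPart R ⊆ D := by
    obtain ⟨c, hc⟩ := hne
    rcases mem_withoutJet.1 (hD hc) with h | ⟨j, hj, h⟩
    · exact hH ⟨c, h, hc⟩
    · obtain ⟨x, hx, y, hy, hxy⟩ := hR.jet_attached j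
      exact hH ⟨y, hy, hcl x (hJ j hj ⟨c, h, hc⟩ hx) y (hardPart_subset_withoutJet hy) hxy⟩
  intro c hc
  rcases mem_withoutJet.1 hc with h | ⟨j, hj, h⟩
  · exact hHD h
  · obtain ⟨x, hx, y, hy, hxy⟩ := hR.jet_attached j
    exact hJ j hj ⟨x, hx, hcl y (hHD hy) x (jetPart_subset_withoutJet hj hx) hxy.symm⟩ h

section Cut

variable [Finite V] [Nonempty V] [Fintype E] {T : Set E} {w : ℕ} {D : Set (Cell V E K L)} {v : V}

omit [Finite V] [Nonempty V] [Fintype E] in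
theorem IsTerm.isForest {T : Set E} {w : ℕ} (h : G.IsTerm T w) : G.IsForest T := by
  rcases h with ⟨hT, -⟩ | ⟨hT, -⟩
  · exact hT.1
  · exact hT.1

/-- The nonsoft part of a term of minimal weight joins every vertex of a jet to a hard vertex or to
an external line. -/
theorem IsTerm.exists_reach_hard_or_att (h : G.IsTerm T w) (hR : G.BasicRequirements R)
    (hm : treeWeight R T + w = G.minWeight R) {x : V} (hx : x ∉ G.softVerts R) :
    ∃ y, G.Reach (T ∩ nonsoftEdges R) x y ∧ (y ∈ G.hardVerts R ∨ ∃ ℓ, y = G.att ℓ) := by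
  by_contra hcon
  push Not at hcon
  have hsub : T ∩ nonsoftEdges R ⊆ T := Set.inter_subset_left
  have hxh : ∀ h ∈ G.hardVerts R, ¬ G.Reach (T ∩ nonsoftEdges R) x h := fun h hh hr =>
    (hcon h hr).1 hh
  have hxℓ : ∀ ℓ, ¬ G.Reach (T ∩ nonsoftEdges R) x (G.att ℓ) := fun ℓ hr =>
    (hcon _ hr).2 ℓ rfl
  obtain ⟨h₀, hh₀⟩ := hR.hardVerts_nonempty
  rcases h with ⟨hT, rfl⟩ | ⟨hT, v, hs⟩
  · exact hxh h₀ hh₀ (reach_of_numComp_le Set.inter_subset_right (hT.numComp_of_minWeight hm).2.le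
      (hR.reach_nonsoft hx (notMem_softVerts_of_hard hh₀)))
  have hsum := hT.numComp_of_minWeight hm
  have hH : G.numComp (hardEdges R) ≤ G.numComp (T ∩ hardEdges R) :=
    numComp_anti Set.inter_subset_right
  -- The component of `x`, together with one for a line on each side, exhausts the budget. If the
  -- hard vertices are on the side of `ℓ₁`, then that of `ℓ₂` has a single component for its lines,
  -- inside one jet, and `w = 1` exceeds the budget.
  have key : ∀ ℓ₁ ℓ₂, ¬ G.Reach T (G.att ℓ₁) (G.att ℓ₂) → ¬ G.Reach T (G.att ℓ₁) h₀ := by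
    intro ℓ₁ ℓ₂ h12 h1
    have hz₁ := hR.att_notMem_softVerts ℓ₁
    have hz₂ := hR.att_notMem_softVerts ℓ₂
    have h12' : ¬ G.Reach (T ∩ nonsoftEdges R) (G.att ℓ₁) (G.att ℓ₂) := fun h => h12 (h.mono hsub)
    have h3 := hR.length_le [x, G.att ℓ₁, G.att ℓ₂] (T := T) (by simp [hxℓ, h12'])
      (by simp [hx, hz₁, hz₂])
    simp only [List.length_cons, List.length_nil] at h3
    have hHr : ∀ h ∈ G.hardVerts R, G.Reach T h₀ h := fun h hh =>
      (reach_of_numComp_le Set.inter_subset_right (by omega) (hR.reach_hard hh₀ hh)).mono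
        Set.inter_subset_left
    have := hT.eq_one_of_jet hR hs hz₂ (fun h hh hr => h12 ((h1.trans (hHr h hh)).trans hr.symm))
      (fun ℓ hℓ => by
        by_contra hr
        have h1ℓ : ¬ G.Reach (T ∩ nonsoftEdges R) (G.att ℓ₁) (G.att ℓ) := fun h =>
          h12 ((h.mono hsub).trans hℓ.symm)
        have := hR.length_le [x, G.att ℓ₁, G.att ℓ₂, G.att ℓ] (T := T) (by simp [hxℓ, h12', hr, h1ℓ])
          (by simp [hx, hz₁, hz₂, hR.att_notMem_softVerts])
        simp only [List.length_cons, List.length_nil] at this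
        omega)
    omega
  obtain ⟨ℓ₁, hℓ₁⟩ := hT.exists_att_reach hs h₀
  obtain ⟨ℓ₂, hℓ₂⟩ := exists_att_not_reach hs h₀
  exact key ℓ₁ ℓ₂ (fun h => hℓ₂ (hℓ₁.trans h)) hℓ₁.symm

/-- In a term of minimal weight, the part behind a cut vertex in `H ∪ J \ J_i` has as many edges as
vertices. -/
theorem IsTerm.ncard_cut (h : G.IsTerm T w) (hR : G.BasicRequirements R)
    (hm : treeWeight R T + w = G.minWeight R) (hD : D ⊆ G.withoutJet R i)
    (hleg : ∀ ℓ, .inr (.inr ℓ) ∉ D) (hvD : .inl v ∉ D)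
    (hcl : ∀ x ∈ D, ∀ y ∈ G.withoutJet R i, y ≠ .inl v → G.incidence.Adj x y → y ∈ D)
    (hcases : (v ∈ G.hardVerts R ∧ D ⊆ G.hardPart R) ∨
      ∃ j, j ≠ i ∧ v ∈ G.jetVerts R j ∧ D ⊆ G.jetPart R j) :
    (T ∩ {e | .inr (.inl e) ∈ D}).ncard = {v | .inl v ∈ D}.ncard := by
  have hVE : ∀ u, .inl u ∈ D → ∀ e, .inr (.inl e) ∈ G.withoutJet R i → u ∈ G.ends e →
      .inr (.inl e) ∈ D := fun u hu e he hue =>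
    hcl _ hu (.inr (.inl e)) he (by simp) (incidence_adj_inl.2 ⟨_, rfl, hue⟩)
  have hEV : ∀ e, .inr (.inl e) ∈ D → ∀ u ∈ G.ends e, .inl u ∉ D → u = v := by
    intro e he u hu huD
    by_contra hne
    exact huD (hcl _ he (.inl u) (vertex_mem_of_edge_mem_withoutJet (hD he) hu)
      (fun h => hne (Sum.inl.inj h)) (incidence_adj_inr.2 ⟨_, rfl, hu⟩))
  have hatt : ∀ ℓ, ℓ ≠ .inl i → .inl (G.att ℓ) ∉ D := fun ℓ hℓ hmem =>
    hleg ℓ (hcl _ hmem (.inr (.inr ℓ)) (leg_mem_withoutJet hℓ) (by simp)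
      (incidence_adj_inl.2 ⟨_, rfl, rfl⟩))
  have hsubN : T ∩ nonsoftEdges R ⊆ T := Set.inter_subset_left
  have hsubH : T ∩ hardEdges R ⊆ T := Set.inter_subset_left
  set F := T ∩ {e | .inr (.inl e) ∈ D} with hF
  -- By `hEV` the only vertex outside `D` that edges of `D` can meet is `v`, so it suffices to join
  -- every vertex of `D` to `v`.
  have hmain : ∀ x, .inl x ∈ D → G.Reach F x v := by
    intro x hx
    rcases hcases with ⟨hvH, hDH⟩ | ⟨j, hji, hvj, hDj⟩
    · have hxH : x ∈ G.hardVerts R := hDH hx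
      by_contra hxv
      have hclass : ∀ y, G.Reach (T ∩ hardEdges R) x y → .inl y ∈ D := by
        intro y hr
        refine (hr.induction (fun y => .inl y ∈ D ∧ G.Reach F x y) ⟨hx, Reach.refl x⟩ ?_).1
        rintro e ⟨heT, he⟩ a b hab - ⟨ha, hra⟩
        have heD := hVE a ha e (edge_mem_withoutJet.2 (Or.inl he))
          (by rw [hab]; exact Sym2.mem_mk_left _ _)
        have hrb := hra.trans (reach_of_edge (F := F) ⟨heT, heD⟩ hab)
        refine ⟨?_, hrb⟩
        by_contra hb
        have := hEV e heD b (by rw [hab]; exact Sym2.mem_mk_right _ _) hb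
        exact hxv (this ▸ hrb)
      have hxvH : ¬ G.Reach (T ∩ hardEdges R) x v := fun hr => hvD (hclass v hr)
      have hcard := numComp_add_length_le (G := G) (F := T ∩ hardEdges R) Set.inter_subset_right v
        [x, v] (by simp [hxvH]) (by simp [hR.reach_hard hxH hvH, Reach.refl])
      simp only [List.length_cons, List.length_nil] at hcard
      rcases h with ⟨hT, rfl⟩ | ⟨hT, u, hs⟩
      · have := (hT.numComp_of_minWeight hm).1
        omega
      -- The separation of `x` from `v` costs one hard component, and the 2-tree costs one nonsoft
      -- component. So `w = 0`, and `hH2`, `hN2` say that nothing else is separated.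
      have hsum := hT.numComp_of_minWeight hm
      have hb := hT.numComp_nonsoft_lt hR hs
      have hH2 : ∀ h ∈ G.hardVerts R, G.Reach (T ∩ hardEdges R) x h ∨
          G.Reach (T ∩ hardEdges R) v h := by
        intro h hh
        by_contra hcon
        push Not at hcon
        have := numComp_add_length_le (G := G) (F := T ∩ hardEdges R) Set.inter_subset_right v
          [x, v, h] (by simp [hxvH, hcon])
          (by simp [hR.reach_hard hxH hvH, Reach.refl, hR.reach_hard hh hvH])
        simp only [List.length_cons, List.length_nil] at this
        omega
      have hN2 : ∀ a b, a ∉ G.softVerts R → b ∉ G.softVerts R → ¬ G.Reach T x a →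
          G.Reach (T ∩ nonsoftEdges R) x b ∨ G.Reach (T ∩ nonsoftEdges R) a b := by
        intro a b ha hb hxa
        by_contra hcon
        push Not at hcon
        have hxa' : ¬ G.Reach (T ∩ nonsoftEdges R) x a := fun h => hxa (h.mono hsubN)
        have := hR.length_le [x, a, b] (T := T) (by simp [hxa', hcon])
          (by simp [ha, hb, notMem_softVerts_of_hard hxH])
        simp only [List.length_cons, List.length_nil] at this
        omega
      -- If `x` and `v` are on the same side, so are all hard vertices, and the other side cuts off
      -- the line of a single jet.
      by_cases hTxv : G.Reach T x v
      · obtain ⟨ℓ, hℓ⟩ := exists_att_not_reach hs x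
        have hHx : ∀ h ∈ G.hardVerts R, G.Reach T x h := fun h hh =>
          (hH2 h hh).elim (fun h => h.mono hsubH) fun h => hTxv.trans (h.mono hsubH)
        have := hT.eq_one_of_jet hR hs (hR.att_notMem_softVerts ℓ)
          (fun h hh hr => hℓ ((hHx h hh).trans hr.symm)) fun ℓ' hℓ' =>
            (hN2 _ _ (hR.att_notMem_softVerts ℓ) (hR.att_notMem_softVerts ℓ') hℓ).resolve_left
              fun h => hℓ ((h.mono hsubN).trans hℓ'.symm)
        omega
      · have hHx : ∀ h ∈ G.hardVerts R, G.Reach T x h → .inl h ∈ D := fun h hh hr =>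
          hclass h ((hH2 h hh).resolve_right fun h' => hTxv (hr.trans (h'.mono hsubH).symm))
        -- The hard vertices on the side of `x` lie in `D`. A line `ℓ ≠ p_i` cannot enter there, and
        -- if it entered in a jet `k ≠ i`, the path to `x` would use a jet edge ending in `D`,
        -- although `D` is purely hard. So only `p_i`, which is not a line of H ∪ J \ J_i, can be
        -- cut off.
        have := hT.eq_one_of_subset hs (x := x) (i := i) fun ℓ hℓ => by
          by_contra hne
          have hr := (hN2 v _ (notMem_softVerts_of_hard hvH) (hR.att_notMem_softVerts ℓ)
            hTxv).resolve_right fun h => hTxv (hℓ.trans (h.mono hsubN).symm)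
          rcases hard_or_jet_of_notMem_softVerts (hR.att_notMem_softVerts ℓ) with hA | ⟨k, hk⟩
          · exact hatt ℓ hne (hHx _ hA hℓ)
          · have hki : k ≠ i := fun h => hne (h ▸ hR.eq_of_att_mem hk)
            obtain ⟨e, ⟨heT, he⟩, a, ha, b, hb, hab, hra⟩ := hr.symm.first_exit hk
              (notMem_jetVerts_of_hard hxH)
            have hjet := jet_of_nonsoft he ha (by rw [hab]; exact Sym2.mem_mk_left _ _)
            have hbe : b ∈ G.ends e := by rw [hab]; exact Sym2.mem_mk_right _ _
            have hbH := (hard_or_jet_of_jet hjet hbe).resolve_right hb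
            have hxb : G.Reach T x b := (hℓ.trans ((hra.mono inside_subset).mono hsubN)).trans
              (reach_of_edge heT hab)
            have heD := hVE b (hHx b hbH hxb) e (edge_mem_withoutJet.2 (Or.inr ⟨k, hki, hjet⟩)) hbe
            have heh : R e = .hard := hDH heD
            rw [hjet] at heh
            cases heh
        omega
    · have hxj : x ∈ G.jetVerts R j := hDj hx
      -- The path to a hard vertex or an external line has to leave `D`, and it can do so only at
      -- `v`.
      obtain ⟨y, hr, hy⟩ := h.exists_reach_hard_or_att hR hm (notMem_softVerts_of_jet hxj)
      have hyD : .inl y ∉ D := by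
        rcases hy with hy | ⟨ℓ, rfl⟩
        · exact fun h => notMem_jetVerts_of_hard hy (hDj h)
        · intro hmem
          have hℓj := hR.eq_of_att_mem (hDj hmem)
          exact hatt ℓ (fun h => hji (Sum.inl.inj (hℓj.symm.trans h))) hmem
      have hedge : ∀ a, .inl a ∈ D → ∀ e ∈ nonsoftEdges R, a ∈ G.ends e → .inr (.inl e) ∈ D :=
        fun a ha e he hae => hVE a ha e
          (edge_mem_withoutJet.2 (Or.inr ⟨j, hji, jet_of_nonsoft he (hDj ha) hae⟩)) hae
      obtain ⟨e, ⟨heT, he⟩, a, ha, b, hb, hab, hra⟩ :=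
        hr.first_exit (S := {v : V | (Sum.inl v : Cell V E K L) ∈ D}) hx hyD
      have heD := hedge a ha e he (by rw [hab]; exact Sym2.mem_mk_left _ _)
      have hbv := hEV e heD b (by rw [hab]; exact Sym2.mem_mk_right _ _) hb
      rw [← hbv]
      refine (hra.mono ?_).trans (reach_of_edge (F := F) ⟨heT, heD⟩ hab)
      rintro f ⟨⟨hfT, hfn⟩, hf⟩
      obtain ⟨p, q, hpq⟩ := G.exists_ends f
      have hp : p ∈ G.ends f := by rw [hpq]; exact Sym2.mem_mk_left _ _
      exact ⟨hfT, hedge p (hf p hp) f hfn hp⟩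
  refine (h.isForest.subset Set.inter_subset_left).ncard_eq ?_ ?_
  · intro x
    by_cases hx : .inl x ∈ D
    · exact ⟨v, hvD, hmain x hx⟩
    · exact ⟨x, hx, Reach.refl x⟩
  · intro x hx y hy hr
    by_contra hne
    obtain ⟨e, he, hxe⟩ := exists_edge_of_reach hr hne
    obtain ⟨f, hf, hyf⟩ := exists_edge_of_reach hr.symm (Ne.symm hne)
    exact hne ((hEV e he.2 x hxe hx).trans (hEV f hf.2 y hyf hy).symm)

/-- In a region all the subgraphs `H ∪ J \ J_i` are mojetic. -/
theorem isMojetic_withoutJet_of_forall (hR : G.BasicRequirements R)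
    (hn : 3 ≤ K + L ∧ (L = 0 → 4 ≤ K))
    (H : ∀ α : E → ℝ, (∃ κ, ∀ T w, G.IsTerm T w → treeWeight R T + w = G.minWeight R →
      ∑ e, T.indicator α e = κ) → α = 0) (i : Fin K) : G.IsMojetic (G.withoutJet R i) := by
  by_contra hnot
  -- A further external line, needed when `v` lies in J_j, to show that H is not cut off by `v`.
  have hthird : ∀ j : Fin K, 0 < L ∨ ∃ k : Fin K, k ≠ i ∧ k ≠ j := by
    intro j
    by_cases hL : 0 < L
    · exact Or.inl hL
    · right
      have hK : 4 ≤ K := hn.2 (by omega)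
      by_contra hcon
      push Not at hcon
      have hsub : (Finset.univ : Finset (Fin K)) ⊆ {i, j} := fun k _ => by
        by_cases hk : k = i
        · simp [hk]
        · simp [hcon k hk]
      have := Finset.card_le_card hsub
      have h2 := Finset.card_le_two (a := i) (b := j)
      simp at this
      omega
  obtain ⟨ℓ, hℓ⟩ : ∃ ℓ : Leg K L, ℓ ≠ .inl i := by
    rcases hthird i with h | ⟨k, hk, -⟩
    · exact ⟨.inr ⟨0, h⟩, by simp⟩
    · exact ⟨.inl k, fun h => hk (Sum.inl.inj h)⟩
  have hpre := hR.preconnected_withoutJet i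
  obtain ⟨v, hv, D, hD, hne, hvD, hleg, hcl⟩ :=
    exists_closed_of_not_isMojetic hpre (leg_mem_withoutJet hℓ) hnot
  have habs : ∀ s ⊆ G.withoutJet R i, (G.incidence.induce s).Preconnected → .inl v ∉ s →
      (s ∩ D).Nonempty → s ⊆ D := by
    intro s hs hpre hvs hmeet
    refine SimpleGraph.subset_of_induce_preconnected (s := s) hpre subset_rfl ?_ hmeet
    intro x hx y hy hadj
    exact hcl x hx y (hs hy) (fun h => hvs (h ▸ hy)) hadj
  have hJno : ∀ k, k ≠ i → v ∉ G.jetVerts R k → ¬ (G.jetPart R k ∩ D).Nonempty := by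
    intro k hk hvk hmeet
    exact hleg (.inl k) (habs _ (jetPart_subset_withoutJet hk) (hR.jet_connected k).preconnected hvk
      hmeet rfl)
  -- `D` lies in the one of H and the jets that contains `v`. Any other one that it meets would be
  -- absorbed as a whole, bringing along an external line: its own, or for H that of a jet attached
  -- to it.
  have hcases : (v ∈ G.hardVerts R ∧ D ⊆ G.hardPart R) ∨
      ∃ j, j ≠ i ∧ v ∈ G.jetVerts R j ∧ D ⊆ G.jetPart R j := by
    rcases mem_withoutJet.1 hv with hvH | ⟨j, hji, hvj⟩
    · refine Or.inl ⟨hvH, fun c hc => ?_⟩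
      rcases mem_withoutJet.1 (hD hc) with h | ⟨k, hk, h⟩
      · exact h
      · exact absurd ⟨c, h, hc⟩ (hJno k hk (notMem_jetVerts_of_hard hvH))
    · refine Or.inr ⟨j, hji, hvj, fun c hc => ?_⟩
      rcases mem_withoutJet.1 (hD hc) with h | ⟨k, hk, h⟩
      · exfalso
        have hHD := habs _ hardPart_subset_withoutJet hR.hard_connected.preconnected
          (fun hvH => notMem_jetVerts_of_hard (v := v) hvH hvj) ⟨c, h, hc⟩
        rcases hthird j with hL | ⟨k, hki, hkj⟩
        · exact hleg (.inr ⟨0, hL⟩) (hHD rfl)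
        · obtain ⟨x, hx, y, hy, hxy⟩ := hR.jet_attached k
          have hvk : v ∉ G.jetVerts R k := fun h => hkj (eq_of_mem_jetVerts h hvj)
          exact hJno k hki hvk ⟨x, hx, hcl y (hHD hy) x (jetPart_subset_withoutJet hki hx)
            (fun h => hvk (by rw [h] at hx; exact hx)) hxy.symm⟩
      · by_cases hkj : k = j
        · exact hkj ▸ h
        · exact absurd ⟨c, h, hc⟩ (hJno k hk fun h => hkj (eq_of_mem_jetVerts h hvj))
  have h0 := H ({e | .inr (.inl e) ∈ D}.indicator fun _ => 1) ⟨_, fun T w hT hm => by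
    rw [sum_indicator_indicator_one, hT.ncard_cut hR hm hD hleg hvD hcl hcases]⟩
  have hno : ∀ e, .inr (.inl e) ∉ D := fun e he => by
    have := congrFun h0 e
    rw [Set.indicator_of_mem (Set.mem_ofPred_eq ▸ he)] at this
    exact one_ne_zero this
  obtain ⟨c, hc⟩ := hne
  rcases c with x | e | ℓ'
  · have hxv : (Sum.inl v : Cell V E K L) ≠ .inl x := fun h => hvD (h ▸ hc)
    have := (hpre ⟨_, hD hc⟩ ⟨_, hv⟩).induce_induction
      (fun c => c = .inl x ∨ ∃ y ∈ G.withoutJet R i, G.incidence.Adj (.inl x) y) (Or.inl rfl) (by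
        rintro a ha b hb hab (rfl | h)
        · exact Or.inr ⟨b, hb, hab⟩
        · exact Or.inr h)
    obtain ⟨y, hy, hadj⟩ := this.resolve_left hxv
    obtain ⟨l, rfl, -⟩ := incidence_adj_inl.1 hadj
    have hlD := hcl _ hc _ hy (by simp) hadj
    rcases l with e | ℓ'
    · exact hno e hlD
    · exact hleg ℓ' hlD
  · exact hno e hc
  · exact hleg ℓ' hc

end Cut

end FeynmanGraph

/-! ### Bonds and their growth to a single exit -/

namespace FeynmanGraph

variable {V E : Type*} {K L : ℕ} {G : FeynmanGraph V E K L}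
  {X : Set E} {A B S U Z : Set V} {e : E} {u v x y z : V}

variable (G) in
/-- The vertices of `A` are connected by edges of `X` inside `A`. -/
def ConnOn (X : Set E) (A : Set V) : Prop := ∀ x ∈ A, ∀ y ∈ A, G.Reach (G.inside X A) x y

variable (G) in
/-- The edges that leave `A`. -/
def cut (A : Set V) : Set E := {e | ∃ a ∈ A, ∃ b ∉ A, G.ends e = s(a, b)}

theorem inside_mono (h : A ⊆ B) : G.inside X A ⊆ G.inside X B :=
  fun _ he => ⟨he.1, fun v hv => h (he.2 v hv)⟩

theorem ConnOn.exists_exit (h : G.ConnOn X S) (hAS : A ⊆ S) (hx : x ∈ A) (hyS : y ∈ S)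
    (hyA : y ∉ A) : ∃ e ∈ X, ∃ a ∈ A, ∃ b ∈ S \ A, G.ends e = s(a, b) := by
  obtain ⟨e, he, a, ha, b, hb, hab, -⟩ := (h x (hAS hx) y hyS).first_exit hx hyA
  exact ⟨e, he.1, a, ha, b, ⟨he.2 b (by rw [hab]; exact Sym2.mem_mk_right _ _), hb⟩, hab⟩

theorem ConnOn.union (hA : G.ConnOn X A) (hB : G.ConnOn X B) (he : e ∈ X) (hx : x ∈ A) (hy : y ∈ B)
    (h : G.ends e = s(x, y)) : G.ConnOn X (A ∪ B) := by
  have hxy : G.Reach (G.inside X (A ∪ B)) x y :=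
    reach_of_edge (mem_inside he h (Or.inl hx) (Or.inr hy)) h
  have key : ∀ z ∈ A ∪ B, G.Reach (G.inside X (A ∪ B)) z x := by
    rintro z (hz | hz)
    · exact (hA z hz x hx).mono (inside_mono Set.subset_union_left)
    · exact ((hB z hz y hy).mono (inside_mono Set.subset_union_right)).trans hxy.symm
  exact fun a ha b hb => (key a ha).trans (key b hb).symm

variable (G) in
/-- The component of `x` in the part of `X` that lies in `S`. -/
def compIn (X : Set E) (S : Set V) (x : V) : Set V := {y | y ∈ S ∧ G.Reach (G.inside X S) x y}

theorem mem_compIn (hx : x ∈ S) : x ∈ G.compIn X S x := ⟨hx, Reach.refl x⟩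

theorem compIn_closed (hu : u ∈ G.compIn X S x) (hv : v ∈ S) (he : e ∈ X)
    (h : G.ends e = s(u, v)) : v ∈ G.compIn X S x :=
  ⟨hv, hu.2.trans (reach_of_edge (mem_inside he h hu.1 hv) h)⟩

theorem connOn_compIn (hx : x ∈ S) : G.ConnOn X (G.compIn X S x) := by
  have key : ∀ y ∈ G.compIn X S x, G.Reach (G.inside X (G.compIn X S x)) x y := by
    rintro y ⟨hy, hr⟩
    refine (hr.induction (fun z => z ∈ S ∧ G.Reach (G.inside X (G.compIn X S x)) x z)
      ⟨hx, Reach.refl x⟩ ?_).2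
    rintro e he a b hab hra ⟨ha, hra'⟩
    have hb : b ∈ S := he.2 b (by rw [hab]; exact Sym2.mem_mk_right _ _)
    exact ⟨hb, hra'.trans (reach_of_edge (mem_inside he.1 hab ⟨ha, hra⟩
      ⟨hb, hra.trans (reach_of_edge he hab)⟩) hab)⟩
  exact fun a ha b hb => (key a ha).symm.trans (key b hb)

/-- Removing from a connected set a component of the complement of a connected part leaves a
connected set. -/
theorem ConnOn.diff_compIn (hS : G.ConnOn X S) (hA : G.ConnOn X A) (hAS : A ⊆ S) (hz : z ∈ A) :
    G.ConnOn X (S \ G.compIn X (S \ A) x) := by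
  set D : Set V := G.compIn X (S \ A) x with hD
  have hAD : A ⊆ S \ D := fun a ha => ⟨hAS ha, fun h => h.1.2 ha⟩
  have key : ∀ y ∈ S \ D, G.Reach (G.inside X (S \ D)) y z := by
    rintro y ⟨hyS, hyD⟩
    by_cases hyA : y ∈ A
    · exact (hA y hyA z hz).mono (inside_mono hAD)
    -- Since `S` is connected, some edge leaves this other component of `S \ A`, and it can only end
    -- in `A`.
    set D' : Set V := G.compIn X (S \ A) y
    have hyD' : y ∈ D' := mem_compIn ⟨hyS, hyA⟩
    have hsub : D' ⊆ S \ D := fun w hw => ⟨hw.1.1, fun h => hyD ⟨⟨hyS, hyA⟩, h.2.trans hw.2.symm⟩⟩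
    obtain ⟨e, he, a, ha, b, ⟨hbS, hbD'⟩, hab⟩ := hS.exists_exit (fun w hw => (hsub hw).1) hyD'
      (hAS hz) (fun h => h.1.2 hz)
    have hbA : b ∈ A := by
      by_contra hbA
      exact hbD' (compIn_closed (S := S \ A) ha ⟨hbS, hbA⟩ he hab)
    exact (((connOn_compIn (S := S \ A) ⟨hyS, hyA⟩ y hyD' a ha).mono (inside_mono hsub)).trans
      (reach_of_edge (mem_inside he hab (hsub ha) (hAD hbA)) hab)).trans
      ((hA b hbA z hz).mono (inside_mono hAD))
  exact fun a ha b hb => (key a ha).trans (key b hb).symm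

theorem connOn_singleton (x : V) : G.ConnOn X {x} := by
  rintro _ rfl _ rfl
  exact Reach.refl _

theorem ConnOn.subset_compIn_or (hZ : G.ConnOn X Z) (hZS : Z ⊆ S) :
    Z ⊆ G.compIn X S x ∨ Disjoint Z (G.compIn X S x) := by
  by_cases h : (Z ∩ G.compIn X S x).Nonempty
  · obtain ⟨z, hz, hzD⟩ := h
    exact Or.inl fun y hy => ⟨hZS hy, hzD.2.trans ((hZ z hz y hy).mono (inside_mono hZS))⟩
  · exact Or.inr (Set.disjoint_iff_inter_eq_empty.2 (Set.not_nonempty_iff_eq_empty.1 h))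

/-- Growing a family of connected sets with connected complements in `U` that avoid `Z` leads to a
set whose leaving edges all end in the same vertex or all end in `Z`. -/
theorem exists_single_exit [Finite V] (hZ : G.ConnOn X Z) (hZU : Z ⊆ U) (𝓐 : Set (Set V))
    (h0 : 𝓐.Nonempty)
    (h𝓐 : ∀ A ∈ 𝓐, A ⊆ U ∧ G.ConnOn X A ∧ G.ConnOn X (U \ A) ∧ Disjoint Z A)
    (step : ∀ A ∈ 𝓐, ∀ B₁ B₂ : Set V, B₁.Nonempty → B₂.Nonempty → Disjoint B₁ B₂ →
      B₁ ∪ B₂ = U \ A → G.ConnOn X B₁ → G.ConnOn X B₂ → G.ConnOn X (A ∪ B₁) → G.ConnOn X (A ∪ B₂) →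
      (∃ e ∈ X, ∃ a ∈ A, ∃ b ∈ B₁, G.ends e = s(a, b)) →
      (∃ e ∈ X, ∃ a ∈ A, ∃ b ∈ B₂, G.ends e = s(a, b)) →
      (Z ⊆ B₁ ∨ Z ⊆ B₂) → A ∪ B₁ ∈ 𝓐 ∨ A ∪ B₂ ∈ 𝓐) :
    ∃ A ∈ 𝓐, ∀ e ∈ X, ∀ a ∈ A, ∀ x ∈ U \ A, G.ends e = s(a, x) →
      ∀ e' ∈ X, ∀ a' ∈ A, ∀ x' ∈ U \ A, G.ends e' = s(a', x') → x = x' ∨ (x ∈ Z ∧ x' ∈ Z) := by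
  obtain ⟨A, hA⟩ := (Set.toFinite 𝓐).exists_maximal h0
  refine ⟨A, hA.prop, ?_⟩
  obtain ⟨hAU, hcA, hcB, hZA⟩ := h𝓐 A hA.prop
  have hmax : ∀ B : Set V, B.Nonempty → B ⊆ U \ A → A ∪ B ∉ 𝓐 := by
    rintro B ⟨b, hb⟩ hB hmem
    exact (hB hb).2 (hA.le_of_ge hmem Set.subset_union_left (Or.inr hb))
  have main : ∀ e ∈ X, ∀ a ∈ A, ∀ x ∈ U \ A, G.ends e = s(a, x) →
      ∀ e' ∈ X, ∀ a' ∈ A, ∀ x' ∈ U \ A, G.ends e' = s(a', x') → x' ∉ Z → x = x' := by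
    intro e he a ha x hx hax e' he' a' ha' y hy hay hyZ
    by_contra hne
    have hxy : x ∈ (U \ A) \ {y} := ⟨hx, hne⟩
    -- Two distinct exits split the complement into two connected parts, one containing `x` and the
    -- other `y`, and both adjacent to `A`. As `y ∉ Z`, the connected set `Z` lies in one of them.
    -- Adding the part chosen by `step` contradicts maximality.
    set D := G.compIn X ((U \ A) \ {y}) x with hD
    have hxD : x ∈ D := mem_compIn hxy
    have hDB : D ⊆ U \ A := fun w hw => hw.1.1
    have hyB : y ∈ (U \ A) \ D := ⟨hy, fun h => h.1.2 rfl⟩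
    have hc₁ : G.ConnOn X D := connOn_compIn hxy
    have hc₂ : G.ConnOn X ((U \ A) \ D) :=
      hcB.diff_compIn (connOn_singleton y) (Set.singleton_subset_iff.2 hy) rfl
    have hZy : Z ⊆ (U \ A) \ {y} := fun z hz =>
      ⟨⟨hZU hz, Set.disjoint_left.1 hZA hz⟩, fun h => hyZ (Set.mem_singleton_iff.1 h ▸ hz)⟩
    have hZor : Z ⊆ D ∨ Z ⊆ (U \ A) \ D := by
      rcases hZ.subset_compIn_or (x := x) hZy with h | h
      · exact Or.inl h
      · exact Or.inr fun z hz => ⟨(hZy hz).1, Set.disjoint_left.1 h hz⟩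
    rcases step A hA.prop D ((U \ A) \ D) ⟨x, hxD⟩ ⟨y, hyB⟩ Set.disjoint_sdiff_right
      (Set.union_sdiff_cancel hDB) hc₁ hc₂ (hcA.union hc₁ he ha hxD hax)
      (hcA.union hc₂ he' ha' hyB hay) ⟨e, he, a, ha, x, hxD, hax⟩ ⟨e', he', a', ha', y, hyB, hay⟩
      hZor with h | h
    · exact hmax _ ⟨x, hxD⟩ hDB h
    · exact hmax _ ⟨y, hyB⟩ Set.sdiff_subset h
  intro e he a ha x hx hax e' he' a' ha' y hy hay
  by_cases hyZ : y ∈ Z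
  · by_cases hxZ : x ∈ Z
    · exact Or.inr ⟨hxZ, hyZ⟩
    · exact Or.inl (main e' he' a' ha' y hy hay e he a ha x hx hax hxZ).symm
  · exact Or.inl (main e he a ha x hx hax e' he' a' ha' y hy hay hyZ)

variable (G) in
/-- `A` and `U \ A` are nonempty and connected, and `Z` lies in the latter. -/
structure IsBond (X : Set E) (U Z A : Set V) : Prop where
  subset : A ⊆ U
  nonempty : A.Nonempty
  diff_nonempty : (U \ A).Nonempty
  conn : G.ConnOn X A
  conn_diff : G.ConnOn X (U \ A)
  disjoint : Disjoint Z A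

/-- The component of `v` in `U \ {u}` and its complement, which contains `u`, are both connected.
The connected set `Z` avoids `u` and so lies in one of them; the other is the bond. -/
theorem exists_isBond (hU : G.ConnOn X U) (hZ : G.ConnOn X Z) (hZU : Z ⊆ U) (hu : u ∈ U)
    (hv : v ∈ U) (huv : u ≠ v) (huZ : u ∉ Z) (h : G.ends e = s(u, v)) :
    ∃ A, G.IsBond X U Z A ∧ e ∈ G.cut A := by
  have hv' : v ∈ U \ {u} := ⟨hv, fun h => huv h.symm⟩
  set D := G.compIn X (U \ {u}) v with hD
  have hvD : v ∈ D := mem_compIn hv'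
  have huD : u ∉ D := fun h => h.1.2 rfl
  have hDU : D ⊆ U := fun w hw => hw.1.1
  have hc₁ : G.ConnOn X D := connOn_compIn hv'
  have hc₂ : G.ConnOn X (U \ D) :=
    hU.diff_compIn (connOn_singleton u) (Set.singleton_subset_iff.2 hu) rfl
  have hZu : Z ⊆ U \ {u} := fun z hz =>
    ⟨hZU hz, fun h => huZ (Set.mem_singleton_iff.1 h ▸ hz)⟩
  have hdd : U \ (U \ D) = D := Set.sdiff_sdiff_cancel_left hDU
  rcases hZ.subset_compIn_or (x := v) hZu with hsub | hdis
  · exact ⟨U \ D, ⟨Set.sdiff_subset, ⟨u, hu, huD⟩, by rw [hdd]; exact ⟨v, hvD⟩, hc₂,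
      by rw [hdd]; exact hc₁, Set.disjoint_left.2 fun z hz h => h.2 (hsub hz)⟩,
      u, ⟨hu, huD⟩, v, fun h => h.2 hvD, h⟩
  · exact ⟨D, ⟨hDU, ⟨v, hvD⟩, ⟨u, hu, huD⟩, hc₁, hc₂, hdis⟩, v, hvD, u, huD,
      h.trans Sym2.eq_swap⟩

/-- The function `α` has the value `c` on all edges of `X` that leave `A`. -/
def ConstOnCut (G : FeynmanGraph V E K L) (X : Set E) (α : E → ℝ) (c : ℝ) (A : Set V) : Prop :=
  ∀ e ∈ X, e ∈ G.cut A → α e = c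

/-- Growing bonds on which `α` is constant, subject to a condition `N`. -/
theorem exists_bond_single_exit [Finite V] {α : E → ℝ} {c : ℝ}
    (hZ : G.ConnOn X Z) (hZU : Z ⊆ U)
    (hconst : ∀ A, G.IsBond X U Z A → ∀ e ∈ X, e ∈ G.cut A → ∀ e' ∈ X, e' ∈ G.cut A → α e = α e')
    (N : Set V → Prop)
    (h0 : ∃ A, G.IsBond X U Z A ∧ G.ConstOnCut X α c A ∧ N A)
    (hN : ∀ A B₁ B₂ : Set V, G.IsBond X U Z A → N A → B₁.Nonempty → B₂.Nonempty → Disjoint B₁ B₂ →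
      B₁ ∪ B₂ = U \ A → (Z ⊆ B₁ ∨ Z ⊆ B₂) →
      (Z ⊆ B₂ → G.IsBond X U Z (A ∪ B₁) ∧ G.ConstOnCut X α c (A ∪ B₁)) →
      (Z ⊆ B₁ → G.IsBond X U Z (A ∪ B₂) ∧ G.ConstOnCut X α c (A ∪ B₂)) →
      (Z ⊆ B₂ ∧ N (A ∪ B₁)) ∨ (Z ⊆ B₁ ∧ N (A ∪ B₂))) :
    ∃ A, G.IsBond X U Z A ∧ G.ConstOnCut X α c A ∧ N A ∧
      ∀ e ∈ X, ∀ a ∈ A, ∀ x ∈ U \ A, G.ends e = s(a, x) →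
      ∀ e' ∈ X, ∀ a' ∈ A, ∀ x' ∈ U \ A, G.ends e' = s(a', x') → x = x' ∨ (x ∈ Z ∧ x' ∈ Z) := by
  have hres := exists_single_exit hZ hZU
    {A | G.IsBond X U Z A ∧ G.ConstOnCut X α c A ∧ N A} h0
    (fun A hA => ⟨hA.1.subset, hA.1.conn, hA.1.conn_diff, hA.1.disjoint⟩) ?_
  · obtain ⟨A, ⟨h1, h2, h3⟩, h4⟩ := hres
    exact ⟨A, h1, h2, h3, h4⟩
  rintro A ⟨hA, hcA, hNA⟩ B₁ B₂ hn₁ hn₂ hdis hun hc₁ hc₂ hc₁' hc₂' hx₁ hx₂ hZor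
  have key : ∀ B₁ B₂ : Set V, B₁.Nonempty → B₂.Nonempty → Disjoint B₁ B₂ → B₁ ∪ B₂ = U \ A →
      G.ConnOn X B₂ → G.ConnOn X (A ∪ B₁) → (∃ e ∈ X, ∃ a ∈ A, ∃ b ∈ B₂, G.ends e = s(a, b)) →
      Z ⊆ B₂ → G.IsBond X U Z (A ∪ B₁) ∧ G.ConstOnCut X α c (A ∪ B₁) := by
    rintro B₁ B₂ hn₁ hn₂ hdis hun hc₂ hc₁' ⟨e, he, a, ha, b, hb, hab⟩ hZ₂
    have hU1 : B₁ ⊆ U \ A := hun ▸ Set.subset_union_left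
    have hU2 : B₂ ⊆ U \ A := hun ▸ Set.subset_union_right
    have hcompl : U \ (A ∪ B₁) = B₂ := by
      rw [← Set.sdiff_sdiff, ← hun, Set.union_sdiff_left]
      exact hdis.symm.sdiff_eq_left
    have hbond : G.IsBond X U Z (A ∪ B₁) := by
      refine ⟨Set.union_subset hA.subset fun w hw => (hU1 hw).1, ⟨a, Or.inl ha⟩, ?_, hc₁', ?_, ?_⟩
      · rw [hcompl]; exact hn₂
      · rw [hcompl]; exact hc₂
      · rw [Set.disjoint_union_right]
        exact ⟨hA.disjoint, hdis.symm.mono_left hZ₂⟩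
    have hbA : b ∉ A := (hU2 hb).2
    -- This edge leaves both the old and the enlarged set, and carries the value `c` over to the new
    -- cut.
    have hecut : e ∈ G.cut (A ∪ B₁) :=
      ⟨a, Or.inl ha, b, fun h => h.elim hbA fun h => Set.disjoint_left.1 hdis h hb, hab⟩
    exact ⟨hbond, fun e' he' hcut => (hconst _ hbond e' he' hcut e he hecut).trans
      (hcA e he ⟨a, ha, b, hbA, hab⟩)⟩
  have k₁ := key B₁ B₂ hn₁ hn₂ hdis hun hc₂ hc₁' hx₂
  have k₂ := key B₂ B₁ hn₂ hn₁ hdis.symm (by rw [Set.union_comm]; exact hun) hc₁ hc₂' hx₁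
  rcases hN A B₁ B₂ hA hNA hn₁ hn₂ hdis hun hZor k₁ k₂ with ⟨h, h'⟩ | ⟨h, h'⟩
  · exact Or.inl ⟨(k₁ h).1, (k₁ h).2, h'⟩
  · exact Or.inr ⟨(k₂ h).1, (k₂ h).2, h'⟩

/-- A forest that joins the two sides of a bond separately, and becomes a spanning tree of the
level by adding any leaving edge. -/
theorem IsBond.exists_forest [Finite E] (hA : G.IsBond X U Z A) (hX : ∀ e ∈ X, ∀ v ∈ G.ends e, v ∈ U)
    {F₁ : Set E} (hF₁ : G.IsForest F₁) (hF₁X : F₁ ⊆ X \ G.cut A) (he : e ∈ X) (hecut : e ∈ G.cut A) :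
    ∃ F, F₁ ⊆ F ∧ F ⊆ X \ G.cut A ∧ G.IsForest (insert e F) ∧
      (∀ x ∈ A, ∀ y ∈ A, G.Reach F x y) ∧ (∀ x ∈ U \ A, ∀ y ∈ U \ A, G.Reach F x y) ∧
      ∀ x ∈ U, ∀ y ∈ U, G.Reach (insert e F) x y := by
  obtain ⟨F, hF, hF₁F, hFX, hr⟩ := hF₁.exists_extension hF₁X
  obtain ⟨a, ha, b, hb, hab⟩ := hecut
  have hbU : b ∈ U := hX e he b (by rw [hab]; exact Sym2.mem_mk_right _ _)
  have hins : ∀ S : Set V, (S ⊆ A ∨ Disjoint S A) → G.inside X S ⊆ X \ G.cut A := by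
    rintro S hS f ⟨hfX, hf⟩
    refine ⟨hfX, ?_⟩
    rintro ⟨p, hp, q, hq, hpq⟩
    have hpS := hf p (by rw [hpq]; exact Sym2.mem_mk_left _ _)
    have hqS := hf q (by rw [hpq]; exact Sym2.mem_mk_right _ _)
    rcases hS with hS | hS
    · exact hq (hS hqS)
    · exact Set.disjoint_left.1 hS hpS hp
  have h1 : ∀ x ∈ A, ∀ y ∈ A, G.Reach F x y := fun x hx y hy =>
    hr x y ((hA.conn x hx y hy).mono (hins A (Or.inl subset_rfl)))
  have h2 : ∀ x ∈ U \ A, ∀ y ∈ U \ A, G.Reach F x y := fun x hx y hy =>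
    hr x y ((hA.conn_diff x hx y hy).mono (hins _ (Or.inr Set.disjoint_sdiff_left)))
  have hno : ¬ G.Reach F a b := by
    intro h
    obtain ⟨f, hf, p, hp, q, hq, hpq, -⟩ := h.first_exit ha hb
    exact (hFX hf).2 ⟨p, hp, q, hq, hpq⟩
  have hm := Set.subset_insert e F
  have hedge : G.Reach (insert e F) a b := reach_of_edge (Set.mem_insert e F) hab
  have key : ∀ x ∈ U, G.Reach (insert e F) x a := by
    intro x hx
    by_cases hxA : x ∈ A
    · exact (h1 x hxA a ha).mono hm
    · exact ((h2 x ⟨hx, hxA⟩ b ⟨hbU, hb⟩).mono hm).trans hedge.symm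
  exact ⟨F, hF₁F, hFX, hF.insert_edge hab hno, h1, h2,
    fun x hx y hy => (key x hx).trans (key y hy).symm⟩

end FeynmanGraph

/-! ### Exchange arguments and minimal trees adapted to bonds -/

namespace FeynmanGraph

variable {V E : Type*} {K L : ℕ} {G : FeynmanGraph V E K L} {R : E → Mode K}

theorem reach_inside_mem {X : Set E} {A : Set V} {x y : V} (hx : x ∈ A)
    (h : G.Reach (G.inside X A) x y) : y ∈ A :=
  h.induction (· ∈ A) hx fun e he u v huv _ _ => he.2 v (by rw [huv]; exact Sym2.mem_mk_right _ _)

theorem exists_third_leg (hn : 3 ≤ K + L ∧ (L = 0 → 4 ≤ K)) (i j m : Fin K) :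
    ∃ ℓ : Leg K L, ℓ ≠ .inl i ∧ ℓ ≠ .inl j ∧ ℓ ≠ .inl m := by
  by_cases hL : 0 < L
  · exact ⟨.inr ⟨0, hL⟩, by simp⟩
  · have hK : 4 ≤ K := hn.2 (by omega)
    by_contra hcon
    push Not at hcon
    have hsub : (Finset.univ : Finset (Fin K)) ⊆ {i, j, m} := fun k _ => by
      have := hcon (.inl k)
      by_cases hi : k = i
      · simp [hi]
      by_cases hj : k = j
      · simp [hj]
      have h3 := this (fun h => hi (Sum.inl.inj h)) (fun h => hj (Sum.inl.inj h))
      simp [Sum.inl.inj h3]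
    have := Finset.card_le_card hsub
    have h2 := Finset.card_le_three (a := i) (b := j) (c := m)
    simp at this
    omega

/-- A line other than `p_i`, `p_j`, `p_m` shows that the complement is not the single `p_m`; three
on-shell lines alone would not do. -/
theorem isSplit_pair (hn : 3 ≤ K + L ∧ (L = 0 → 4 ≤ K)) {i j : Fin K} (hij : i ≠ j) :
    IsSplit ({.inl i, .inl j} : Set (Leg K L)) 0 := by
  refine isSplit_zero_iff.2 ⟨⟨.inl i, Or.inl rfl⟩, ?_, fun m => ⟨fun h => ?_, fun h => ?_⟩⟩
  · obtain ⟨ℓ, h1, h2, -⟩ := exists_third_leg hn i j j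
    exact ⟨ℓ, fun h => h.elim h1 h2⟩
  · have h1 : (.inl i : Leg K L) ∈ ({.inl m} : Set (Leg K L)) := h ▸ Or.inl rfl
    have h2 : (.inl j : Leg K L) ∈ ({.inl m} : Set (Leg K L)) := h ▸ Or.inr rfl
    exact hij (Sum.inl.inj (h1.trans h2.symm))
  · obtain ⟨ℓ, h1, h2, h3⟩ := exists_third_leg hn i j m
    have : ℓ ∈ ({.inl i, .inl j} : Set (Leg K L))ᶜ := fun h => h.elim h1 h2
    rw [h] at this
    exact h3 this

section Exchange

variable [Finite V] [Nonempty V] [Fintype E] {T : Set E} {α : E → ℝ} {κ : ℝ} {e e' : E}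
  {u v u' v' : V}

theorem treeWeight_diff (he : e ∈ T) :
    treeWeight R T = treeWeight R (T \ {e}) + edgeWeight R e := by
  rw [← treeWeight_insert (T := T \ {e}) fun h => h.2 rfl, Set.insert_sdiff_self_of_mem he]

theorem sum_indicator_diff (he : e ∈ T) (α : E → ℝ) :
    ∑ e', T.indicator α e' = ∑ e', (T \ {e}).indicator α e' + α e := by
  rw [← sum_indicator_insert (T := T \ {e}) fun h => h.2 rfl, Set.insert_sdiff_self_of_mem he]

variable (hα : ∀ T w, G.IsTerm T w → treeWeight R T + w = G.minWeight R →
  ∑ e, T.indicator α e = κ)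

include hα

/-- The exchanged tree has the same weight, so it is again a minimal term, and the two sums differ
by `α e - α e'`. -/
theorem IsMinTree.eq_of_exchange (hT : G.IsMinTree R T) (he : e ∈ T)
    (hw : edgeWeight R e = edgeWeight R e') (h : G.ends e = s(u, v)) (h' : G.ends e' = s(u', v'))
    (hu : G.Reach (T \ {e}) u' u) (hv : G.Reach (T \ {e}) v' v) : α e = α e' := by
  obtain ⟨hmem, hT'⟩ := hT.1.exchange he h h' hu hv
  have h1 := hα T 0 (Or.inl ⟨hT.1, rfl⟩) hT.treeWeight_eq
  have hm := hT.treeWeight_eq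
  rw [treeWeight_diff he] at hm
  have h2 := hα _ 0 (Or.inl ⟨hT', rfl⟩) (by rw [treeWeight_insert hmem, ← hw, add_zero, hm])
  rw [sum_indicator_diff he] at h1
  rw [sum_indicator_insert hmem] at h2
  linarith

/-- Deleting `e` loses its weight, which the exponent of the split restores. The 2-tree is again a
minimal term, and the sums differ by `α e`. -/
theorem IsMinTree.eq_zero_of_isSplit (hT : G.IsMinTree R T) (he : e ∈ T) (h : G.ends e = s(u, v))
    {x : V} (hs : IsSplit (G.legSide (T \ {e}) x) (edgeWeight R e)) : α e = 0 := by
  have h1 := hα T 0 (Or.inl ⟨hT.1, rfl⟩) hT.treeWeight_eq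
  have hm := hT.treeWeight_eq
  rw [treeWeight_diff he] at hm
  have h2 := hα _ _ (Or.inr ⟨hT.1.isSpanningTwoTree_diff he h, x, hs⟩) hm
  rw [sum_indicator_diff he] at h1
  linarith

/-- `α` is constant on the edges that leave a bond, if these have the same weight and every one of
them lies in a suitable tree. -/
theorem const_of_trees {X : Set E} {U A : Set V} (hX : ∀ e ∈ X, ∀ v ∈ G.ends e, v ∈ U)
    (hw : ∀ e ∈ X, e ∈ G.cut A → ∀ e' ∈ X, e' ∈ G.cut A → edgeWeight R e = edgeWeight R e')
    (htree : ∀ e ∈ X, e ∈ G.cut A → ∃ T, G.IsMinTree R T ∧ e ∈ T ∧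
      (∀ x ∈ A, ∀ y ∈ A, G.Reach (T \ {e}) x y) ∧
      ∀ x ∈ U \ A, ∀ y ∈ U \ A, G.Reach (T \ {e}) x y) :
    ∀ e ∈ X, e ∈ G.cut A → ∀ e' ∈ X, e' ∈ G.cut A → α e = α e' := by
  intro e he hcut e' he' hcut'
  obtain ⟨T, hT, heT, h1, h2⟩ := htree e he hcut
  have hww := hw e he hcut e' he' hcut'
  obtain ⟨a, ha, b, hb, hab⟩ := hcut
  obtain ⟨a', ha', b', hb', hab'⟩ := hcut'
  have hbU : b ∈ U := hX e he b (by rw [hab]; exact Sym2.mem_mk_right _ _)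
  have hbU' : b' ∈ U := hX e' he' b' (by rw [hab']; exact Sym2.mem_mk_right _ _)
  exact hT.eq_of_exchange hα heT hww hab hab' (h1 a' ha' a ha)
    (h2 b' ⟨hbU', hb'⟩ b ⟨hbU, hb⟩)

end Exchange

section Levels

variable (G R) in
/-- The vertices that are not soft. -/
def nonsoftVerts : Set V := {v | v ∉ G.softVerts R}

theorem hardVerts_subset_nonsoftVerts : G.hardVerts R ⊆ G.nonsoftVerts R :=
  fun _ h => notMem_softVerts_of_hard h

variable (G R) in
/-- The jet edges with both endpoints in their jet. -/
def innerJetEdges : Set E := {e | ∃ i, R e = .jet i ∧ ∀ v ∈ G.ends e, v ∈ G.jetVerts R i}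

theorem innerJetEdges_subset : G.innerJetEdges R ⊆ nonsoftEdges R :=
  fun _ ⟨i, h, _⟩ => mem_nonsoftEdges_iff.2 (Or.inr ⟨i, h⟩)

theorem ends_nonsoft {e : E} (he : e ∈ nonsoftEdges R) : ∀ v ∈ G.ends e, v ∈ G.nonsoftVerts R :=
  fun _ hv => notMem_softVerts_of_nonsoft he hv

theorem BasicRequirements.connOn_hard (hR : G.BasicRequirements R) :
    G.ConnOn (hardEdges R) (G.hardVerts R) := fun _ hx _ hy =>
  (hR.reach_hard hx hy).mono fun _ he => ⟨he, fun _ hv => mem_hardVerts_of_hard he hv⟩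

theorem BasicRequirements.connOn_nonsoft (hR : G.BasicRequirements R) :
    G.ConnOn (nonsoftEdges R) (G.nonsoftVerts R) := fun _ hx _ hy =>
  (hR.reach_nonsoft hx hy).mono fun _ he => ⟨he, ends_nonsoft he⟩

theorem ConnOn.mono {X Y : Set E} {A : Set V} (h : G.ConnOn X A) (hXY : X ⊆ Y) : G.ConnOn Y A :=
  fun x hx y hy => (h x hx y hy).mono fun _ he => ⟨hXY he.1, he.2⟩

theorem mode_of_mem_cut {A : Set V} {e : E} {i : Fin K} (hA : A ⊆ G.jetVerts R i)
    (he : e ∈ nonsoftEdges R) (hcut : e ∈ G.cut A) : R e = .jet i := by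
  obtain ⟨a, ha, b, -, hab⟩ := hcut
  exact jet_of_nonsoft he (hA ha) (by rw [hab]; exact Sym2.mem_mk_left _ _)

theorem IsBond.subset_jetVerts {A : Set V}
    (hA : G.IsBond (nonsoftEdges R) (G.nonsoftVerts R) (G.hardVerts R) A) :
    ∃ i, A ⊆ G.jetVerts R i := by
  obtain ⟨a, ha⟩ := hA.nonempty
  obtain ⟨i, hi⟩ := (hard_or_jet_of_notMem_softVerts (hA.subset ha)).resolve_left
    fun h => Set.disjoint_left.1 hA.disjoint h ha
  refine ⟨i, fun y hy => Reach.mem_jetVerts (F := G.inside (nonsoftEdges R) A) inside_subset hi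
    (fun h hh hr => ?_) (hA.conn a ha y hy)⟩
  exact Set.disjoint_left.1 hA.disjoint hh (reach_inside_mem ha hr)

variable [Finite E]

theorem exists_hardForest : ∃ F, G.IsForest F ∧ F ⊆ hardEdges R ∧
    ∀ x y, G.Reach (hardEdges R) x y → G.Reach F x y := by
  obtain ⟨F, h1, -, h2, h3⟩ := (isForest_empty (G := G)).exists_extension
    (Set.empty_subset (hardEdges R))
  exact ⟨F, h1, h2, h3⟩

/-- The forest is grown in three stages: hard edges, then inner jet edges, then the rest. The middle
stage keeps each jet joined when edges between jets and the hard part are removed later. -/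
theorem BasicRequirements.exists_nonsoftForest (hR : G.BasicRequirements R) : ∃ F₁ F₂, F₁ ⊆ hardEdges R ∧
    (∀ x y, G.Reach (hardEdges R) x y → G.Reach F₁ x y) ∧ F₁ ⊆ F₂ ∧ G.IsForest F₂ ∧
    F₂ ⊆ nonsoftEdges R ∧ (∀ x y, G.Reach (nonsoftEdges R) x y → G.Reach F₂ x y) ∧
    ∀ i, ∀ x ∈ G.jetVerts R i, ∀ y ∈ G.jetVerts R i,
      G.Reach (F₂ ∩ (hardEdges R ∪ G.innerJetEdges R)) x y := by
  obtain ⟨F₁, h1, h1X, h1r⟩ := exists_hardForest (G := G) (R := R)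
  obtain ⟨F, h2, h12, h2X, h2r⟩ := h1.exists_extension
    (h1X.trans (Set.subset_union_left (t := G.innerJetEdges R)))
  have hsub : hardEdges R ∪ G.innerJetEdges R ⊆ nonsoftEdges R :=
    Set.union_subset hardEdges_subset innerJetEdges_subset
  obtain ⟨F₂, h3, h23, h3X, h3r⟩ := h2.exists_extension (h2X.trans hsub)
  refine ⟨F₁, F₂, h1X, h1r, h12.trans h23, h3, h3X, h3r, fun i x hx y hy => ?_⟩
  refine Reach.mono (fun e he => ⟨h23 he, h2X he⟩) (h2r x y ?_)
  exact (hR.reach_jet hx hy).mono fun e he => Or.inr ⟨i, he.1, he.2⟩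

variable [Nonempty V]

/-- Trees for bonds of nonsoft edges. -/
theorem IsBond.exists_tree_nonsoft (hG : G.IsMojetic Set.univ) {A : Set V}
    (hA : G.IsBond (nonsoftEdges R) (G.nonsoftVerts R) (G.hardVerts R) A) {e : E}
    (he : e ∈ nonsoftEdges R) (hcut : e ∈ G.cut A) : ∃ T, G.IsMinTree R T ∧ e ∈ T ∧
      (∀ x ∈ A, ∀ y ∈ A, G.Reach (T \ {e}) x y) ∧
      ∀ x ∈ G.nonsoftVerts R \ A, ∀ y ∈ G.nonsoftVerts R \ A, G.Reach (T \ {e}) x y := by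
  obtain ⟨F₁, h1, h1X, h1r⟩ := exists_hardForest (G := G) (R := R)
  -- `A` avoids the hard vertices, so no hard edge crosses the bond and the hard forest survives on
  -- its other side.
  have hF₁ : F₁ ⊆ nonsoftEdges R \ G.cut A := by
    intro f hf
    refine ⟨hardEdges_subset (h1X hf), ?_⟩
    rintro ⟨a, ha, b, -, hab⟩
    exact Set.disjoint_left.1 hA.disjoint (mem_hardVerts_of_hard (h1X hf)
      (by rw [hab]; exact Sym2.mem_mk_left _ _)) ha
  obtain ⟨F, h1F, hFX, hFe, hcA, hcB, hU⟩ := hA.exists_forest (fun e he => ends_nonsoft he) h1 hF₁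
    he hcut
  obtain ⟨T, hT, hFT, -, -⟩ := exists_isMinTree (F₂ := insert e F) h1X h1r
    (h1F.trans (Set.subset_insert e F)) hFe (Set.insert_subset he fun f hf => (hFX hf).1)
    (fun x y hr => hr.of_edges fun f hf a b hab => hU a (ends_nonsoft hf a
      (by rw [hab]; exact Sym2.mem_mk_left _ _)) b (ends_nonsoft hf b
      (by rw [hab]; exact Sym2.mem_mk_right _ _))) (Set.subset_univ _) hG.reach_univ
  have hsub : F ⊆ T \ {e} := fun f hf => ⟨hFT (Or.inr hf), fun h =>
    (hFX hf).2 (Set.mem_singleton_iff.1 h ▸ hcut)⟩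
  exact ⟨T, hT, hFT (Set.mem_insert _ _), fun x hx y hy => (hcA x hx y hy).mono hsub,
    fun x hx y hy => (hcB x hx y hy).mono hsub⟩

/-- Trees for bonds of all edges. -/
theorem IsBond.exists_tree_soft (hR : G.BasicRequirements R) {A : Set V}
    (hA : G.IsBond Set.univ Set.univ (G.nonsoftVerts R) A) {e : E}
    (hcut : e ∈ G.cut A) : ∃ T, G.IsMinTree R T ∧ e ∈ T ∧
      (∀ x ∈ A, ∀ y ∈ A, G.Reach (T \ {e}) x y) ∧
      ∀ x ∈ Set.univ \ A, ∀ y ∈ Set.univ \ A, G.Reach (T \ {e}) x y := by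
  obtain ⟨F₁, F₂, h1X, h1r, h12, h2, h2X, h2r, -⟩ := hR.exists_nonsoftForest
  have hF₂ : F₂ ⊆ Set.univ \ G.cut A := by
    intro f hf
    refine ⟨trivial, ?_⟩
    rintro ⟨a, ha, b, -, hab⟩
    exact Set.disjoint_left.1 hA.disjoint (ends_nonsoft (h2X hf) a
      (by rw [hab]; exact Sym2.mem_mk_left _ _)) ha
  obtain ⟨F, h2F, hFX, hFe, hcA, hcB, hU⟩ := hA.exists_forest (fun _ _ _ _ => trivial) h2 hF₂
    trivial hcut
  have hsub : F ⊆ insert e F \ {e} := fun f hf => ⟨Or.inr hf, fun h =>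
    (hFX hf).2 (Set.mem_singleton_iff.1 h ▸ hcut)⟩
  refine ⟨insert e F, ⟨isSpanningTree_iff.2 ⟨hFe, fun x y => hU x trivial y trivial⟩,
    fun x y hr => (h1r x y hr).mono fun f hf => ⟨Or.inr (h2F (h12 hf)), h1X hf⟩,
    fun x y hr => (h2r x y hr).mono fun f hf => ⟨Or.inr (h2F hf), h2X hf⟩⟩,
    Set.mem_insert _ _, fun x hx y hy => (hcA x hx y hy).mono hsub,
    fun x hx y hy => (hcB x hx y hy).mono hsub⟩

/-- Trees for bonds of hard edges. -/
theorem IsBond.exists_tree_hard (hG : G.IsMojetic Set.univ) {A : Set V}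
    (hA : G.IsBond (hardEdges R) (G.hardVerts R) ∅ A) {e : E}
    (he : e ∈ hardEdges R) (hcut : e ∈ G.cut A) {X : Set E} (hX : hardEdges R ⊆ X)
    (hX' : X ⊆ nonsoftEdges R) (hXr : ∀ x y, G.Reach (nonsoftEdges R) x y → G.Reach X x y) :
    ∃ T, G.IsMinTree R T ∧ e ∈ T ∧ T ∩ nonsoftEdges R ⊆ X ∧
      (∀ x ∈ A, ∀ y ∈ A, G.Reach (T \ {e}) x y) ∧
      ∀ x ∈ G.hardVerts R \ A, ∀ y ∈ G.hardVerts R \ A, G.Reach (T \ {e}) x y := by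
  obtain ⟨F, -, hFX, hFe, hcA, hcB, hU⟩ := hA.exists_forest
    (fun e he v hv => mem_hardVerts_of_hard he hv) isForest_empty (Set.empty_subset _) he hcut
  have hFH : insert e F ⊆ hardEdges R := Set.insert_subset he fun f hf => (hFX hf).1
  obtain ⟨F₂, h2, hF2, h2X, h2r⟩ := hFe.exists_extension (hFH.trans hX)
  obtain ⟨T, hT, hFT, -, hTN⟩ := exists_isMinTree (F₂ := F₂) hFH
    (fun x y hr => hr.of_edges fun f hf a b hab => hU a (mem_hardVerts_of_hard hf
      (by rw [hab]; exact Sym2.mem_mk_left _ _)) b (mem_hardVerts_of_hard hf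
      (by rw [hab]; exact Sym2.mem_mk_right _ _))) hF2 h2 (h2X.trans hX')
    (fun x y hr => h2r x y (hXr x y hr)) (Set.subset_univ _) hG.reach_univ
  have hsub : F ⊆ T \ {e} := fun f hf => ⟨hFT (hF2 (Or.inr hf)), fun h =>
    (hFX hf).2 (Set.mem_singleton_iff.1 h ▸ hcut)⟩
  exact ⟨T, hT, hFT (hF2 (Set.mem_insert _ _)), hTN ▸ h2X,
    fun x hx y hy => (hcA x hx y hy).mono hsub, fun x hx y hy => (hcB x hx y hy).mono hsub⟩

end Levels

end FeynmanGraph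

/-! ### Sufficiency: jet and soft edges -/

namespace FeynmanGraph

variable {V E : Type*} {K L : ℕ} {G : FeynmanGraph V E K L} {R : E → Mode K}

theorem edgeWeight_jet {e : E} {i : Fin K} (h : R e = .jet i) : edgeWeight R e = 1 := by
  simp [edgeWeight, h]

theorem edgeWeight_soft {e : E} (h : R e = .soft) : edgeWeight R e = 2 := by
  simp [edgeWeight, h]

theorem edgeWeight_hard {e : E} (h : R e = .hard) : edgeWeight R e = 0 := by
  simp [edgeWeight, h]

theorem left_mem_ends {e : E} {u v : V} (h : G.ends e = s(u, v)) : u ∈ G.ends e := by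
  rw [h]; exact Sym2.mem_mk_left _ _

theorem right_mem_ends {e : E} {u v : V} (h : G.ends e = s(u, v)) : v ∈ G.ends e := by
  rw [h]; exact Sym2.mem_mk_right _ _

theorem exists_ends_of_mem {e : E} {u : V} (h : u ∈ G.ends e) : ∃ v, G.ends e = s(u, v) := by
  obtain ⟨v, hv⟩ := Sym2.mem_iff_exists.1 h
  exact ⟨v, hv⟩

theorem IsBond.exists_cut {X : Set E} {U Z A : Set V} (hU : G.ConnOn X U) (hA : G.IsBond X U Z A) :
    ∃ e ∈ X, ∃ a ∈ A, ∃ b ∈ U \ A, G.ends e = s(a, b) := by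
  obtain ⟨a, ha⟩ := hA.nonempty
  obtain ⟨b, hbU, hb⟩ := hA.diff_nonempty
  exact hU.exists_exit hA.subset ha hbU hb

variable [Finite V] [Nonempty V] [Fintype E] {α : E → ℝ} {κ : ℝ}
  (hG : G.IsMojetic Set.univ) (hR : G.BasicRequirements R)
  (hα : ∀ T w, G.IsTerm T w → treeWeight R T + w = G.minWeight R → ∑ e, T.indicator α e = κ)

include hG hR hα

/-- A combination that is constant on the terms of minimal weight vanishes on the jets. -/
theorem eq_zero_of_jet (hn : 2 ≤ K + L)
    (hγ : ∀ i, ∃ γ, G.IsMojetic γ ∧ G.hardPart R ⊆ γ ∧ G.jetPart R i ⊆ γ ∧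
      ∀ e, .inr (.inl e) ∈ γ → e ∈ nonsoftEdges R)
    {e : E} {i : Fin K} (he : R e = .jet i) : α e = 0 := by
  by_contra hne
  have hU := hR.connOn_nonsoft
  have hZ := hR.connOn_hard.mono hardEdges_subset
  have heN : e ∈ nonsoftEdges R := mem_nonsoftEdges_iff.2 (Or.inr ⟨i, he⟩)
  have hconst : ∀ A, G.IsBond (nonsoftEdges R) (G.nonsoftVerts R) (G.hardVerts R) A →
      ∀ e ∈ nonsoftEdges R, e ∈ G.cut A → ∀ e' ∈ nonsoftEdges R, e' ∈ G.cut A → α e = α e' := by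
    intro A hA
    obtain ⟨k, hk⟩ := hA.subset_jetVerts
    refine const_of_trees hα (fun e he => ends_nonsoft he) (fun e he hcut e' he' hcut' => ?_)
      fun e he hcut => hA.exists_tree_nonsoft hG he hcut
    rw [edgeWeight_jet (mode_of_mem_cut hk he hcut), edgeWeight_jet (mode_of_mem_cut hk he' hcut')]
  obtain ⟨u, hue, huJ⟩ := hR.exists_jetVert_of_jet he
  obtain ⟨v, huv⟩ := exists_ends_of_mem hue
  obtain ⟨A₀, hA₀, hcut₀⟩ := exists_isBond hU hZ hardVerts_subset_nonsoftVerts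
    (ends_nonsoft heN u hue) (ends_nonsoft heN v (right_mem_ends huv)) (hG.ne_of_ends huv)
    (fun h => notMem_jetVerts_of_hard h huJ) huv
  -- No side condition is needed: of two parts of the complement, the one without hard vertices can
  -- be added.
  obtain ⟨A, hA, hcA, -, hexit⟩ := exists_bond_single_exit (c := α e) hZ
    hardVerts_subset_nonsoftVerts hconst (fun _ => True)
    ⟨A₀, hA₀, fun e' he' hcut' => hconst A₀ hA₀ e' he' hcut' e heN hcut₀, trivial⟩
    (fun A B₁ B₂ _ _ _ _ _ _ hor _ _ => hor.symm.imp (fun h => ⟨h, trivial⟩) fun h => ⟨h, trivial⟩)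
  obtain ⟨k, hk⟩ := hA.subset_jetVerts
  obtain ⟨e₀, he₀, a, ha, x, hx, hax⟩ := hA.exists_cut hU
  have hy := hR.att_mem_jetVerts (hk ha)
  have hcut₀ : e₀ ∈ G.cut A := ⟨a, ha, x, hx.2, hax⟩
  -- If `p_k` entered in `A`, deleting a crossing edge would cut off `p_k` alone, and `w = 1` is the
  -- weight of that jet edge.
  have hyA : G.att (.inl k) ∉ A := by
    intro hyA
    obtain ⟨T, hT, heT, h1, h2⟩ := hA.exists_tree_nonsoft hG he₀ hcut₀
    have hside : G.legSide (T \ {e₀}) a = {.inl k} := by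
      ext ℓ
      constructor
      · intro hℓ
        by_cases hmem : G.att ℓ ∈ A
        · exact hR.eq_of_att_mem (hk hmem)
        · exact absurd (hℓ.trans (h2 _ ⟨hR.att_notMem_softVerts ℓ, hmem⟩ x hx))
            (hT.1.1.not_reach_diff heT hax)
      · rintro rfl
        exact h1 a ha _ hyA
    have hz : α e₀ = 0 := by
      refine hT.eq_zero_of_isSplit hα heT hax (x := a) ?_
      rw [hside, edgeWeight_jet (mode_of_mem_cut hk he₀ hcut₀)]
      refine ⟨⟨_, rfl⟩, ?_, Or.inl ⟨⟨k, Or.inl rfl⟩, rfl⟩⟩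
      rw [Set.nonempty_compl]
      intro h
      have := congrArg Set.ncard h
      rw [Set.ncard_singleton, Set.ncard_univ, Nat.card_eq_fintype_card, Fintype.card_sum,
        Fintype.card_fin, Fintype.card_fin] at this
      omega
    exact hne ((hcA e₀ he₀ hcut₀).symm.trans hz)
  -- The exits cannot all be hard, because the jet is connected and `p_k` enters outside `A`. So `x`
  -- is a jet vertex that cuts `A` off from all external lines.
  by_cases hxZ : x ∈ G.hardVerts R
  · obtain ⟨e₁, he₁, p, hp, q, hq, hpq, -⟩ := (hR.reach_jet (hk ha) hy).first_exit ha hyA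
    have hqJ : q ∈ G.jetVerts R k := he₁.2 q (right_mem_ends hpq)
    have he₁N : e₁ ∈ nonsoftEdges R := mem_nonsoftEdges_iff.2 (Or.inr ⟨k, he₁.1⟩)
    rcases hexit e₀ he₀ a ha x hx hax e₁ he₁N p hp q ⟨notMem_softVerts_of_jet hqJ, hq⟩ hpq with h | h
    · exact notMem_jetVerts_of_hard hxZ (h ▸ hqJ)
    · exact notMem_jetVerts_of_hard h.2 hqJ
  · obtain ⟨γ, hγm, -, hγJ, hγN⟩ := hγ k
    have hxJ : x ∈ G.jetVerts R k :=
      (hard_or_jet_of_jet (mode_of_mem_cut hk he₀ hcut₀) (right_mem_ends hax)).resolve_left hxZ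
    refine hγm.false_of_cut (A := A) (x := x) (hγJ hxJ) (fun v hv => hγJ (hk hv)) hA.nonempty hx.2
      (fun ℓ _ hℓ => ?_) fun f hf u hu w hw huw => ?_
    · have hℓk := hR.eq_of_att_mem (hk hℓ)
      rw [hℓk] at hℓ
      exact hyA hℓ
    · rcases hexit e₀ he₀ a ha x hx hax f (hγN f hf) u hu w
        ⟨ends_nonsoft (hγN f hf) w (right_mem_ends huw), hw⟩ huw with h | h
      · exact h.symm
      · exact absurd h.1 hxZ

omit hG in
/-- A soft line that joins two jets outside the hard subgraph. -/
theorem eq_zero_of_soft_between_jets (hn : 3 ≤ K + L ∧ (L = 0 → 4 ≤ K))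
    (hjet : ∀ e i, R e = .jet i → α e = 0) {T : Set E} (hT : G.IsMinTree R T)
    (hTJ : ∀ i, ∀ x ∈ G.jetVerts R i, ∀ y ∈ G.jetVerts R i,
      G.Reach (T ∩ (hardEdges R ∪ G.innerJetEdges R)) x y)
    {i j : Fin K} (hij : i ≠ j) {x y z : V} (hx : x ∈ G.jetVerts R i) (hy : y ∈ G.jetVerts R j)
    (hzx : G.Reach (T \ nonsoftEdges R) z x) {f : E} (hf : R f = .soft)
    (hends : G.ends f = s(y, z)) : α f = 0 := by
  set S := T ∩ (hardEdges R ∪ G.innerJetEdges R) with hS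
  -- A jet with vertices hangs on the hard part by an edge of `T` that is not needed to join the jet
  -- internally.
  have hconn : ∀ k, ∀ p ∈ G.jetVerts R k, ∃ g ∈ T, R g = .jet k ∧ g ∉ S ∧ ∃ a ∈ G.jetVerts R k,
      ∃ h ∈ G.hardVerts R, G.ends g = s(a, h) := by
    intro k p hp
    obtain ⟨h, hh⟩ := hR.hardVerts_nonempty
    obtain ⟨g, ⟨hgT, hgN⟩, a, ha, b, hb, hab, -⟩ := (hT.2.2 p h (hR.reach_nonsoft
      (notMem_softVerts_of_jet hp) (notMem_softVerts_of_hard hh))).first_exit hp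
      (notMem_jetVerts_of_hard hh)
    have hg := jet_of_nonsoft hgN ha (left_mem_ends hab)
    have hbH := (hard_or_jet_of_jet hg (right_mem_ends hab)).resolve_right hb
    refine ⟨g, hgT, hg, ?_, a, ha, b, hbH, hab⟩
    rintro ⟨-, h | ⟨m, -, h⟩⟩
    · have : R g = .hard := h
      rw [hg] at this; cases this
    · exact notMem_jetVerts_of_hard hbH (h b (right_mem_ends hab))
  obtain ⟨gi, hgiT, hgi, hgiS, pi, hpi, hi, hhi, hgiE⟩ := hconn i x hx
  obtain ⟨gj, hgjT, hgj, hgjS, pj, hpj, hj, hhj, hgjE⟩ := hconn j y hy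
  have hgne : gi ≠ gj := by
    rintro rfl
    rw [hgi] at hgj
    exact hij (Mode.jet.inj hgj)
  have hgiN : gi ∈ nonsoftEdges R := mem_nonsoftEdges_iff.2 (Or.inr ⟨i, hgi⟩)
  have hgjN : gj ∈ nonsoftEdges R := mem_nonsoftEdges_iff.2 (Or.inr ⟨j, hgj⟩)
  have hHr : ∀ a ∈ G.hardVerts R, ∀ b ∈ G.hardVerts R, G.Reach S a b := fun a ha b hb =>
    (hT.2.1 a b (hR.reach_hard ha hb)).mono fun e he => ⟨he.1, Or.inl he.2⟩
  have hsub : ∀ Y : Set E, Y ⊆ T → gi ∉ Y → gj ∉ Y → Y ⊆ (T \ {gj}) \ {gi} := fun Y hY h1 h2 e he =>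
    ⟨⟨hY he, fun h => h2 (Set.mem_singleton_iff.1 h ▸ he)⟩,
      fun h => h1 (Set.mem_singleton_iff.1 h ▸ he)⟩
  have hS2 : S ⊆ (T \ {gj}) \ {gi} := hsub S Set.inter_subset_left hgiS hgjS
  have hsoft2 : T \ nonsoftEdges R ⊆ (T \ {gj}) \ {gi} :=
    hsub _ Set.sdiff_subset (fun h => h.2 hgiN) (fun h => h.2 hgjN)
  have hzpi : G.Reach ((T \ {gj}) \ {gi}) z pi := (hzx.mono hsoft2).trans
    ((hTJ i x hx pi hpi).mono hS2)
  have hypj : G.Reach ((T \ {gj}) \ {gi}) y pj := (hTJ j y hy pj hpj).mono hS2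
  have hd : (T \ {gj}) \ {gi} ⊆ T \ {gj} := Set.sdiff_subset
  have hzhj : G.Reach (T \ {gj}) z hj := ((hzpi.mono hd).trans
    (reach_of_edge ⟨hgiT, hgne⟩ hgiE)).trans ((hHr hi hhi hj hhj).mono (hS2.trans hd))
  -- Jet `j` is taken off the hard part and hung on jet `i` by the soft edge. Deleting `gi` next
  -- cuts off both jets together.
  obtain ⟨hfT, hT₁⟩ := hT.1.exchange hgjT hgjE hends (hypj.mono hd) hzhj
  have hfgi : f ≠ gi := by
    rintro rfl
    rw [hgi] at hf; cases hf
  have hgi₁ : gi ∈ insert f (T \ {gj}) := Or.inr ⟨hgiT, hgne⟩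
  have hd2 : (T \ {gj}) \ {gi} ⊆ insert f (T \ {gj}) \ {gi} :=
    Set.sdiff_subset_sdiff_left (Set.subset_insert _ _)
  have hfmem : f ∈ insert f (T \ {gj}) \ {gi} := ⟨Set.mem_insert _ _, hfgi⟩
  have hside : G.legSide (insert f (T \ {gj}) \ {gi}) pi = {.inl i, .inl j} := by
    have hfi : ∀ p ∈ G.jetVerts R i, G.Reach (insert f (T \ {gj}) \ {gi}) pi p := fun p hp =>
      ((hTJ i pi hpi p hp).mono hS2).mono hd2
    have hfj : ∀ p ∈ G.jetVerts R j, G.Reach (insert f (T \ {gj}) \ {gi}) pi p := fun p hp =>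
      ((hzpi.mono hd2).symm.trans (reach_of_edge hfmem hends).symm).trans
        (((hTJ j y hy p hp).mono hS2).mono hd2)
    have hno := hT₁.1.not_reach_diff hgi₁ hgiE
    ext ℓ
    constructor
    · intro hℓ
      by_contra hcon
      refine hno (Reach.trans hℓ ?_)
      rcases hard_or_jet_of_notMem_softVerts (hR.att_notMem_softVerts ℓ) with h | ⟨k, hk⟩
      · exact ((hHr _ h hi hhi).mono hS2).mono hd2
      · have hℓk := hR.eq_of_att_mem hk
        have hki : k ≠ i := fun h => hcon (Or.inl (h ▸ hℓk))
        have hkj : k ≠ j := fun h => hcon (Or.inr (h ▸ hℓk))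
        obtain ⟨g, hgT, hg, -, a, ha, h, hh, hgE⟩ := hconn k _ hk
        have hgm : g ∈ (T \ {gj}) \ {gi} := ⟨⟨hgT, fun h => hkj (by
          rw [Set.mem_singleton_iff.1 h, hgj] at hg; exact (Mode.jet.inj hg).symm)⟩, fun h => hki (by
          rw [Set.mem_singleton_iff.1 h, hgi] at hg; exact (Mode.jet.inj hg).symm)⟩
        exact ((((hTJ k _ hk a ha).mono hS2).trans (reach_of_edge hgm hgE)).trans
          ((hHr h hh hi hhi).mono hS2)).mono hd2
    · rintro (rfl | rfl)
      · exact hfi _ (hR.att_mem_jetVerts hpi)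
      · exact hfj _ (hR.att_mem_jetVerts hpj)
  have h1 := hα T 0 (Or.inl ⟨hT.1, rfl⟩) hT.treeWeight_eq
  have hm := hT.treeWeight_eq
  have hw1 := treeWeight_diff (R := R) hgjT
  have hw2 := treeWeight_insert (R := R) hfT
  have hw3 := treeWeight_diff (R := R) hgi₁
  rw [edgeWeight_jet hgj] at hw1
  rw [edgeWeight_soft hf] at hw2
  rw [edgeWeight_jet hgi] at hw3
  -- The weight changes by -1 + 2 - 1 = 0, and the pair `p_i`, `p_j` has `w = 0`, so the 2-tree is
  -- minimal.
  have h2 := hα (insert f (T \ {gj}) \ {gi}) 0 (Or.inr ⟨hT₁.isSpanningTwoTree_diff hgi₁ hgiE, pi, by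
    rw [hside]; exact isSplit_pair hn hij⟩) (by omega)
  have hs1 := sum_indicator_diff hgjT α
  have hs2 := sum_indicator_insert hfT α
  have hs3 := sum_indicator_diff hgi₁ α
  rw [hjet gj j hgj] at hs1
  rw [hjet gi i hgi] at hs3
  linarith

/-- A combination that is constant on the terms of minimal weight vanishes on the soft edges. -/
theorem eq_zero_of_soft (hn : ∀ _ : Fin K, 3 ≤ K + L ∧ (L = 0 → 4 ≤ K))
    (hjet : ∀ e i, R e = .jet i → α e = 0)
    (hsoft : ∀ C, G.IsComponent (G.softPart R) C → ∃ i j : Fin K, i ≠ j ∧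
      G.Attached C (G.jetPart R i) ∧ G.Attached C (G.jetPart R j))
    {e : E} (he : R e = .soft) : α e = 0 := by
  by_contra hne
  have hU : G.ConnOn Set.univ Set.univ := fun x _ y _ =>
    (hG.reach_univ x y).mono fun _ _ => ⟨trivial, fun _ _ => trivial⟩
  have hZ := hR.connOn_nonsoft.mono (Set.subset_univ _)
  by_cases hcase : ∃ u ∈ G.ends e, u ∈ G.softVerts R
  · obtain ⟨u, hue, hu⟩ := hcase
    obtain ⟨v, huv⟩ := exists_ends_of_mem hue
    have hsub : ∀ A, G.IsBond Set.univ Set.univ (G.nonsoftVerts R) A → A ⊆ G.softVerts R := by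
      intro A hA v hv
      by_contra h
      exact Set.disjoint_left.1 hA.disjoint h hv
    have hmode : ∀ A, G.IsBond Set.univ Set.univ (G.nonsoftVerts R) A → ∀ e ∈ G.cut A,
        R e = .soft := by
      rintro A hA e ⟨a, ha, b, -, hab⟩
      exact mode_of_mem_softVerts (hsub A hA ha) (left_mem_ends hab)
    have hconst : ∀ A, G.IsBond Set.univ Set.univ (G.nonsoftVerts R) A →
        ∀ e ∈ Set.univ, e ∈ G.cut A → ∀ e' ∈ Set.univ, e' ∈ G.cut A → α e = α e' := by
      intro A hA
      refine const_of_trees (X := Set.univ) (U := Set.univ) hα (fun _ _ _ _ => trivial)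
        (fun e he hcut e' he' hcut' => ?_) fun e he hcut => hA.exists_tree_soft hR hcut
      rw [edgeWeight_soft (hmode A hA e hcut), edgeWeight_soft (hmode A hA e' hcut')]
    obtain ⟨A₀, hA₀, hcut₀⟩ := exists_isBond (X := Set.univ) hU hZ (Set.subset_univ _)
      (Set.mem_univ u) (Set.mem_univ v) (hG.ne_of_ends huv) (fun h => h hu) huv
    obtain ⟨A, hA, hcA, -, hexit⟩ := exists_bond_single_exit (c := α e) hZ
      (Set.subset_univ _) hconst (fun _ => True)
      ⟨A₀, hA₀, fun e' he' hcut' => hconst A₀ hA₀ e' he' hcut' e trivial hcut₀, trivial⟩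
      (fun A B₁ B₂ _ _ _ _ _ _ hor _ _ =>
        hor.symm.imp (fun h => ⟨h, trivial⟩) fun h => ⟨h, trivial⟩)
    have hAS := hsub A hA
    obtain ⟨e₀, -, a, ha, x, hx, hax⟩ := hA.exists_cut hU
    -- If all exits are nonsoft, the soft component of `a` consists of cells in or touching `A`, and
    -- its attachments to two jets are edges across the bond.
    by_cases hxZ : x ∈ G.nonsoftVerts R
    · have hexitZ : ∀ f, ∀ p ∈ A, ∀ q ∉ A, G.ends f = s(p, q) → q ∉ G.softVerts R := by
        intro f p hp q hq hpq
        rcases hexit e₀ trivial a ha x hx hax f trivial p hp q ⟨trivial, hq⟩ hpq with h | h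
        · exact h ▸ hxZ
        · exact h.2
      obtain ⟨C, hC, -, hCD⟩ := G.exists_isComponent (γ := G.softPart R) (x := .inl a) (hAS ha)
      have hCD := hCD {c | (∃ v ∈ A, c = .inl v) ∨ ∃ f, c = .inr (.inl f) ∧ ∃ p ∈ A, p ∈ G.ends f}
        (Or.inl ⟨a, ha, rfl⟩) (by
          rintro c hc y hy hadj
          rcases hc with ⟨v, hv, rfl⟩ | ⟨f, rfl, p, hp, hpf⟩
          · obtain ⟨l, rfl, hl⟩ := incidence_adj_inl.1 hadj
            rcases l with f | ℓ
            · exact Or.inr ⟨f, rfl, v, hv, hl⟩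
            · have hatt : G.att ℓ = v := hl
              exact absurd (hAS (hatt ▸ hv)) (hR.att_notMem_softVerts ℓ)
          · obtain ⟨w, rfl, hw⟩ := incidence_adj_inr.1 hadj
            refine Or.inl ⟨w, ?_, rfl⟩
            by_contra hwA
            have hpw : p ≠ w := fun h => hwA (h ▸ hp)
            exact hexitZ f p hp w hwA (OnLine.ends_eq (G := G) hpf hw hpw) hy)
      have hatt : ∀ k, G.Attached C (G.jetPart R k) → ∃ f, ∃ p ∈ A, ∃ q ∈ G.jetVerts R k,
          G.ends f = s(p, q) := by
        rintro k ⟨c, hc, y, hy, hadj⟩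
        rcases hCD hc with ⟨v, hv, rfl⟩ | ⟨f, rfl, p, hp, hpf⟩
        · obtain ⟨l, rfl, hl⟩ := incidence_adj_inl.1 hadj
          have h1 : lineMode R l = .soft := hAS hv l hl
          have h2 : lineMode R l = .jet k := hy
          rw [h1] at h2; cases h2
        · obtain ⟨w, rfl, hw⟩ := incidence_adj_inr.1 hadj
          have hpw : p ≠ w := by
            rintro rfl
            exact notMem_softVerts_of_jet hy (hAS hp)
          exact ⟨f, p, hp, w, hy, OnLine.ends_eq (G := G) hpf hw hpw⟩
      obtain ⟨i, j, hij, hCi, hCj⟩ := hsoft C hC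
      obtain ⟨fi, pi, hpi, xi, hxi, hfi⟩ := hatt i hCi
      obtain ⟨fj, pj, hpj, xj, hxj, hfj⟩ := hatt j hCj
      have hxiA : xi ∉ A := fun h => notMem_softVerts_of_jet hxi (hAS h)
      have hxjA : xj ∉ A := fun h => notMem_softVerts_of_jet hxj (hAS h)
      obtain ⟨F₁, F₂, h1X, h1r, h12, h2, h2X, h2r, h2J⟩ := hR.exists_nonsoftForest
      -- `T` is built to leave `A` only through `fi`. Its path from `pj` to jet `i` then consists of
      -- soft edges, so that `fj` becomes a link between the two jets.
      obtain ⟨T, hT, hFT, hTX, -⟩ := exists_isMinTree (X := {f | f ∈ G.cut A → f = fi}) h1X h1r h12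
        h2 h2X h2r (fun f hf hcut => absurd (hmode A hA f hcut) (h2X hf)) (by
          have hin : ∀ B : Set V, (B ⊆ A ∨ Disjoint B A) →
              G.inside Set.univ B ⊆ {f | f ∈ G.cut A → f = fi} := by
            rintro B hB f ⟨-, hf⟩ ⟨p, hp, q, hq, hpq⟩
            rcases hB with h | h
            · exact absurd (h (hf q (right_mem_ends hpq))) hq
            · exact absurd hp (Set.disjoint_left.1 h (hf p (left_mem_ends hpq)))
          have hfi' : G.Reach {f | f ∈ G.cut A → f = fi} pi xi := reach_of_edge (fun _ => rfl) hfi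
          have key : ∀ y, G.Reach {f | f ∈ G.cut A → f = fi} y pi := by
            intro y
            by_cases hy : y ∈ A
            · exact (hA.conn y hy pi hpi).mono (hin A (Or.inl subset_rfl))
            · exact ((hA.conn_diff y ⟨trivial, hy⟩ xi ⟨trivial, hxiA⟩).mono
                (hin _ (Or.inr Set.disjoint_sdiff_left))).trans hfi'.symm
          exact fun y z => (key y).trans (key z).symm)
      have hzx : G.Reach (T \ nonsoftEdges R) pj xi := by
        obtain ⟨f, hfT, p, hp, q, hq, hpq, hr⟩ := (hT.1.reach pj xi).first_exit hpj hxiA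
        obtain rfl := hTX hfT ⟨p, hp, q, hq, hpq⟩
        have hq' : q = xi := by
          rw [hfi, Sym2.eq_iff] at hpq
          rcases hpq with ⟨-, h⟩ | ⟨h, -⟩
          · exact h.symm
          · exact absurd hpi (h ▸ hq)
        rw [← hq']
        have hns : ∀ g, ∀ p ∈ A, p ∈ G.ends g → g ∉ nonsoftEdges R := fun g p hp hpg hg =>
          hg (mode_of_mem_softVerts (hAS hp) hpg)
        refine (hr.mono ?_).trans (reach_of_edge ⟨hfT, hns f p hp (left_mem_ends hpq)⟩ hpq)
        rintro g ⟨hgT, hg⟩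
        obtain ⟨c, d, hcd⟩ := G.exists_ends g
        exact ⟨hgT, hns g c (hg c (left_mem_ends hcd)) (left_mem_ends hcd)⟩
      have hcutj : fj ∈ G.cut A := ⟨pj, hpj, xj, hxjA, hfj⟩
      have := eq_zero_of_soft_between_jets hR hα (hn i) hjet hT (fun k p hp q hq =>
        (h2J k p hp q hq).mono (Set.inter_subset_inter_left _ hFT)) hij hxi hxj hzx
        (hmode A hA fj hcutj) (hfj.trans Sym2.eq_swap)
      exact hne ((hcA fj trivial hcutj).symm.trans this)
    · have hexitx : ∀ f, ∀ p ∈ A, ∀ q ∉ A, G.ends f = s(p, q) → q = x := by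
        intro f p hp q hq hpq
        rcases hexit e₀ trivial a ha x hx hax f trivial p hp q ⟨trivial, hq⟩ hpq with h | h
        · exact h.symm
        · exact absurd h.1 hxZ
      -- No external line enters at a soft vertex, so a single soft exit is a cut vertex of the
      -- whole graph.
      exact hG.false_of_cut (A := A) (x := x) (Set.mem_univ _) (fun _ _ => Set.mem_univ _)
        hA.nonempty hx.2 (fun ℓ _ hℓ => hR.att_notMem_softVerts ℓ (hAS hℓ))
        fun f _ u hu w hw huw => hexitx f u hu w hw huw
  · push Not at hcase
    obtain ⟨C, hC, -, hCD⟩ := G.exists_isComponent (γ := G.softPart R) (x := .inr (.inl e)) he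
    have hCD := hCD {.inr (.inl e)} rfl (by
      rintro _ rfl y hy hadj
      obtain ⟨w, rfl, hw⟩ := incidence_adj_inr.1 hadj
      exact absurd hy (hcase w hw))
    have hatt : ∀ k, G.Attached C (G.jetPart R k) → ∃ q ∈ G.jetVerts R k, q ∈ G.ends e := by
      rintro k ⟨c, hc, y, hy, hadj⟩
      rw [Set.mem_singleton_iff.1 (hCD hc)] at hadj
      obtain ⟨w, rfl, hw⟩ := incidence_adj_inr.1 hadj
      exact ⟨w, hy, hw⟩
    obtain ⟨i, j, hij, hCi, hCj⟩ := hsoft C hC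
    obtain ⟨xi, hxi, hxie⟩ := hatt i hCi
    obtain ⟨xj, hxj, hxje⟩ := hatt j hCj
    have hxx : xj ≠ xi := by
      rintro rfl
      exact hij (eq_of_mem_jetVerts hxi hxj)
    obtain ⟨F₁, F₂, h1X, h1r, h12, h2, h2X, h2r, h2J⟩ := hR.exists_nonsoftForest
    obtain ⟨T, hT, hFT, -, -⟩ := exists_isMinTree (X := Set.univ) h1X h1r h12
      h2 h2X h2r (Set.subset_univ _) hG.reach_univ
    exact hne (eq_zero_of_soft_between_jets hR hα (hn i) hjet hT (fun k p hp q hq =>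
      (h2J k p hp q hq).mono (Set.inter_subset_inter_left _ hFT)) hij hxi hxj (Reach.refl xi) he
      (OnLine.ends_eq (G := G) hxje hxie hxx))

end FeynmanGraph

/-! ### Sufficiency: hard edges and the choice of entries -/

namespace FeynmanGraph

variable {V E : Type*} {K L : ℕ} {G : FeynmanGraph V E K L} {R : E → Mode K}

variable (G R) in
/-- The hard vertices at which the external line `ℓ`, or the jet it belongs to, may enter. -/
def IsEntry (ℓ : Leg K L) (h : V) : Prop :=
  h ∈ G.hardVerts R ∧ (G.att ℓ = h ∨
    ∃ k, ℓ = .inl k ∧ ∃ e, R e = .jet k ∧ ∃ x ∈ G.jetVerts R k, G.ends e = s(x, h))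

variable (G R) in
/-- The nonsoft edges after all edges from a jet `k` to the hard part have been dropped, except
for those that enter at `h (.inl k)`. -/
def entryEdges (h : Leg K L → V) : Set E :=
  hardEdges R ∪ G.innerJetEdges R ∪
    {e | ∃ k, R e = .jet k ∧ ∃ x ∈ G.jetVerts R k, G.ends e = s(x, h (.inl k))}

theorem entryEdges_subset {h : Leg K L → V} : G.entryEdges R h ⊆ nonsoftEdges R := by
  rintro e ((he | he) | ⟨k, he, -⟩)
  · exact hardEdges_subset he
  · exact innerJetEdges_subset he
  · exact mem_nonsoftEdges_iff.2 (Or.inr ⟨k, he⟩)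

section

variable (hR : G.BasicRequirements R)

include hR

theorem BasicRequirements.exists_isEntry (ℓ : Leg K L) : ∃ h, G.IsEntry R ℓ h := by
  rcases hard_or_jet_of_notMem_softVerts (hR.att_notMem_softVerts ℓ) with h | ⟨k, hk⟩
  · exact ⟨_, h, Or.inl rfl⟩
  · obtain ⟨e, he, u, hu, h, hh, hends⟩ := hR.exists_jet_edge_to_hard hk
    exact ⟨h, hh, Or.inr ⟨k, hR.eq_of_att_mem hk, e, he, u, hu, hends⟩⟩

theorem BasicRequirements.exists_entry_edge {k : Fin K} {x h : V} (hx : x ∈ G.jetVerts R k)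
    (hh : G.IsEntry R (.inl k) h) :
    ∃ e, R e = .jet k ∧ ∃ x ∈ G.jetVerts R k, G.ends e = s(x, h) := by
  rcases hh.2 with h1 | ⟨k', h1, h2⟩
  · exact absurd (h1 ▸ hR.att_mem_jetVerts hx) (notMem_jetVerts_of_hard hh.1)
  · rw [Sum.inl.inj h1]; exact h2

/-- One vertex of attachment per jet is enough, since the jets and the hard part are connected in
themselves. Hence the entries can be chosen independently. -/
theorem BasicRequirements.reach_entryEdges {h : Leg K L → V} (hh : ∀ ℓ, G.IsEntry R ℓ (h ℓ))
    {x y : V} (hxy : G.Reach (nonsoftEdges R) x y) : G.Reach (G.entryEdges R h) x y := by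
  have hH : ∀ a ∈ G.hardVerts R, ∀ b ∈ G.hardVerts R, G.Reach (G.entryEdges R h) a b :=
    fun a ha b hb => (hR.reach_hard ha hb).mono fun e he => Or.inl (Or.inl he)
  have hJ : ∀ k, ∀ a ∈ G.jetVerts R k, ∀ b ∈ G.jetVerts R k, G.Reach (G.entryEdges R h) a b :=
    fun k a ha b hb => (hR.reach_jet ha hb).mono fun e he => Or.inl (Or.inr ⟨k, he.1, he.2⟩)
  have hJH : ∀ k, ∀ a ∈ G.jetVerts R k, ∀ b ∈ G.hardVerts R, G.Reach (G.entryEdges R h) a b := by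
    intro k a ha b hb
    obtain ⟨e, he, u, hu, hends⟩ := hR.exists_entry_edge ha (hh (.inl k))
    exact ((hJ k a ha u hu).trans (reach_of_edge (Or.inr ⟨k, he, u, hu, hends⟩) hends)).trans
      (hH _ (hh _).1 b hb)
  refine hxy.of_edges fun e he a b hab => ?_
  rcases mem_nonsoftEdges_iff.1 he with h | ⟨k, h⟩
  · exact reach_of_edge (Or.inl (Or.inl h)) hab
  · rcases hard_or_jet_of_jet h (left_mem_ends hab) with ha | ha <;>
      rcases hard_or_jet_of_jet h (right_mem_ends hab) with hb | hb
    · exact hH a ha b hb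
    · exact (hJH k b hb a ha).symm
    · exact hJH k a ha b hb
    · exact hJ k a ha b hb

/-- If all hard edges that leave `A` end in one vertex, then some external line enters in `A`. -/
theorem BasicRequirements.exists_isEntry_mem {A : Set V} {γ : Set (Cell V E K L)}
    (hγ : G.IsMojetic γ) (hγH : G.hardPart R ⊆ γ)
    (hγJ : ∀ e, .inr (.inl e) ∈ γ → R e = .hard ∨ ∃ k, R e = .jet k ∧ .inr (.inr (.inl k)) ∈ γ)
    (hA : A ⊆ G.hardVerts R) (hne : A.Nonempty) {x : V} (hx : x ∈ G.hardVerts R \ A)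
    (hexit : ∀ e ∈ hardEdges R, ∀ a ∈ A, ∀ y ∈ G.hardVerts R \ A, G.ends e = s(a, y) → y = x) :
    ∃ ℓ, .inr (.inr ℓ) ∈ γ ∧ ∃ p ∈ A, G.IsEntry R ℓ p := by
  by_contra hcon
  push Not at hcon
  refine hγ.false_of_cut (A := A) (x := x) (hγH hx.1) (fun v hv => hγH (hA hv)) hne hx.2
    (fun ℓ hℓ hatt => hcon ℓ hℓ _ hatt ⟨hA hatt, Or.inl rfl⟩) fun e he u hu w hw huw => ?_
  -- A jet edge at `A` would make its external line enter in `A`, so only hard edges leave `A`, and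
  -- `x` would be a cut vertex of `γ`.
  rcases hγJ e he with h | ⟨k, h, hk⟩
  · exact hexit e h u hu w ⟨mem_hardVerts_of_hard h (right_mem_ends huw), hw⟩ huw
  · obtain ⟨v, hv, hvJ⟩ := hR.exists_jetVert_of_jet h
    rw [huw, Sym2.mem_iff] at hv
    rcases hv with rfl | rfl
    · exact absurd hvJ (notMem_jetVerts_of_hard (hA hu))
    · exact absurd ⟨hA hu, Or.inr ⟨k, rfl, e, h, v, hvJ, huw.trans Sym2.eq_swap⟩⟩
        (hcon _ hk u hu)

variable [Nonempty V] [Finite E] (hG : G.IsMojetic Set.univ)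

include hG

/-- Every choice of entries is realized by a tree in which a given hard edge separates those in
`A` from the others. -/
theorem IsBond.exists_tree_legSide {A : Set V}
    (hA : G.IsBond (hardEdges R) (G.hardVerts R) ∅ A) {e : E}
    (he : e ∈ hardEdges R) {a b : V} (ha : a ∈ A) (hb : b ∉ A) (hab : G.ends e = s(a, b))
    {h : Leg K L → V} (hh : ∀ ℓ, G.IsEntry R ℓ (h ℓ)) :
    ∃ T, G.IsMinTree R T ∧ e ∈ T ∧ G.legSide (T \ {e}) a = {ℓ | h ℓ ∈ A} := by
  obtain ⟨T, hT, heT, hTX, h1, h2⟩ := hA.exists_tree_hard hG he ⟨a, ha, b, hb, hab⟩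
    (X := G.entryEdges R h) (fun e he => Or.inl (Or.inl he)) entryEdges_subset
    (fun x y hxy => hR.reach_entryEdges hh hxy)
  have hno := hT.1.1.not_reach_diff heT hab
  -- The nonsoft edges of `T` are entry edges, so `T` can leave the jet `k` only at the chosen
  -- vertex, by a path of jet edges that avoids the hard edge `e`.
  have hreach : ∀ ℓ, G.Reach (T \ {e}) (G.att ℓ) (h ℓ) := by
    intro ℓ
    rcases (hh ℓ).2 with hℓ | ⟨k, rfl, e', he', x, hx, hends⟩
    · rw [hℓ]
    · have hk := hR.att_mem_jetVerts hx
      obtain ⟨g, ⟨hgT, hgN⟩, p, hp, q, hq, hpq, hr⟩ := (hT.2.2 _ _ (hR.reach_nonsoft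
        (notMem_softVerts_of_jet hk) (notMem_softVerts_of_hard (hh (.inl k)).1))).first_exit hk
        (notMem_jetVerts_of_hard (hh (.inl k)).1)
      have hne : ∀ g u, u ∈ G.jetVerts R k → u ∈ G.ends g → g ≠ e := by
        rintro g u hu hug rfl
        exact notMem_jetVerts_of_hard (mem_hardVerts_of_hard he hug) hu
      have hg := jet_of_nonsoft hgN hp (left_mem_ends hpq)
      have hqh : q = h (.inl k) := by
        rcases hTX ⟨hgT, hgN⟩ with (hg' | ⟨m, hg', hin⟩) | ⟨m, hg', y, hy, hgy⟩
        · have : R g = .hard := hg'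
          rw [hg] at this; cases this
        · rw [hg] at hg'
          exact absurd (Mode.jet.inj hg' ▸ hin q (right_mem_ends hpq)) hq
        · rw [hg] at hg'
          obtain rfl := Mode.jet.inj hg'
          rw [hpq, Sym2.eq_iff] at hgy
          rcases hgy with ⟨-, h⟩ | ⟨-, h⟩
          · exact h
          · exact absurd (h ▸ hy) hq
      rw [← hqh]
      refine (hr.mono ?_).trans (reach_of_edge ⟨hgT, hne g p hp (left_mem_ends hpq)⟩ hpq)
      rintro f ⟨hf, hfJ⟩
      obtain ⟨c, d, hcd⟩ := G.exists_ends f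
      exact ⟨hf.1, hne f c (hfJ c (left_mem_ends hcd)) (left_mem_ends hcd)⟩
  refine ⟨T, hT, heT, ?_⟩
  ext ℓ
  refine ⟨fun hℓ => ?_, fun hℓ => (h1 a ha _ hℓ).trans (hreach ℓ).symm⟩
  by_contra hℓA
  exact hno (((show G.Reach (T \ {e}) a (G.att ℓ) from hℓ).trans (hreach ℓ)).trans
    (h2 _ ⟨(hh ℓ).1, hℓA⟩ b ⟨mem_hardVerts_of_hard he (right_mem_ends hab), hb⟩))

end

theorem IsBond.compl {X : Set E} {U A : Set V} (h : G.IsBond X U ∅ A) :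
    G.IsBond X U ∅ (U \ A) := by
  have hc : U \ (U \ A) = A := Set.sdiff_sdiff_cancel_left h.subset
  exact ⟨Set.sdiff_subset, h.diff_nonempty, by rw [hc]; exact h.nonempty, h.conn_diff,
    by rw [hc]; exact h.conn, Set.disjoint_left.2 fun _ hx => hx.elim⟩

theorem ConstOnCut.compl {X : Set E} {U A : Set V} {α : E → ℝ} {c : ℝ}
    (hX : ∀ e ∈ X, ∀ v ∈ G.ends e, v ∈ U) (h : G.ConstOnCut X α c A) :
    G.ConstOnCut X α c (U \ A) := by
  rintro e he ⟨a, ha, b, hb, hab⟩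
  refine h e he ⟨b, ?_, a, ha.2, hab.trans Sym2.eq_swap⟩
  by_contra hbA
  exact hb ⟨hX e he b (right_mem_ends hab), hbA⟩

theorem eq_of_not_isSplit {X : Set (Leg K L)} (h : ¬ IsSplit X 0) :
    X = ∅ ∨ Xᶜ = ∅ ∨ ∃ i, X = {.inl i} ∨ Xᶜ = {.inl i} := by
  by_contra hcon
  push Not at hcon
  exact h (isSplit_zero_iff.2 ⟨hcon.1, hcon.2.1, hcon.2.2⟩)

section

variable [Finite V] [Nonempty V] [Fintype E] {α : E → ℝ} {κ : ℝ}
  (hG : G.IsMojetic Set.univ) (hR : G.BasicRequirements R)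
  (hα : ∀ T w, G.IsTerm T w → treeWeight R T + w = G.minWeight R → ∑ e, T.indicator α e = κ)

include hG hR hα

/-- A combination that is constant on the terms of minimal weight vanishes on the hard edges. -/
theorem eq_zero_of_hard (hn : ∀ _ : Fin K, 3 ≤ K + L ∧ (L = 0 → 4 ≤ K)) (hn2 : 2 ≤ K + L)
    (hmoj : ∀ i, G.IsMojetic (G.withoutJet R i)) (hsoft : IsEmpty (Fin K) → ∀ e, R e ≠ .soft)
    {e : E} (he : R e = .hard) : α e = 0 := by
  by_contra hne
  have hU := hR.connOn_hard
  have hends : ∀ e ∈ hardEdges R, ∀ v ∈ G.ends e, v ∈ G.hardVerts R :=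
    fun e he v hv => mem_hardVerts_of_hard he hv
  have hZ : G.ConnOn (hardEdges R) ∅ := fun _ h => h.elim
  have hconst : ∀ A, G.IsBond (hardEdges R) (G.hardVerts R) ∅ A →
      ∀ e ∈ hardEdges R, e ∈ G.cut A → ∀ e' ∈ hardEdges R, e' ∈ G.cut A → α e = α e' := by
    intro A hA
    refine const_of_trees hα hends (fun e he _ e' he' _ => ?_) fun e he hcut => ?_
    · rw [edgeWeight_hard he, edgeWeight_hard he']
    · obtain ⟨T, hT, heT, -, h1, h2⟩ := hA.exists_tree_hard hG he hcut hardEdges_subset subset_rfl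
        fun _ _ h => h
      exact ⟨T, hT, heT, h1, h2⟩
  -- Hard edges have weight 0, so a split with `w = 0`, for any choice of entries, would give `α e =
  -- 0`.
  have hsplit : ∀ A, G.IsBond (hardEdges R) (G.hardVerts R) ∅ A →
      G.ConstOnCut (hardEdges R) α (α e) A → ∀ h : Leg K L → V, (∀ ℓ, G.IsEntry R ℓ (h ℓ)) →
      {ℓ | h ℓ ∈ A} = ∅ ∨ {ℓ | h ℓ ∈ A}ᶜ = ∅ ∨
        ∃ i, {ℓ | h ℓ ∈ A} = {.inl i} ∨ {ℓ | h ℓ ∈ A}ᶜ = {.inl i} := by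
    intro A hA hcA h hh
    refine eq_of_not_isSplit fun hs => ?_
    obtain ⟨e', he', a, ha, b, hb, hab⟩ := hA.exists_cut hU
    obtain ⟨T, hT, heT, hside⟩ := hA.exists_tree_legSide hR hG he' ha hb.2 hab hh
    refine hne ((hcA e' he' ⟨a, ha, b, hb.2, hab⟩).symm.trans
      (hT.eq_zero_of_isSplit hα heT hab (x := a) ?_))
    rw [hside, edgeWeight_hard he']
    exact hs
  have hcompl : ∀ (A : Set V) (h : Leg K L → V), (∀ ℓ, G.IsEntry R ℓ (h ℓ)) →
      {ℓ | h ℓ ∈ G.hardVerts R \ A} = {ℓ | h ℓ ∈ A}ᶜ := fun A h hh => by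
    ext ℓ
    exact ⟨fun h => h.2, fun h => ⟨(hh ℓ).1, h⟩⟩
  have hupd : ∀ h : Leg K L → V, (∀ ℓ, G.IsEntry R ℓ (h ℓ)) → ∀ ℓ₀ p, G.IsEntry R ℓ₀ p →
      ∀ ℓ, G.IsEntry R ℓ (Function.update h ℓ₀ p ℓ) := by
    intro h hh ℓ₀ p hp ℓ
    by_cases hℓ : ℓ = ℓ₀
    · subst hℓ
      rwa [Function.update_self]
    · rw [Function.update_of_ne hℓ]
      exact hh ℓ
  choose h₀ hh₀ using hR.exists_isEntry (L := L)
  obtain ⟨u, v, huv⟩ := G.exists_ends e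
  obtain ⟨A₀, hA₀, hcut₀⟩ := exists_isBond (Z := ∅) hU hZ (Set.empty_subset _)
    (hends e he u (left_mem_ends huv)) (hends e he v (right_mem_ends huv)) (hG.ne_of_ends huv)
    (fun h => h.elim) huv
  have hcA₀ : G.ConstOnCut (hardEdges R) α (α e) A₀ :=
    fun e' he' hcut' => hconst A₀ hA₀ e' he' hcut' e he hcut₀
  -- Either `p_j` can be the only line entering some bond of this value, or all lines are always on
  -- one side. In each case the bond is grown with fixed entries, keeping its set of lines.
  by_cases hcase : ∃ A, G.IsBond (hardEdges R) (G.hardVerts R) ∅ A ∧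
      G.ConstOnCut (hardEdges R) α (α e) A ∧
      ∃ h : Leg K L → V, (∀ ℓ, G.IsEntry R ℓ (h ℓ)) ∧ ∃ j, {ℓ | h ℓ ∈ A} = {.inl j}
  · obtain ⟨A₁, hA₁, hcA₁, h, hh, j, hj⟩ := hcase
    have hnj := hn j
    obtain ⟨A, hA, hcA, hNA, hexit⟩ := exists_bond_single_exit (c := α e) hZ (Set.empty_subset _)
      hconst (fun A => {ℓ | h ℓ ∈ A} = {.inl j}) ⟨A₁, hA₁, hcA₁, hj⟩ (by
        intro A B₁ B₂ hA hN hn₁ hn₂ hdis hun _ k₁ k₂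
        replace k₁ := k₁ (Set.empty_subset _)
        replace k₂ := k₂ (Set.empty_subset _)
        by_contra hcon
        push Not at hcon
        -- If adding `B` brings in a second line, then at most one line, an on-shell one, remains
        -- outside.
        have hm : ∀ B : Set V, G.IsBond (hardEdges R) (G.hardVerts R) ∅ (A ∪ B) →
            G.ConstOnCut (hardEdges R) α (α e) (A ∪ B) → {ℓ | h ℓ ∈ A ∪ B} ≠ {.inl j} →
            {ℓ | h ℓ ∈ A ∪ B}ᶜ = ∅ ∨ ∃ m, {ℓ | h ℓ ∈ A ∪ B}ᶜ = {.inl m} := by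
          intro B hB hcB hne'
          have hjB : (.inl j : Leg K L) ∈ {ℓ | h ℓ ∈ A ∪ B} := Or.inl (by
            have : (.inl j : Leg K L) ∈ {ℓ | h ℓ ∈ A} := hN ▸ rfl
            exact this)
          rcases hsplit _ hB hcB h hh with h1 | h1 | ⟨m, h1 | h1⟩
          · rw [h1] at hjB
            exact hjB.elim
          · exact Or.inl h1
          · rw [h1] at hjB
            exact absurd (by rw [h1, Set.mem_singleton_iff.1 hjB]) hne'
          · exact Or.inr ⟨m, h1⟩
        have hcov : ∀ ℓ, ℓ ≠ .inl j → h ℓ ∉ A ∪ B₁ ∨ h ℓ ∉ A ∪ B₂ := by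
          intro ℓ hℓ
          have hℓA : h ℓ ∉ A := fun hmem => hℓ (by
            have : ℓ ∈ {ℓ | h ℓ ∈ A} := hmem
            rw [hN] at this
            exact this)
          by_contra hcc
          push Not at hcc
          exact Set.disjoint_left.1 hdis (hcc.1.resolve_left hℓA) (hcc.2.resolve_left hℓA)
        have hm' : ∀ B : Set V, ({ℓ | h ℓ ∈ A ∪ B}ᶜ = ∅ ∨ ∃ m, {ℓ | h ℓ ∈ A ∪ B}ᶜ = {.inl m}) →
            ∃ m, ∀ ℓ, h ℓ ∉ A ∪ B → ℓ = .inl m := by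
          rintro B (h1 | ⟨m, h1⟩)
          · refine ⟨j, fun ℓ hℓ => ?_⟩
            have : ℓ ∈ {ℓ | h ℓ ∈ A ∪ B}ᶜ := hℓ
            rw [h1] at this
            exact this.elim
          · refine ⟨m, fun ℓ hℓ => ?_⟩
            have : ℓ ∈ {ℓ | h ℓ ∈ A ∪ B}ᶜ := hℓ
            rw [h1] at this
            exact this
        obtain ⟨m₁, h1⟩ := hm' B₁ (hm B₁ k₁.1 k₁.2 (hcon.1 (Set.empty_subset _)))
        obtain ⟨m₂, h2⟩ := hm' B₂ (hm B₂ k₂.1 k₂.2 (hcon.2 (Set.empty_subset _)))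
        -- A line other than `p_j` lies outside `A ∪ B₁` or outside `A ∪ B₂`, so it would have to be
        -- one of the two exceptional ones.
        obtain ⟨ℓ, h3, h4, h5⟩ := exists_third_leg hnj j m₁ m₂
        rcases hcov ℓ h3 with h6 | h6
        · exact h4 (h1 ℓ h6)
        · exact h5 (h2 ℓ h6))
    obtain ⟨e₀, he₀, a, ha, x, hx, hax⟩ := hA.exists_cut hU
    -- As the vertex `x` does not cut H ∪ J \ J_j, a line other than `p_j` can enter in `A`.
    obtain ⟨ℓ, hℓ, p, hp, hent⟩ := hR.exists_isEntry_mem (hmoj j) hardPart_subset_withoutJet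
      (fun f hf => (edge_mem_withoutJet.1 hf).imp_right fun ⟨k, hk, hfk⟩ =>
        ⟨k, hfk, leg_mem_withoutJet fun h => hk (Sum.inl.inj h)⟩) hA.subset hA.nonempty hx
      fun f hf b hb y hy hby => (hexit f hf b hb y hy hby e₀ he₀ a ha x hx hax).resolve_right
        fun h => h.1
    have hℓj : ℓ ≠ .inl j := by
      rintro rfl
      rcases mem_withoutJet.1 hℓ with h | ⟨k, hk, h⟩
      · cases (show Mode.jet j = .hard from h)
      · exact hk (Mode.jet.inj (show Mode.jet j = .jet k from h)).symm
    have hset : {ℓ' | Function.update h ℓ p ℓ' ∈ A} = {.inl j, ℓ} := by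
      ext ℓ'
      by_cases hℓ' : ℓ' = ℓ
      · subst hℓ'
        simp [hp]
      · have : h ℓ' ∈ A ↔ ℓ' = .inl j := by
          rw [← Set.mem_singleton_iff, ← hNA]
          rfl
        simp [hℓ', this]
    have hres := hsplit A hA hcA _ (hupd h hh ℓ p hent)
    rw [hset] at hres
    rcases ℓ with k | q
    · refine absurd (isSplit_pair (K := K) (L := L) hnj (fun h => hℓj (by rw [h]) : j ≠ k))
        fun hs => ?_
      obtain ⟨s1, s2, s3⟩ := isSplit_zero_iff.1 hs
      rcases hres with h1 | h1 | ⟨i, h1 | h1⟩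
      · exact s1.ne_empty h1
      · exact s2.ne_empty h1
      · exact (s3 i).1 h1
      · exact (s3 i).2 h1
    -- A line `q` has only one possible entry, so it would have been in `A` from the start.
    · have hq : h (.inr q) = p := by
        have key : ∀ p, G.IsEntry R (.inr q) p → G.att (.inr q) = p := by
          rintro p ⟨-, h | ⟨k, h, -⟩⟩
          · exact h
          · cases h
        exact (key _ (hh _)).symm.trans (key _ hent)
      have : (.inr q : Leg K L) ∈ {ℓ | h ℓ ∈ A} := by
        rw [← hq] at hp
        exact hp
      rw [hNA] at this
      exact hℓj this
  · push Not at hcase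
    have htriv : ∀ A, G.IsBond (hardEdges R) (G.hardVerts R) ∅ A →
        G.ConstOnCut (hardEdges R) α (α e) A → ∀ h : Leg K L → V, (∀ ℓ, G.IsEntry R ℓ (h ℓ)) →
        {ℓ | h ℓ ∈ A} = ∅ ∨ {ℓ | h ℓ ∈ A}ᶜ = ∅ := by
      intro A hA hcA h hh
      rcases hsplit A hA hcA h hh with h1 | h1 | ⟨m, h1 | h1⟩
      · exact Or.inl h1
      · exact Or.inr h1
      · exact absurd h1 (hcase A hA hcA h hh m)
      · exact absurd ((hcompl A h hh).trans h1) (hcase _ hA.compl (hcA.compl hends) h hh m)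
    have h0 : ∃ A, G.IsBond (hardEdges R) (G.hardVerts R) ∅ A ∧
        G.ConstOnCut (hardEdges R) α (α e) A ∧ {ℓ | h₀ ℓ ∈ A} = ∅ := by
      rcases htriv A₀ hA₀ hcA₀ h₀ hh₀ with h1 | h1
      · exact ⟨A₀, hA₀, hcA₀, h1⟩
      · exact ⟨_, hA₀.compl, hcA₀.compl hends, (hcompl A₀ h₀ hh₀).trans h1⟩
    obtain ⟨A, hA, hcA, hNA, hexit⟩ := exists_bond_single_exit (c := α e) hZ (Set.empty_subset _)
      hconst (fun A => {ℓ | h₀ ℓ ∈ A} = ∅) h0 (by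
        intro A B₁ B₂ hA hN hn₁ hn₂ hdis hun _ k₁ k₂
        replace k₁ := k₁ (Set.empty_subset _)
        -- If `A ∪ B₁` contains all entries, then `B₁` does, and `B₂` may be added instead.
        refine (htriv _ k₁.1 k₁.2 h₀ hh₀).imp (fun h => ⟨Set.empty_subset _, h⟩) fun h =>
          ⟨Set.empty_subset _, ?_⟩
        rw [Set.compl_empty_iff] at h
        rw [Set.eq_empty_iff_forall_notMem] at hN ⊢
        intro ℓ hℓ
        have h1 : ℓ ∈ {ℓ | h₀ ℓ ∈ A ∪ B₁} := h ▸ trivial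
        exact Set.disjoint_left.1 hdis (Or.resolve_left h1 (hN ℓ)) (Or.resolve_left hℓ (hN ℓ)))
    obtain ⟨e₀, he₀, a, ha, x, hx, hax⟩ := hA.exists_cut hU
    have hexit' : ∀ f ∈ hardEdges R, ∀ b ∈ A, ∀ y ∈ G.hardVerts R \ A, G.ends f = s(b, y) → y = x :=
      fun f hf b hb y hy hby => (hexit f hf b hb y hy hby e₀ he₀ a ha x hx hax).resolve_right
        fun h => h.1
    obtain ⟨ℓ, p, hp, hent⟩ : ∃ ℓ, ∃ p ∈ A, G.IsEntry R ℓ p := by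
      -- Without jets there are no soft edges either, and mojeticity of the whole graph is used.
      rcases isEmpty_or_nonempty (Fin K) with hK | ⟨⟨i⟩⟩
      · obtain ⟨ℓ, -, h⟩ := hR.exists_isEntry_mem hG (Set.subset_univ _) (fun f _ => by
          rcases hf : R f with _ | k | _
          · exact Or.inl rfl
          · exact hK.elim k
          · exact absurd hf (hsoft hK f)) hA.subset hA.nonempty hx hexit'
        exact ⟨ℓ, h⟩
      · obtain ⟨ℓ, -, h⟩ := hR.exists_isEntry_mem (hmoj i) hardPart_subset_withoutJet
          (fun f hf => (edge_mem_withoutJet.1 hf).imp_right fun ⟨k, hk, hfk⟩ =>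
            ⟨k, hfk, leg_mem_withoutJet fun h => hk (Sum.inl.inj h)⟩) hA.subset hA.nonempty hx
          hexit'
        exact ⟨ℓ, h⟩
    -- Moving the entry of `ℓ` alone into `A` gives a set of lines that is neither empty nor, by `2
    -- ≤ K + L`, everything.
    have hset : {ℓ' | Function.update h₀ ℓ p ℓ' ∈ A} = {ℓ} := by
      ext ℓ'
      by_cases hℓ' : ℓ' = ℓ
      · subst hℓ'
        simp [hp]
      · have : h₀ ℓ' ∉ A := fun h => (Set.eq_empty_iff_forall_notMem.1 hNA) ℓ' h
        simp [hℓ', this]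
    have hres := htriv A hA hcA _ (hupd h₀ hh₀ ℓ p hent)
    rw [hset] at hres
    rcases hres with h1 | h1
    · exact Set.singleton_ne_empty _ h1
    · rw [Set.compl_empty_iff] at h1
      have := congrArg Set.ncard h1
      rw [Set.ncard_singleton, Set.ncard_univ, Nat.card_eq_fintype_card, Fintype.card_sum,
        Fintype.card_fin, Fintype.card_fin] at this
      omega

end

end FeynmanGraph

/-! ### The equivalence -/

theorem theorem3 {V E M : Type*} [Fintype V] [Nonempty V] [Fintype E]
    [AddCommGroup M] [Module ℝ M] {K L : ℕ}
    (G : FeynmanGraph V E K L) (hG : G.IsMojetic Set.univ)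
    (Q : QuadraticForm ℝ M) (k : Leg K L → ℝ → M) (hk : WideAngle Q k)
    (R : E → Mode K) (hR : G.BasicRequirements R) :
    G.IsRegion Q k R ↔
      (∀ i : Fin K, G.IsMojetic (G.hardPart R ∪ ⋃ (j : Fin K) (_ : j ≠ i), G.jetPart R j)) ∧
      (∀ C, G.IsComponent (G.softPart R) C →
        ∃ i j : Fin K, i ≠ j ∧
          G.Attached C (G.jetPart R i) ∧ G.Attached C (G.jetPart R j)) := by
  obtain ⟨F₁, F₂, h1X, h1r, h12, h2, h2X, h2r, -⟩ := hR.exists_nonsoftForest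
  obtain ⟨T, hT, -⟩ := FeynmanGraph.exists_isMinTree h1X h1r h12 h2 h2X h2r (Set.subset_univ _)
    hG.reach_univ
  rw [FeynmanGraph.isRegion_iff hk R (fun _ _ h => h.minWeight_le hR)
    ⟨T, 0, Or.inl ⟨hT.1, rfl⟩, hT.treeWeight_eq⟩]
  refine ⟨fun H => ⟨fun i => FeynmanGraph.isMojetic_withoutJet_of_forall hR (hk.three_le i) H i,
    fun C hC => FeynmanGraph.exists_attached_of_forall hG hR H hC⟩, ?_⟩
  rintro ⟨hmoj, hsoft⟩ α ⟨κ, hα⟩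
  have hn2 : 2 ≤ K + L := by
    obtain ⟨i | j⟩ := hG.nonempty_leg
    · exact hk.two_le (by have := i.pos; omega)
    · exact hk.two_le (by have := j.pos; omega)
  -- With fewer than two jets the second condition leaves no room for soft edges, and the whole
  -- graph can replace H ∪ J \ J_j in the arguments for jets and hard edges.
  have hnosoft : (∀ i j : Fin K, i = j) → ∀ e, R e ≠ .soft := by
    intro hK e he
    obtain ⟨C, hC, -⟩ := G.exists_isComponent (γ := G.softPart R) (x := .inr (.inl e)) he
    obtain ⟨i, j, hij, -⟩ := hsoft C hC
    exact hij (hK i j)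
  have hjet : ∀ e i, R e = .jet i → α e = 0 := fun e i he => by
    refine FeynmanGraph.eq_zero_of_jet hG hR hα hn2 (fun i => ?_) he
    by_cases hi : ∃ j, j ≠ i
    · obtain ⟨j, hj⟩ := hi
      exact ⟨G.withoutJet R j, hmoj j, FeynmanGraph.hardPart_subset_withoutJet,
        FeynmanGraph.jetPart_subset_withoutJet hj.symm,
        fun e he => FeynmanGraph.edge_nonsoft_of_mem_withoutJet he⟩
    · push Not at hi
      exact ⟨Set.univ, hG, Set.subset_univ _, Set.subset_univ _,
        fun e _ => hnosoft (fun a b => (hi a).trans (hi b).symm) e⟩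
  funext e
  rcases he : R e with _ | i | _
  · exact FeynmanGraph.eq_zero_of_hard hG hR hα hk.three_le hn2 hmoj
      (fun hK => hnosoft fun i => hK.elim i) he
  · exact hjet e i he
  · exact FeynmanGraph.eq_zero_of_soft hG hR hα hk.three_le hjet hsoft he
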